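/- **Proposition 3.8.** Let $p>3$ be a prime. Write $C_n$ for the cyclic group of order $n$, write $2D_n$ for the binary dihedral group $\langle a,x \mid a^{2n}=1,\ x^2=a^n,\ x^{-1}ax=a^{-1}\rangle$ of order $4n$, and write $2A_4$, $2S_4$, $2A_5$ for the binary tetrahedral, octahedral and icosahedral groups, of orders $24$, $48$, $120$ (the preimages in the group of unit quaternions of the rotation groups of the regular tetrahedron, octahedron and icosahedron). For each of these groups $K$, "a conjugacy class $K$" means an $\mathbf{SL}_2(\mathbf{F}_p)$-conjugacy class of subgroups of $\mathbf{SL}_2(\mathbf{F}_p)$ that are isomorphic to $K$. Up to conjugacy in $\mathbf{SL}_2(\mathbf{F}_p)$, the subgroups of $\mathbf{SL}_2(\mathbf{F}_p)$ of order prime to $p$ are exactly the following, and the isomorphism types listed do not overlap: - for each integer $n\ge 1$ with $p\equiv\pm1\bmod n$, a single conjugacy class $C_n$; - for each integer $n>1$ with $p\equiv\pm1\bmod 4n$, two conjugacy classes $2D_n$; - for each integer $n>1$ with $p\equiv\pm1\bmod 2n$ and $p\not\equiv\pm1\bmod 4n$, a single conjugacy class $2D_n$; - two conjugacy classes $2A_4$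 if $p\equiv\pm1\bmod 8$, and one otherwise; - two conjugacy classes $2S_4$ if $p\equiv\pm1\bmod 8$, and none otherwise; - two conjugacy classes $2A_5$ if $p\equiv\pm1\bmod 5$, and none otherwise. Moreover $2A_5\simeq \mathbf{SL}_2(\mathbf{F}_5)$. All the counts are of classes of subgroups of order prime to $p$. -/

import Mathlib

open scoped MatrixGroups

/-- `p ≡ ±1 mod m`. -/
def CongPM (p m : ℕ) : Prop :=
  (p : ℤ) ≡ 1 [ZMOD (m : ℤ)] ∨ (p : ℤ) ≡ -1 [ZMOD (m : ℤ)]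

/-- The group of nonzero real quaternions generated by two given ones. -/
noncomputable def quaternionSubgroup (s t : Quaternion ℝ) : Subgroup (Quaternion ℝ)ˣ :=
  Subgroup.closure {u | (u : Quaternion ℝ) = s ∨ (u : Quaternion ℝ) = t}

/-- The binary tetrahedral group `2A₄` (of order 24), the double cover of the rotation group of the
tetrahedron, generated by the unit quaternions `(1+i+j+k)/2` and `(1+i+j-k)/2`. -/
noncomputable abbrev BinaryTetrahedral : Subgroup (Quaternion ℝ)ˣ :=
  quaternionSubgroup ⟨1 / 2, 1 / 2, 1 / 2, 1 / 2⟩ ⟨1 / 2, 1 / 2, 1 / 2, -1 / 2⟩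

/-- The binary octahedral group `2S₄` (of order 48), the double cover of the rotation group of the
octahedron, generated by the unit quaternions `(1+i+j+k)/2` and `(1+i)/√2`. -/
noncomputable abbrev BinaryOctahedral : Subgroup (Quaternion ℝ)ˣ :=
  quaternionSubgroup ⟨1 / 2, 1 / 2, 1 / 2, 1 / 2⟩ ⟨1 / Real.sqrt 2, 1 / Real.sqrt 2, 0, 0⟩

/-- The binary icosahedral group `2A₅` (of order 120), the double cover of the rotation group of the
icosahedron, generated by the unit quaternions `(1+i+j+k)/2` and `(φ+φ⁻¹i+j)/2`, with `φ` the
golden ratio. -/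
noncomputable abbrev BinaryIcosahedral : Subgroup (Quaternion ℝ)ˣ :=
  quaternionSubgroup ⟨1 / 2, 1 / 2, 1 / 2, 1 / 2⟩
    ⟨Real.goldenRatio / 2, Real.goldenRatio⁻¹ / 2, 1 / 2, 0⟩

/-- The labels `C_n`, `2D_n`, `2A₄`, `2S₄`, `2A₅`. -/
inductive SubgroupType : Type
  | C (n : ℕ)
  | twoD (n : ℕ)
  | twoA4
  | twoS4
  | twoA5

/-- The group `H` is isomorphic to the group with the given label. Here `C_n` is the cyclic group
of order `n ≥ 1` and `2D_n` is the binary dihedral (dicyclic) group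
`⟨a, x | a^(2n) = 1, x² = a^n, x⁻¹ a x = a⁻¹⟩` of order `4n`, called `QuaternionGroup n` in
Mathlib. -/
def HasType (H : Type) [Group H] : SubgroupType → Prop
  | .C n => Nonempty (H ≃* Multiplicative (ZMod n))
  | .twoD n => Nonempty (H ≃* QuaternionGroup n)
  | .twoA4 => Nonempty (H ≃* BinaryTetrahedral)
  | .twoS4 => Nonempty (H ≃* BinaryOctahedral)
  | .twoA5 => Nonempty (H ≃* BinaryIcosahedral)

/-- The labels that appear in the classification for the prime `p`. -/
def Listed (p : ℕ) : SubgroupType → Prop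
  | .C n => 1 ≤ n ∧ CongPM p n
  | .twoD n => 2 < 2 * n ∧ CongPM p (2 * n)
  | .twoA4 => True
  | .twoS4 => CongPM p 8
  | .twoA5 => CongPM p 5

/-- The `SL₂(𝔽_p)`-conjugacy classes of subgroups of `SL₂(𝔽_p)`: the orbits of the
conjugation action on the set of subgroups. -/
abbrev SL2SubgroupClass (p : ℕ) : Type :=
  open scoped Pointwise in
  MulAction.orbitRel.Quotient (ConjAct SL(2, ZMod p)) (Subgroup SL(2, ZMod p))

/-- The number of `SL₂(𝔽_p)`-conjugacy classes of subgroups of `SL₂(𝔽_p)` of order prime to `p`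
which have the given label. -/
noncomputable def numClasses (p : ℕ) (τ : SubgroupType) : ℕ :=
  Set.ncard {c : SL2SubgroupClass p | ∃ H : Subgroup SL(2, ZMod p),
    Quotient.mk _ H = c ∧ (Nat.card H).Coprime p ∧ HasType H τ}

/-! In a subgroup `H` of order prime to `p` only `±1` have trace `±2`. Over an algebraic closure
every other element is therefore diagonalizable with two distinct eigenlines. An ordered pair of
eigenlines is encoded by an axis, a traceless `J` with `J² = 1` commuting with the element. Axes
play the role of the poles of a finite rotation group: noncentral elements fix exactly two of them,
`J` and `-J`, stabilizers are cyclic, and Burnside's lemma leaves zero, two or three orbits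
(`axes_classification`). Zero or two orbits make `H` cyclic. Three orbits have stabilizers of orders
`(2,2,n)`, `(2,3,3)`, `(2,3,4)` or `(2,3,5)` modulo `±1`, the binary dihedral and polyhedral cases.

Polyhedral groups are recognized by traces: `H` contains `s`, `t` with traces `1`, `τ` and with `s
t` of trace `0`, where `τ = 1`, `τ² = 2` or `τ² = τ + 1` (`IsPolyhedral.exists_pair`). Pairs with
prescribed traces exist over `𝔽_p` (`exists_pair_with_traces`) and, when irreducible, are unique up
to `GL₂` by Skolem-Noether (`TracePair.exists_conj`). The group they generate is isomorphic to the
quaternion group with the same traces (`nonempty_closure_mulEquiv`): if a unit quaternion `g` of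
that group reduces to `1` modulo `p`, the norm of `g - 1` is a quadratic integer whose conjugates
lie in `[0, 4]` and whose integral norm is divisible by `p² ≥ 25`, hence `g = 1`.

The congruences come from Frobenius, which maps an eigenvalue `e` of an element of `SL₂(𝔽_p)` to `e`
or `e⁻¹`. An order prime to `p` thus divides `p - 1` or `p + 1`, and conversely `ζ + ζ⁻¹` lies in
`𝔽_p` for the corresponding roots of unity.

Subgroups of one type are conjugate under `GL₂(𝔽_p)`, and this class splits into two classes under
`SL₂(𝔽_p)` exactly when all elements of `GL₂` normalizing the subgroup have square determinant
(`numClasses_eq`). For `C_n` the centralizer already contains all determinants. For `2D_n` with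
rotation `a` the element `1 + a` normalizes and has determinant `2 + tr a`, which is a square
exactly when `a` is the square of an element of order `4n`. The groups `2S₄` and `2A₅` are
normalized only by themselves and scalars, while `2A₄` is also normalized by `s t - t s`, of
determinant `2`. Finally `2A₅ ≃ SL₂(𝔽₅)` is the comparison with quaternions at `p = 5`. -/

/-! ### The algebra generated by two elements with given traces. -/

/-- The relations satisfied by two matrices of determinant one with traces `x`, `y` whose product
has trace `z`. -/
structure TracePair {C A : Type*} [CommRing C] [Ring A] [Algebra C A] (x y z : C) (s t : A) :
    Prop where
  sq_left : s * s = x • s - 1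
  sq_right : t * t = y • t - 1
  swap : t * s = -(s * t) + x • t + y • s + (z - x * y) • (1 : A)

/-- The combination `a + b s + c t + d s t`. -/
def combo {C A : Type*} [CommRing C] [Ring A] [Algebra C A] (s t : A) (a b c d : C) : A :=
  a • (1 : A) + b • s + c • t + d • (s * t)

namespace TracePair

section Ring

variable {C A : Type*} [CommRing C] [Ring A] [Algebra C A] {x y z : C} {s t : A}

theorem left_mul (h : TracePair x y z s t) (w : A) : s * (s * w) = x • (s * w) - w := by
  rw [← mul_assoc, h.sq_left, sub_mul, smul_mul_assoc, one_mul]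

theorem swap_mul (h : TracePair x y z s t) (w : A) :
    t * (s * w) = -(s * (t * w)) + x • (t * w) + y • (s * w) + (z - x * y) • w := by
  rw [← mul_assoc, h.swap]
  simp only [add_mul, neg_mul, smul_mul_assoc, one_mul, mul_assoc]

/-- Right multiplication by a generator acts on coordinates by formulas that involve only the three
traces. Hence computations carry over between any two pairs with the same traces, even in different
algebras. -/
theorem combo_mul_left (h : TracePair x y z s t) (a b c d : C) :
    combo s t a b c d * s =
      combo s t (-b + c * (z - x * y) - y * d) (a + x * b + y * c + z * d) (x * c + d) (-c) := by
  simp only [combo, add_mul, smul_mul_assoc, one_mul, mul_assoc, h.swap, h.sq_left, mul_add,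
    mul_smul_comm, mul_neg, h.left_mul, mul_one]
  module

theorem combo_mul_right (h : TracePair x y z s t) (a b c d : C) :
    combo s t a b c d * t = combo s t (-c) (-d) (a + y * c) (b + y * d) := by
  simp only [combo, add_mul, smul_mul_assoc, one_mul, mul_assoc, h.sq_right, mul_sub,
    mul_smul_comm, mul_one]
  module

/-- The square of the commutator is the scalar given by the Fricke polynomial of the traces. When
that scalar is a unit the commutator is invertible, and the pair is irreducible. -/
theorem comm_mul_comm (h : TracePair x y z s t) :
    (s * t - t * s) * (s * t - t * s) = (x ^ 2 + y ^ 2 + z ^ 2 - x * y * z - 4) • (1 : A) := by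
  simp only [h.swap, sub_mul, mul_sub, mul_add, add_mul, mul_neg, neg_mul, smul_mul_assoc,
    mul_smul_comm, one_mul, mul_one, mul_assoc, h.sq_left, h.sq_right, h.left_mul,
    h.swap_mul, smul_add, smul_sub, smul_neg, neg_add, neg_sub]
  module

end Ring

section Field

variable {C A : Type*} [Field C] [Ring A] [Algebra C A] {x y z : C} {s t : A}

/-- Commutators with `s` and `t` strip off the coefficients one at a time, each leaving a multiple
of `m = s t - t s`. This `m` can be cancelled because `m²` is a nonzero scalar. -/
theorem combo_eq_zero [Nontrivial A] (h : TracePair x y z s t)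
    (hk : x ^ 2 + y ^ 2 + z ^ 2 - x * y * z - 4 ≠ 0) {a b c d : C} (h0 : combo s t a b c d = 0) :
    a = 0 ∧ b = 0 ∧ c = 0 ∧ d = 0 := by
  set m := s * t - t * s with hm
  have key : ∀ w : A, w * m = 0 → w = 0 := by
    intro w hw
    have h1 : w * (m * m) = 0 := by rw [← mul_assoc, hw, zero_mul]
    rw [h.comm_mul_comm, mul_smul_comm, mul_one] at h1
    exact (smul_eq_zero.1 h1).resolve_left hk
  have m0 : m ≠ 0 := by
    intro h1
    have h2 := h.comm_mul_comm
    rw [← hm, h1, mul_zero] at h2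
    exact hk ((smul_eq_zero.1 h2.symm).resolve_right one_ne_zero)
  have e1 : (c • (1 : A) + d • s) * m = 0 := by
    have : s * combo s t a b c d - combo s t a b c d * s = (c • (1 : A) + d • s) * m := by
      simp only [combo, hm]; simp only [mul_add, add_mul, smul_mul_assoc, mul_smul_comm, mul_assoc,
        mul_one, one_mul, mul_sub]
      module
    rw [← this, h0]; simp
  have e2 := key _ e1
  have e3 : d • m = 0 := by
    have : (c • (1 : A) + d • s) * t - t * (c • (1 : A) + d • s) = d • m := by
      simp only [hm, mul_add, add_mul, smul_mul_assoc, mul_smul_comm, mul_one, one_mul]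
      module
    rw [← this, e2]; simp
  have hd : d = 0 := (smul_eq_zero.1 e3).resolve_right m0
  subst hd
  have hc : c = 0 := by
    rw [zero_smul, add_zero] at e2
    exact (smul_eq_zero.1 e2).resolve_right one_ne_zero
  subst hc
  have e4 : b • m = 0 := by
    have : combo s t a b 0 0 * t - t * combo s t a b 0 0 = b • m := by
      simp only [combo, hm, mul_add, add_mul, smul_mul_assoc, mul_smul_comm, mul_one, one_mul,
        zero_smul, add_zero]
      module
    rw [← this, h0]; simp
  have hb : b = 0 := (smul_eq_zero.1 e4).resolve_right m0
  subst hb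
  refine ⟨?_, rfl, rfl, rfl⟩
  simpa [combo] using h0

theorem combo_injective [Nontrivial A] (h : TracePair x y z s t)
    (hk : x ^ 2 + y ^ 2 + z ^ 2 - x * y * z - 4 ≠ 0) {a b c d a' b' c' d' : C}
    (h0 : combo s t a b c d = combo s t a' b' c' d') :
    a = a' ∧ b = b' ∧ c = c' ∧ d = d' := by
  have h1 : combo s t (a - a') (b - b') (c - c') (d - d') = 0 := by
    rw [← sub_eq_zero.2 h0]; simp only [combo]; module
  obtain ⟨e1, e2, e3, e4⟩ := h.combo_eq_zero hk h1
  exact ⟨sub_eq_zero.1 e1, sub_eq_zero.1 e2, sub_eq_zero.1 e3, sub_eq_zero.1 e4⟩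

end Field

end TracePair

/-! ### Pairs in `SL₂`: Cayley-Hamilton, conjugation by `GL₂`, existence and uniqueness for given
traces. -/

/-- The polarised Cayley-Hamilton identity for `2 × 2` matrices. -/
theorem Matrix.mul_add_mul_fin_two {C : Type*} [CommRing C] (g h : Matrix (Fin 2) (Fin 2) C) :
    h * g = -(g * h) + g.trace • h + h.trace • g
      + ((g * h).trace - g.trace * h.trace) • (1 : Matrix (Fin 2) (Fin 2) C) := by
  ext i j
  fin_cases i <;> fin_cases j <;>
    simp [Matrix.mul_apply, Fin.sum_univ_two, Matrix.trace_fin_two] <;> ring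

theorem Matrix.mul_self_fin_two {C : Type*} [CommRing C] (g : Matrix (Fin 2) (Fin 2) C) :
    g * g = g.trace • g - g.det • (1 : Matrix (Fin 2) (Fin 2) C) := by
  ext i j
  fin_cases i <;> fin_cases j <;>
    simp [Matrix.mul_apply, Fin.sum_univ_two, Matrix.trace_fin_two, Matrix.det_fin_two] <;> ring

theorem Matrix.SpecialLinearGroup.tracePair {C : Type*} [CommRing C] (s t : SL(2, C)) :
    TracePair (s : Matrix (Fin 2) (Fin 2) C).trace (t : Matrix (Fin 2) (Fin 2) C).trace
      ((s : Matrix (Fin 2) (Fin 2) C) * t).trace (s : Matrix (Fin 2) (Fin 2) C) t where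
  sq_left := by rw [Matrix.mul_self_fin_two, s.2, one_smul]
  sq_right := by rw [Matrix.mul_self_fin_two, t.2, one_smul]
  swap := Matrix.mul_add_mul_fin_two _ _

/-- The automorphism `s ↦ g s g⁻¹` of `SL₂` given by an element `g` of `GL₂`. -/
def glConj {C : Type*} [CommRing C] (g : GL (Fin 2) C) : SL(2, C) ≃* SL(2, C) where
  toFun s := ⟨(g : Matrix (Fin 2) (Fin 2) C) * s * (g⁻¹ : GL (Fin 2) C), by
    rw [Matrix.det_mul, Matrix.det_mul, s.2, mul_one, ← Matrix.det_mul, ← Units.val_mul]; simp⟩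
  invFun s := ⟨((g⁻¹ : GL (Fin 2) C) : Matrix (Fin 2) (Fin 2) C) * s * g, by
    rw [Matrix.det_mul, Matrix.det_mul, s.2, mul_one, ← Matrix.det_mul, ← Units.val_mul]; simp⟩
  left_inv s := Subtype.ext <| by simp [mul_assoc]
  right_inv s := Subtype.ext <| by simp [mul_assoc]
  map_mul' s t := Subtype.ext <| by
    change (g : Matrix (Fin 2) (Fin 2) C) * ((s : Matrix (Fin 2) (Fin 2) C) * t) *
      (g⁻¹ : GL (Fin 2) C) = (g * s * (g⁻¹ : GL (Fin 2) C)) * (g * t * (g⁻¹ : GL (Fin 2) C))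
    simp [mul_assoc]

section

variable {C : Type*} [CommRing C]

theorem coe_glConj (g : GL (Fin 2) C) (s : SL(2, C)) :
    (glConj g s : Matrix (Fin 2) (Fin 2) C) =
      (g : Matrix (Fin 2) (Fin 2) C) * s * (g⁻¹ : GL (Fin 2) C) := rfl

theorem glConj_mul (g h : GL (Fin 2) C) (s : SL(2, C)) :
    glConj (g * h) s = glConj g (glConj h s) := by
  exact Subtype.ext <| by simp [coe_glConj, mul_assoc]

theorem glConj_coe (g s : SL(2, C)) :
    glConj (g : GL (Fin 2) C) s = g * s * g⁻¹ := by
  apply Subtype.ext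
  have h : (((g : GL (Fin 2) C)⁻¹ : GL (Fin 2) C) : Matrix (Fin 2) (Fin 2) C)
      = ((g⁻¹ : SL(2, C)) : Matrix (Fin 2) (Fin 2) C) := by
    rw [← map_inv]; rfl
  rw [coe_glConj, h]; simp

theorem glConj_eq_iff (g : GL (Fin 2) C) (s t : SL(2, C)) :
    glConj g s = t ↔ (g : Matrix (Fin 2) (Fin 2) C) * s = t * (g : Matrix (Fin 2) (Fin 2) C) := by
  rw [← Units.mul_inv_eq_iff_eq_mul, ← coe_glConj]
  exact Subtype.ext_iff

theorem trace_glConj (g : GL (Fin 2) C) (s : SL(2, C)) :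
    (glConj g s : Matrix (Fin 2) (Fin 2) C).trace = (s : Matrix (Fin 2) (Fin 2) C).trace := by
  rw [coe_glConj, Matrix.trace_mul_comm, ← mul_assoc, ← Units.val_mul]; simp

end

/-- Two irreducible pairs with the same traces are conjugate under `GL₂`. -/
theorem TracePair.exists_conj {F : Type*} [Field F] {x y z : F}
    {s t s' t' : Matrix (Fin 2) (Fin 2) F}
    (h : TracePair x y z s t) (h' : TracePair x y z s' t')
    (hk : x ^ 2 + y ^ 2 + z ^ 2 - x * y * z - 4 ≠ 0) :
    ∃ g : GL (Fin 2) F, (g : Matrix (Fin 2) (Fin 2) F) * s = s' * g ∧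
      (g : Matrix (Fin 2) (Fin 2) F) * t = t' * g := by
  let E := fun (s t : Matrix (Fin 2) (Fin 2) F) ↦ show (Fin 4 → F) →ₗ[F] Matrix (Fin 2) (Fin 2) F from
    { toFun := fun v => combo s t (v 0) (v 1) (v 2) (v 3)
      map_add' := fun v w => by simp only [combo, Pi.add_apply]; module
      map_smul' := fun c v => by
        simp only [combo, Pi.smul_apply, smul_eq_mul, RingHom.id_apply]; module }
  have hE : ∀ {s t : Matrix (Fin 2) (Fin 2) F}, TracePair (A := Matrix (Fin 2) (Fin 2) F) x y z s t → Function.Bijective (E s t) := by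
    intro s t h
    have hi : Function.Injective (E s t) := by
      rw [injective_iff_map_eq_zero]
      intro v hv
      obtain ⟨e0, e1, e2, e3⟩ := h.combo_eq_zero hk hv
      ext i; fin_cases i <;> assumption
    exact ⟨hi, (LinearMap.injective_iff_surjective_of_finrank_eq_finrank
      (by simp [Module.finrank_matrix])).1 hi⟩
  let e := LinearEquiv.ofBijective (E s t) (hE h)
  let e' := LinearEquiv.ofBijective (E s' t') (hE h')
  -- Matching coordinates in the two bases `1, s, t, s t` respects right multiplication by the
  -- generators, so this linear map is an algebra automorphism.
  let φ := e.symm.trans e'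
  have hφ : ∀ a b c d : F, φ (combo s t a b c d) = combo s' t' a b c d := by
    intro a b c d
    have : combo s t a b c d = e ![a, b, c, d] := rfl
    rw [this, LinearEquiv.trans_apply, e.symm_apply_apply]; rfl
  have hsurj : ∀ w, ∃ a b c d : F, w = combo s t a b c d := fun w => by
    obtain ⟨v, rfl⟩ := (hE h).2 w
    exact ⟨_, _, _, _, rfl⟩
  have φs : ∀ w, φ (w * s) = φ w * s' := by
    intro w
    obtain ⟨a, b, c, d, rfl⟩ := hsurj w
    rw [h.combo_mul_left, hφ, hφ, h'.combo_mul_left]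
  have φt : ∀ w, φ (w * t) = φ w * t' := by
    intro w
    obtain ⟨a, b, c, d, rfl⟩ := hsurj w
    rw [h.combo_mul_right, hφ, hφ, h'.combo_mul_right]
  have φ1 : φ 1 = 1 := by
    have := hφ 1 0 0 0
    simpa [combo] using this
  have φs' : φ s = s' := by simpa [φ1] using φs 1
  have φt' : φ t = t' := by simpa [φ1] using φt 1
  have φmul : ∀ w w', φ (w * w') = φ w * φ w' := by
    intro w w'
    obtain ⟨a, b, c, d, rfl⟩ := hsurj w'
    rw [hφ]
    simp only [combo, mul_add, map_add, mul_smul_comm, map_smul, mul_one, ← mul_assoc, φs, φt]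
  let f : Matrix (Fin 2) (Fin 2) F ≃ₐ[F] Matrix (Fin 2) (Fin 2) F :=
    AlgEquiv.ofLinearEquiv φ φ1 φmul
  let τ := Matrix.toLinAlgEquiv' (R := F) (n := Fin 2)
  -- Skolem-Noether: automorphisms of the full endomorphism algebra are inner.
  obtain ⟨T, hT⟩ := ((τ.symm.trans f).trans τ).eq_linearEquivConjAlgEquiv
  have hT' : ∀ w, LinearMap.toMatrix' (T : (Fin 2 → F) →ₗ[F] (Fin 2 → F)) * w
      = φ w * LinearMap.toMatrix' (T : (Fin 2 → F) →ₗ[F] (Fin 2 → F)) := by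
    intro w
    have h1 := DFunLike.congr_fun hT (τ w)
    have h2 : τ (φ w) = (T : (Fin 2 → F) →ₗ[F] (Fin 2 → F)) ∘ₗ τ w ∘ₗ
        (T.symm : (Fin 2 → F) →ₗ[F] (Fin 2 → F)) := by
      simpa [f, LinearEquiv.conjAlgEquiv_apply] using h1
    have h3 : (T : (Fin 2 → F) →ₗ[F] (Fin 2 → F)) ∘ₗ Matrix.toLin' w
        = Matrix.toLin' (φ w) ∘ₗ (T : (Fin 2 → F) →ₗ[F] (Fin 2 → F)) := by
      have : Matrix.toLin' (φ w) = τ (φ w) := rfl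
      have this' : Matrix.toLin' w = τ w := rfl
      rw [this, h2, this']
      refine LinearMap.ext fun v => ?_
      simp only [LinearMap.comp_apply, LinearEquiv.coe_coe, LinearEquiv.symm_apply_apply]
    have h4 := congrArg LinearMap.toMatrix' h3
    simpa [LinearMap.toMatrix'_comp] using h4
  let X : GL (Fin 2) F :=
    ⟨LinearMap.toMatrix' (T : (Fin 2 → F) →ₗ[F] (Fin 2 → F)),
      LinearMap.toMatrix' (T.symm : (Fin 2 → F) →ₗ[F] (Fin 2 → F)),
      by rw [← LinearMap.toMatrix'_comp]; simp, by rw [← LinearMap.toMatrix'_comp]; simp⟩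
  exact ⟨X, by simpa [φs'] using hT' s, by simpa [φt'] using hT' t⟩

/-- There are pairs of elements of `SL₂` over a finite field of odd order with prescribed traces. -/
theorem exists_pair_with_traces {F : Type*} [Field F] [Finite F] (h2 : (2 : F) ≠ 0) {x : F}
    (hx : x ^ 2 ≠ 4) (y z : F) :
    ∃ s t : SL(2, F), (s : Matrix (Fin 2) (Fin 2) F).trace = x ∧
      (t : Matrix (Fin 2) (Fin 2) F).trace = y ∧
      ((s : Matrix (Fin 2) (Fin 2) F) * t).trace = z := by
  have := Fintype.ofFinite F
  have h4 : (4 : F) ≠ 0 := by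
    have : (4 : F) = 2 * 2 := by norm_num
    rw [this]; exact mul_ne_zero h2 h2
  have hodd : Fintype.card F % 2 = 1 := by
    rw [FiniteField.odd_card_of_char_ne_two]
    intro hc
    have := CharP.cast_eq_zero F (ringChar F)
    rw [hc] at this
    exact h2 (by exact_mod_cast this)
  -- With `s` a companion matrix, the trace conditions leave two free entries `b`, `d` of `t`.
  -- Completing the square in `b`, with `e = b + (x d - z) / 2`, turns `det t = 1` into `e²` plus a
  -- quadratic in `d` with leading coefficient `1 - (x/2)² ≠ 0`. Such a conic has a point over a
  -- finite field.
  obtain ⟨e, d, hed⟩ := FiniteField.exists_root_sum_quadratic (R := F)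
    (f := Polynomial.X ^ 2)
    (g := Polynomial.C (1 - (x / 2) ^ 2) * Polynomial.X ^ 2
      + Polynomial.C (x * z / 2 - y) * Polynomial.X + Polynomial.C (1 - (z / 2) ^ 2))
    (Polynomial.degree_X_pow 2)
    (Polynomial.degree_quadratic (by
      intro h0
      rw [div_pow, sub_eq_zero, eq_div_iff (pow_ne_zero 2 h2)] at h0
      exact hx (by linear_combination -h0))) hodd
  simp only [Polynomial.eval_add, Polynomial.eval_mul, Polynomial.eval_pow, Polynomial.eval_X,
    Polynomial.eval_C] at hed
  set b := e - (x * d - z) / 2 with hb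
  refine ⟨⟨!![0, -1; 1, x], by simp [Matrix.det_fin_two]⟩,
    ⟨!![y - d, b; b + x * d - z, d], ?_⟩, ?_, ?_, ?_⟩
  · rw [Matrix.det_fin_two_of, hb]
    linear_combination (-1) * hed + (e * x * d - e * z + (d * x * z - d ^ 2 * x ^ 2 - z ^ 2) / 2) *
       mul_inv_cancel₀ h2
  · simp [Matrix.trace_fin_two]
  · simp [Matrix.trace_fin_two]
  · simp [Matrix.trace_fin_two]

/-! ### Axes and the tori that fix them. -/

/-- A trace zero matrix of square one: it records an ordered pair of points of the projective line,
its two eigenspaces. -/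
structure IsAxis {K : Type*} [Field K] (J : Matrix (Fin 2) (Fin 2) K) : Prop where
  trace_eq : J.trace = 0
  mul_self : J * J = 1

namespace IsAxis

variable {K : Type*} [Field K] {J J' : Matrix (Fin 2) (Fin 2) K}

theorem neg (h : IsAxis J) : IsAxis (-J) :=
  ⟨by rw [Matrix.trace_neg, h.trace_eq, neg_zero], by rw [neg_mul_neg, h.mul_self]⟩

theorem ne_zero (h : IsAxis J) : J ≠ 0 := by
  rintro rfl
  simpa using h.mul_self

theorem ne_neg (h2 : (2 : K) ≠ 0) (h : IsAxis J) : J ≠ -J := by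
  intro h1
  have : (2 : K) • J = 0 := by rw [two_smul]; nth_rewrite 2 [h1]; simp
  exact h.ne_zero ((smul_eq_zero.1 this).resolve_left h2)

/-- The eigenvalue of `g` on the eigenspace of `J` for the eigenvalue `1`. -/
def eigenvalue (J g : Matrix (Fin 2) (Fin 2) K) : K := (g.trace + (g * J).trace) / 2

/-- The centralizer of an axis is spanned by `1` and `J`: when `g J = J g`, the polarised
Cayley-Hamilton identity expresses `2 g J` through `J` and `1`, and multiplication by `J` recovers
`g`. -/
theorem eq_add_smul (h2 : (2 : K) ≠ 0) (h : IsAxis J) {g : Matrix (Fin 2) (Fin 2) K}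
    (hg : g * J = J * g) : g = (g.trace / 2) • (1 : Matrix (Fin 2) (Fin 2) K)
      + ((g * J).trace / 2) • J := by
  have h1 := Matrix.mul_add_mul_fin_two g J
  rw [← hg, h.trace_eq, zero_smul, add_zero, mul_zero, sub_zero] at h1
  have h3 : (2 : K) • (g * J) = g.trace • J + (g * J).trace • 1 := by
    rw [two_smul]; nth_rewrite 1 [h1]; abel
  have h4 : (2 : K) • g = g.trace • 1 + (g * J).trace • J := by
    have := congrArg (· * J) h3
    simpa [add_mul, mul_assoc, h.mul_self] using this
  calc g = (2 : K)⁻¹ • ((2 : K) • g) := (inv_smul_smul₀ h2 g).symm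
    _ = _ := by rw [h4]; module

/-- The image of `1 + J` is the `1`-eigenspace of `J`, so this justifies the name `eigenvalue` and
yields its multiplicativity. -/
theorem mul_one_add (h2 : (2 : K) ≠ 0) (h : IsAxis J) {g : Matrix (Fin 2) (Fin 2) K}
    (hg : g * J = J * g) : g * (1 + J) = eigenvalue J g • (1 + J) := by
  conv_lhs => rw [h.eq_add_smul h2 hg]
  simp only [add_mul, mul_add, smul_mul_assoc, one_mul, mul_one, h.mul_self, eigenvalue]
  rw [add_div]
  module

theorem one_add_ne_zero (h2 : (2 : K) ≠ 0) (h : IsAxis J) : 1 + J ≠ 0 := by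
  intro h1
  have := congrArg Matrix.trace h1
  rw [Matrix.trace_add, h.trace_eq] at this
  simp at this
  exact h2 this

theorem eigenvalue_one (h2 : (2 : K) ≠ 0) (h : IsAxis J) : eigenvalue J 1 = 1 := by
  simp [eigenvalue, h.trace_eq, h2]

theorem eigenvalue_mul (h2 : (2 : K) ≠ 0) (h : IsAxis J) {g g' : Matrix (Fin 2) (Fin 2) K}
    (hg : g * J = J * g) (hg' : g' * J = J * g') :
    eigenvalue J (g * g') = eigenvalue J g * eigenvalue J g' := by
  have h1 : (g * g') * J = J * (g * g') := by rw [mul_assoc, hg', ← mul_assoc, hg, mul_assoc]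
  have h3 := h.mul_one_add h2 h1
  rw [mul_assoc, h.mul_one_add h2 hg', mul_smul_comm, h.mul_one_add h2 hg, smul_smul] at h3
  have h4 := smul_left_injective K (h.one_add_ne_zero h2) h3
  rw [← h4, mul_comm]

theorem det_eq (h2 : (2 : K) ≠ 0) (h : IsAxis J) {g : SL(2, K)}
    (hg : (g : Matrix (Fin 2) (Fin 2) K) * J = J * g) :
    ((g : Matrix (Fin 2) (Fin 2) K).trace / 2) ^ 2
      - (((g : Matrix (Fin 2) (Fin 2) K) * J).trace / 2) ^ 2 = 1 := by
  have h1 := Matrix.mul_self_fin_two (g : Matrix (Fin 2) (Fin 2) K)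
  rw [g.2] at h1
  have h3 := h.eq_add_smul h2 hg
  set α := (g : Matrix (Fin 2) (Fin 2) K).trace / 2 with hα
  set β := ((g : Matrix (Fin 2) (Fin 2) K) * J).trace / 2
  have h4 : (g : Matrix (Fin 2) (Fin 2) K).trace = 2 * α := by rw [hα]; field_simp
  rw [h4, h3] at h1
  have h5 : (α ^ 2 - β ^ 2 - 1) • (1 : Matrix (Fin 2) (Fin 2) K) = 0 := by
    have : (α • (1 : Matrix (Fin 2) (Fin 2) K) + β • J) * (α • 1 + β • J)
        = (α ^ 2 + β ^ 2) • 1 + (2 * α * β) • J := by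
      simp only [add_mul, mul_add, smul_mul_assoc, mul_smul_comm, one_mul, mul_one, h.mul_self]
      module
    rw [this] at h1
    have h6 := sub_eq_zero.2 h1
    have h7 : (β ^ 2 - α ^ 2 + 1) • (1 : Matrix (Fin 2) (Fin 2) K) = 0 := by
      rw [← h6]; module
    rw [← neg_eq_zero, ← neg_smul, ← h7]; congr 1; ring
  exact sub_eq_zero.1 ((smul_eq_zero.1 h5).resolve_right one_ne_zero)

/-- Writing `g = α + β J`, the determinant is `(α + β)(α - β) = 1`, so one eigenvalue determines the
other. Thus `eigenvalue` is a faithful character of the torus in `SL₂`. -/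
theorem eq_one_of_eigenvalue (h2 : (2 : K) ≠ 0) (h : IsAxis J) {g : SL(2, K)}
    (hg : (g : Matrix (Fin 2) (Fin 2) K) * J = J * g) (h1 : eigenvalue J g = 1) : g = 1 := by
  have h3 := h.det_eq h2 hg
  have h4 := h.eq_add_smul h2 hg
  rw [eigenvalue, add_div] at h1
  set α := (g : Matrix (Fin 2) (Fin 2) K).trace / 2
  set β := ((g : Matrix (Fin 2) (Fin 2) K) * J).trace / 2
  have h5 : α - β = 1 := by linear_combination h3 - (α - β) * h1
  have h6 : α = 1 := by
    apply mul_left_cancel₀ h2; linear_combination h1 + h5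
  have h7 : β = 0 := by linear_combination h1 - h6
  apply Subtype.ext
  rw [h4, h6, h7]; simp

theorem trace_eq_eigenvalue (h2 : (2 : K) ≠ 0) (h : IsAxis J) {g : SL(2, K)}
    (hg : (g : Matrix (Fin 2) (Fin 2) K) * J = J * g) :
    eigenvalue J g * ((g : Matrix (Fin 2) (Fin 2) K).trace - eigenvalue J g) = 1 := by
  have h3 := h.det_eq h2 hg
  rw [eigenvalue, add_div]
  have h4 : (g : Matrix (Fin 2) (Fin 2) K).trace
    = (g : Matrix (Fin 2) (Fin 2) K).trace / 2 + (g : Matrix (Fin 2) (Fin 2) K).trace / 2 := by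
    field_simp; norm_num
  nth_rewrite 2 [h4]
  linear_combination h3

/-- A noncentral matrix of determinant one commutes with at most one axis up to sign. -/
theorem eq_or_eq_neg (h2 : (2 : K) ≠ 0) (h : IsAxis J) (h' : IsAxis J') {g : SL(2, K)}
    (h1 : g ≠ 1) (hm1 : g ≠ -1) (hg : (g : Matrix (Fin 2) (Fin 2) K) * J = J * g)
    (hg' : (g : Matrix (Fin 2) (Fin 2) K) * J' = J' * g) : J' = J ∨ J' = -J := by
  have h3 := h.det_eq h2 hg
  have h4 := h.eq_add_smul h2 hg
  set α := (g : Matrix (Fin 2) (Fin 2) K).trace / 2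
  set β := ((g : Matrix (Fin 2) (Fin 2) K) * J).trace / 2
  have hβ : β ≠ 0 := by
    intro hβ
    rw [hβ] at h3 h4
    have : (α - 1) * (α + 1) = 0 := by linear_combination h3
    rcases mul_eq_zero.1 this with h5 | h5
    · apply h1; apply Subtype.ext
      rw [h4, sub_eq_zero.1 h5]; simp
    · apply hm1; apply Subtype.ext
      rw [h4, eq_neg_of_add_eq_zero_left h5]; simp
  have hJ : J' * J = J * J' := by
    rw [h4] at hg'
    simp only [add_mul, mul_add, smul_mul_assoc, mul_smul_comm, one_mul, mul_one] at hg'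
    exact (smul_right_injective _ hβ (add_left_cancel hg')).symm
  have h5 := h.eq_add_smul h2 hJ
  rw [h'.trace_eq, zero_div, zero_smul, zero_add] at h5
  set c := (J' * J).trace / 2
  have h6 : (c ^ 2 - 1) • (1 : Matrix (Fin 2) (Fin 2) K) = 0 := by
    have := h'.mul_self
    rw [h5, smul_mul_smul_comm, h.mul_self] at this
    rw [sub_smul, pow_two, this, one_smul, sub_self]
  have h7 : c ^ 2 - 1 = 0 := (smul_eq_zero.1 h6).resolve_right one_ne_zero
  rcases sq_eq_sq_iff_eq_or_eq_neg.1 ((sub_eq_zero.1 h7).trans (one_pow 2).symm) with h8 | h8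
  · left; rw [h5, h8, one_smul]
  · right; rw [h5, h8, neg_one_smul]

theorem commute_of_axis (h2 : (2 : K) ≠ 0) (h : IsAxis J) {g g' : Matrix (Fin 2) (Fin 2) K}
    (hg : g * J = J * g) (hg' : g' * J = J * g') : g * g' = g' * g := by
  rw [h.eq_add_smul h2 hg]
  simp only [add_mul, mul_add, smul_mul_assoc, mul_smul_comm, one_mul, mul_one, hg']

/-- A matrix which reverses an axis has trace zero. -/
theorem trace_eq_zero (h2 : (2 : K) ≠ 0) (h : IsAxis J) {g : Matrix (Fin 2) (Fin 2) K}
    (hg : g * J = -(J * g)) : g.trace = 0 := by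
  have h1 := Matrix.mul_add_mul_fin_two g J
  rw [hg, h.trace_eq, zero_smul, add_zero, mul_zero, sub_zero, neg_neg] at h1
  have h3 : g.trace • J + (g * J).trace • (1 : Matrix (Fin 2) (Fin 2) K) = 0 := by
    have h1 := sub_eq_zero.2 h1
    rw [← neg_eq_zero, ← h1, hg]; abel
  have h4 := congrArg Matrix.trace h3
  simp only [Matrix.trace_add, Matrix.trace_smul, h.trace_eq, Matrix.trace_one] at h4
  have h5 : (g * J).trace = 0 := by simpa [h2] using h4
  rw [h5, zero_smul, add_zero] at h3
  exact (smul_eq_zero.1 h3).resolve_right h.ne_zero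

theorem conj (h : IsAxis J) (g : GL (Fin 2) K) :
    IsAxis ((g : Matrix (Fin 2) (Fin 2) K) * J * ((g⁻¹ : GL (Fin 2) K) : Matrix (Fin 2) (Fin 2) K)) where
  trace_eq := by rw [Matrix.trace_mul_comm, ← mul_assoc, ← Units.val_mul]; simp [h.trace_eq]
  mul_self := by
    have : (g : Matrix (Fin 2) (Fin 2) K) * J * ((g⁻¹ : GL (Fin 2) K) : Matrix (Fin 2) (Fin 2) K) *
        ((g : Matrix (Fin 2) (Fin 2) K) * J * ((g⁻¹ : GL (Fin 2) K) : Matrix (Fin 2) (Fin 2) K)) =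
        (g : Matrix (Fin 2) (Fin 2) K) * (J * J) * ((g⁻¹ : GL (Fin 2) K) : Matrix (Fin 2) (Fin 2) K) := by
      simp [mul_assoc]
    rw [this, h.mul_self]; simp

end IsAxis

/-- A matrix of determinant one and trace different from `±2` commutes with an axis. -/
theorem exists_axis {K : Type*} [Field K] [IsAlgClosed K] {g : SL(2, K)}
    (hg : (g : Matrix (Fin 2) (Fin 2) K).trace ^ 2 ≠ 4) :
    ∃ J : Matrix (Fin 2) (Fin 2) K, IsAxis J ∧ (g : Matrix (Fin 2) (Fin 2) K) * J = J * g := by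
  set x := (g : Matrix (Fin 2) (Fin 2) K).trace with hx
  obtain ⟨r, hr⟩ := IsAlgClosed.exists_pow_nat_eq (x ^ 2 - 4) (n := 2) (by norm_num)
  have hr0 : r ≠ 0 := by
    rintro rfl
    apply hg; linear_combination -hr
  have h1 := Matrix.mul_self_fin_two (g : Matrix (Fin 2) (Fin 2) K)
  rw [g.2, ← hx, one_smul] at h1
  -- The axis is the traceless part `2 g - x`, whose square is `x² - 4`, divided by a square root of
  -- that scalar.
  refine ⟨r⁻¹ • ((2 : K) • (g : Matrix (Fin 2) (Fin 2) K) - x • 1), ⟨?_, ?_⟩, ?_⟩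
  · simp only [Matrix.trace_smul, Matrix.trace_sub, Matrix.trace_one, ← hx]
    simp; right; ring
  · have : ((2 : K) • (g : Matrix (Fin 2) (Fin 2) K) - x • 1) *
        ((2 : K) • (g : Matrix (Fin 2) (Fin 2) K) - x • 1) = (x ^ 2 - 4) • 1 := by
      simp only [sub_mul, mul_sub, smul_mul_assoc, mul_smul_comm, one_mul, mul_one, h1]
      module
    rw [smul_mul_smul_comm, this, smul_smul, ← hr]
    have : r⁻¹ * r⁻¹ * r ^ 2 = 1 := by field_simp
    rw [this, one_smul]
  · simp [mul_sub, sub_mul]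

/-! ### The action of a subgroup of `SL₂` on its axes. -/

section Axes

variable {K : Type*} [Field K]

/-- Conjugation of a matrix by an invertible one. -/
def axConj (g : GL (Fin 2) K) (J : Matrix (Fin 2) (Fin 2) K) : Matrix (Fin 2) (Fin 2) K :=
  (g : Matrix (Fin 2) (Fin 2) K) * J * ((g⁻¹ : GL (Fin 2) K) : Matrix (Fin 2) (Fin 2) K)

theorem axConj_eq_iff {g : GL (Fin 2) K} {J J' : Matrix (Fin 2) (Fin 2) K} :
    axConj g J = J' ↔ (g : Matrix (Fin 2) (Fin 2) K) * J = J' * g := by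
  rw [axConj, Units.mul_inv_eq_iff_eq_mul]

theorem axConj_one (J : Matrix (Fin 2) (Fin 2) K) : axConj 1 J = J := by simp [axConj]

theorem axConj_mul (g h : GL (Fin 2) K) (J : Matrix (Fin 2) (Fin 2) K) :
    axConj (g * h) J = axConj g (axConj h J) := by
  simp [axConj, mul_assoc]

theorem axConj_neg (g : GL (Fin 2) K) (J : Matrix (Fin 2) (Fin 2) K) :
    axConj g (-J) = -axConj g J := by
  simp [axConj]

variable (H : Subgroup SL(2, K))

/-- The axes which are fixed by some noncentral element of `H`. -/
def axes : Set (Matrix (Fin 2) (Fin 2) K) :=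
  {J | IsAxis J ∧ ∃ g ∈ H, g ≠ 1 ∧ g ≠ -1 ∧ (g : Matrix (Fin 2) (Fin 2) K) * J = J * g}

variable {H}

/-- Allowing `g` in `GL₂` rather than in `H` lets normalizing elements act on the axes too. -/
theorem axConj_mem_axes {g : GL (Fin 2) K} (hg : ∀ h ∈ H, glConj g h ∈ H)
    {J : Matrix (Fin 2) (Fin 2) K} (hJ : J ∈ axes H) : axConj g J ∈ axes H := by
  obtain ⟨h1, h, hH, hh, hh', hc⟩ := hJ
  refine ⟨h1.conj g, glConj g h, hg h hH, ?_, ?_, ?_⟩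
  · intro h2; exact hh ((glConj g).injective (by rw [h2, map_one]))
  · intro h2
    apply hh'
    apply (glConj g).injective
    rw [h2, eq_comm, glConj_eq_iff]
    simp
  · rw [coe_glConj, axConj]
    have : ∀ A B : Matrix (Fin 2) (Fin 2) K,
        (g : Matrix (Fin 2) (Fin 2) K) * A * ((g⁻¹ : GL (Fin 2) K) : Matrix (Fin 2) (Fin 2) K) *
        ((g : Matrix (Fin 2) (Fin 2) K) * B * ((g⁻¹ : GL (Fin 2) K) : Matrix (Fin 2) (Fin 2) K))
        = (g : Matrix (Fin 2) (Fin 2) K) * (A * B) *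
          ((g⁻¹ : GL (Fin 2) K) : Matrix (Fin 2) (Fin 2) K) := by
      intro A B; simp [mul_assoc]
    rw [this, this, hc]

theorem glConj_mem_of_mem {h g : SL(2, K)} (hh : h ∈ H) (hg : g ∈ H) :
    glConj (h : GL (Fin 2) K) g ∈ H := by
  rw [glConj_coe]; exact H.mul_mem (H.mul_mem hh hg) (H.inv_mem hh)

noncomputable instance : MulAction H (axes H) where
  smul h J := ⟨axConj (h : SL(2, K)) J, axConj_mem_axes (fun _ hg => glConj_mem_of_mem h.2 hg) J.2⟩
  one_smul J := Subtype.ext (by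
    change axConj (((1 : H) : SL(2, K)) : GL (Fin 2) K) J = J
    rw [Subgroup.coe_one, map_one, axConj_one])
  mul_smul g h J := Subtype.ext (by
    change axConj (((g * h : H) : SL(2, K)) : GL (Fin 2) K) J = _
    rw [Subgroup.coe_mul, map_mul, axConj_mul]; rfl)

theorem coe_smul_axes (h : H) (x : axes H) :
    ((h • x : axes H) : Matrix (Fin 2) (Fin 2) K) = axConj ((h : SL(2, K)) : GL (Fin 2) K) x := rfl

noncomputable instance : InvolutiveNeg (axes H) where
  neg J := ⟨-J, J.2.1.neg, by
    obtain ⟨_, h, hH, hh, hh', hc⟩ := J.2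
    exact ⟨h, hH, hh, hh', by rw [mul_neg, neg_mul, hc]⟩⟩
  neg_neg J := Subtype.ext (neg_neg _)

theorem coe_neg_axes (x : axes H) : ((-x : axes H) : Matrix (Fin 2) (Fin 2) K) = -x := rfl

theorem smul_neg_axes (h : H) (x : axes H) : h • (-x) = -(h • x) :=
  Subtype.ext (axConj_neg _ _)

theorem smul_eq_iff_axes (h : H) (x y : axes H) :
    h • x = y ↔ ((h : SL(2, K)) : Matrix (Fin 2) (Fin 2) K) * x
      = y * ((h : SL(2, K)) : Matrix (Fin 2) (Fin 2) K) := by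
  rw [Subtype.ext_iff, coe_smul_axes, axConj_eq_iff]; rfl

theorem neg_ne_axes (h2 : (2 : K) ≠ 0) (x : axes H) : -x ≠ x := fun h =>
  x.2.1.ne_neg h2 (congrArg Subtype.val h).symm

theorem eq_or_eq_neg_axes (h2 : (2 : K) ≠ 0) {h : H} (h1 : (h : SL(2, K)) ≠ 1)
    (hm1 : (h : SL(2, K)) ≠ -1) {x y : axes H} (hx : h • x = x) (hy : h • y = y) :
    y = x ∨ y = -x := by
  rw [smul_eq_iff_axes] at hx hy
  rcases x.2.1.eq_or_eq_neg h2 y.2.1 h1 hm1 hx hy with h3 | h3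
  · exact Or.inl (Subtype.ext h3)
  · exact Or.inr (Subtype.ext h3)

theorem smul_axes_of_central {h : H} (hh : (h : SL(2, K)) = 1 ∨ (h : SL(2, K)) = -1)
    (x : axes H) : h • x = x := by
  rw [smul_eq_iff_axes]
  rcases hh with hh | hh <;> rw [hh] <;> simp

variable (H) in
/-- The elements `±1` of `H`. -/
def signs : Subgroup H := (Subgroup.zpowers (-1 : SL(2, K))).subgroupOf H

theorem mem_signs {h : H} : h ∈ signs H ↔ (h : SL(2, K)) = 1 ∨ (h : SL(2, K)) = -1 := by
  rw [signs, Subgroup.mem_subgroupOf, Subgroup.mem_zpowers_iff]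
  constructor
  · rintro ⟨k, hk⟩
    rcases Int.even_or_odd k with h1 | h1
    · left; rw [← hk, h1.neg_one_zpow]
    · right; rw [← hk, h1.neg_one_zpow]
  · rintro (h | h)
    · exact ⟨0, by rw [h]; simp⟩
    · exact ⟨1, by rw [h]; simp⟩

variable [IsAlgClosed K]

theorem exists_mem_axes
    (hss : ∀ h ∈ H, (h : Matrix (Fin 2) (Fin 2) K).trace ^ 2 = 4 → h = 1 ∨ h = -1)
    {h : H} (h1 : (h : SL(2, K)) ≠ 1) (hm1 : (h : SL(2, K)) ≠ -1) :
    ∃ x : axes H, h • x = x := by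
  obtain ⟨J, hJ, hc⟩ := exists_axis (g := (h : SL(2, K))) (fun h3 => by
    rcases hss h h.2 h3 with h4 | h4
    exacts [h1 h4, hm1 h4])
  exact ⟨⟨J, hJ, h, h.2, h1, hm1, hc⟩, by rw [smul_eq_iff_axes]; exact hc⟩

/-- The hypothesis `hss` excludes unipotent elements up to sign. A noncentral element therefore has
an axis, and it fixes this axis with its two orientations and nothing else. -/
theorem card_fixedBy_axes (h2 : (2 : K) ≠ 0)
    (hss : ∀ h ∈ H, (h : Matrix (Fin 2) (Fin 2) K).trace ^ 2 = 4 → h = 1 ∨ h = -1)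
    {h : H} (h1 : (h : SL(2, K)) ≠ 1) (hm1 : (h : SL(2, K)) ≠ -1) :
    (MulAction.fixedBy (axes H) h).ncard = 2 := by
  obtain ⟨x, hx⟩ := exists_mem_axes hss h1 hm1
  have : MulAction.fixedBy (axes H) h = {x, -x} := by
    ext y
    rw [MulAction.mem_fixedBy, Set.mem_insert_iff, Set.mem_singleton_iff]
    refine ⟨fun hy => eq_or_eq_neg_axes h2 h1 hm1 hx hy, ?_⟩
    rintro (rfl | rfl)
    · exact hx
    · rw [smul_neg_axes, hx]
  rw [this, Set.ncard_pair (neg_ne_axes h2 x).symm]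

theorem finite_axes [Finite H] (h2 : (2 : K) ≠ 0)
    (hss : ∀ h ∈ H, (h : Matrix (Fin 2) (Fin 2) K).trace ^ 2 = 4 → h = 1 ∨ h = -1) :
    Finite (axes H) := by
  rw [← Set.finite_univ_iff]
  refine Set.Finite.subset (Set.finite_iUnion (fun h : {h : H // (h : SL(2, K)) ≠ 1 ∧
    (h : SL(2, K)) ≠ -1} => Set.finite_of_ncard_ne_zero (s := MulAction.fixedBy (axes H) (h : H))
      (by rw [card_fixedBy_axes h2 hss h.2.1 h.2.2]; norm_num))) ?_
  intro x _
  obtain ⟨_, h, hH, hh, hh', hc⟩ := x.2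
  rw [Set.mem_iUnion]
  refine ⟨⟨⟨h, hH⟩, hh, hh'⟩, ?_⟩
  rw [MulAction.mem_fixedBy, smul_eq_iff_axes]
  exact hc

end Axes

/-! ### Burnside's lemma and the orbit types. -/

section Axes

variable {K : Type*} [Field K] {H : Subgroup SL(2, K)}

theorem neg_one_ne_one {K : Type*} [Field K] (h2 : (2 : K) ≠ 0) : (-1 : SL(2, K)) ≠ 1 := by
  intro h
  have := congrArg (fun g : SL(2, K) => (g : Matrix (Fin 2) (Fin 2) K) 0 0) h
  simp at this
  exact h2 (by linear_combination -this)

/-- By Cayley-Hamilton `g² = 1` reads `tr(g) g = 2`, so `g` is scalar. In particular `-1` is the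
only involution, a fact used throughout. -/
theorem eq_one_or_eq_neg_one_of_sq {K : Type*} [Field K] (h2 : (2 : K) ≠ 0) {g : SL(2, K)}
    (hg : g * g = 1) : g = 1 ∨ g = -1 := by
  have h1 := Matrix.mul_self_fin_two (g : Matrix (Fin 2) (Fin 2) K)
  rw [g.2, ← Matrix.SpecialLinearGroup.coe_mul, hg, Matrix.SpecialLinearGroup.coe_one,
    one_smul] at h1
  set x := (g : Matrix (Fin 2) (Fin 2) K).trace
  have hx : x • (g : Matrix (Fin 2) (Fin 2) K) = (2 : K) • 1 := by
    rw [two_smul]; nth_rewrite 1 [h1]; abel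
  have hx0 : x ≠ 0 := by
    intro h0
    rw [h0, zero_smul] at hx
    exact h2 ((smul_eq_zero.1 hx.symm).resolve_right one_ne_zero)
  have hg' : (g : Matrix (Fin 2) (Fin 2) K) = (2 / x) • 1 := by
    rw [div_eq_inv_mul, mul_smul, ← hx, inv_smul_smul₀ hx0]
  have hd := g.2
  rw [hg', Matrix.det_smul, Matrix.det_one] at hd
  simp only [Fintype.card_fin, mul_one] at hd
  rcases sq_eq_sq_iff_eq_or_eq_neg.1 (hd.trans (one_pow 2).symm) with h | h <;> rw [h] at hg'
  · left; apply Subtype.ext; rw [hg']; simp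
  · right; apply Subtype.ext; rw [hg']; simp

theorem neg_one_mem_of_even {K : Type*} [Field K] {H : Subgroup SL(2, K)}
    [Finite H] (h2 : (2 : K) ≠ 0) (hH : 2 ∣ Nat.card H) : (-1 : SL(2, K)) ∈ H := by
  have : Fact (Nat.Prime 2) := ⟨Nat.prime_two⟩
  obtain ⟨g, hg⟩ := exists_prime_orderOf_dvd_card' 2 hH
  have h1 : (g : SL(2, K)) * g = 1 := by
    have := pow_orderOf_eq_one g
    rw [hg, pow_two] at this
    exact congrArg Subtype.val this
  rcases eq_one_or_eq_neg_one_of_sq h2 h1 with h | h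
  · exfalso
    have : g = 1 := Subtype.ext h
    rw [this, orderOf_one] at hg
    omega
  · rw [← h]; exact g.2

theorem signs_le_stabilizer (x : axes H) : signs H ≤ MulAction.stabilizer H x := fun _ hh =>
  MulAction.mem_stabilizer_iff.2 (smul_axes_of_central (mem_signs.1 hh) x)

theorem signs_lt_stabilizer (x : axes H) : signs H < MulAction.stabilizer H x := by
  refine lt_of_le_of_ne (signs_le_stabilizer x) fun h => ?_
  obtain ⟨_, g, hg, h1, h1', hc⟩ := x.2
  have : (⟨g, hg⟩ : H) ∈ signs H := by
    rw [h, MulAction.mem_stabilizer_iff, smul_eq_iff_axes]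
    exact hc
  rcases mem_signs.1 this with h | h
  exacts [h1 h, h1' h]

/-- The eigenvalue embeds the stabilizer in the multiplicative group of a field, where finite
subgroups are cyclic. -/
theorem isCyclic_stabilizer [Finite H] (h2 : (2 : K) ≠ 0) (x : axes H) :
    IsCyclic (MulAction.stabilizer H x) := by
  have hc : ∀ g : MulAction.stabilizer H x, (((g : H) : SL(2, K)) : Matrix (Fin 2) (Fin 2) K) * x
      = x * (((g : H) : SL(2, K)) : Matrix (Fin 2) (Fin 2) K) := fun g =>
    (smul_eq_iff_axes _ _ _).1 g.2
  let f : MulAction.stabilizer H x →* K :=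
    { toFun := fun g => IsAxis.eigenvalue x (((g : H) : SL(2, K)) : Matrix (Fin 2) (Fin 2) K)
      map_one' := x.2.1.eigenvalue_one h2
      map_mul' := fun g h => x.2.1.eigenvalue_mul h2 (hc g) (hc h) }
  refine isCyclic_of_injective_ringHom f ((injective_iff_map_eq_one f).2 fun g hg => ?_)
  exact Subtype.ext (Subtype.ext (x.2.1.eq_one_of_eigenvalue h2 (hc g) hg))

/-- The orbit equation behind the classification: the number of orbits is determined by Burnside's
lemma. -/
theorem card_axes_eq [IsAlgClosed K] [Finite H] (h2 : (2 : K) ≠ 0)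
    (hss : ∀ h ∈ H, (h : Matrix (Fin 2) (Fin 2) K).trace ^ 2 = 4 → h = 1 ∨ h = -1) :
    Nat.card (signs H) * Nat.card (axes H) + 2 * (Nat.card H - Nat.card (signs H)) =
      Nat.card (MulAction.orbitRel.Quotient H (axes H)) * Nat.card H := by
  classical
  have := finite_axes h2 hss
  have := Fintype.ofFinite (axes H)
  have := Fintype.ofFinite H
  have hb := MulAction.sum_card_fixedBy_eq_card_orbits_mul_card_group H (axes H)
  rw [Nat.card_eq_fintype_card (α := H), Nat.card_eq_fintype_card (α := axes H),
    Nat.card_eq_fintype_card (α := MulAction.orbitRel.Quotient H (axes H)), ← hb]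
  have h1 : ∀ h : H, Fintype.card (MulAction.fixedBy (axes H) h) =
      if h ∈ signs H then Fintype.card (axes H) else 2 := by
    intro h
    split_ifs with hh
    · have : MulAction.fixedBy (axes H) h = Set.univ := by
        ext x; simp [MulAction.mem_fixedBy, smul_axes_of_central (mem_signs.1 hh) x]
      simp [this]
    · rw [mem_signs, not_or] at hh
      rw [← Nat.card_eq_fintype_card, Nat.card_coe_set_eq, card_fixedBy_axes h2 hss hh.1 hh.2]
  rw [Finset.sum_congr rfl (fun h _ => h1 h), Finset.sum_ite, Finset.sum_const, Finset.sum_const]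
  have h3 : (Finset.univ.filter (fun h => h ∈ signs H)).card = Nat.card (signs H) := by
    rw [Nat.card_eq_fintype_card, Fintype.card_subtype]
  have h4 := Finset.card_filter_add_card_filter_not (s := (Finset.univ : Finset H))
    (fun h => h ∈ signs H)
  rw [Finset.card_univ, h3] at h4
  rw [h3, smul_eq_mul, smul_eq_mul]
  have : (Finset.univ.filter (fun h => ¬ h ∈ signs H)).card
    = Fintype.card H - Nat.card (signs H) := by omega
  rw [this, mul_comm 2]

theorem card_signs [Finite H] (h2 : (2 : K) ≠ 0) :
    Nat.card (signs H) = 1 ∨ Nat.card (signs H) = 2 ∧ (-1 : SL(2, K)) ∈ H := by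
  by_cases h : (-1 : SL(2, K)) ∈ H
  · right
    refine ⟨?_, h⟩
    have : (signs H : Set H) = {1, ⟨-1, h⟩} := by
      ext g
      rw [SetLike.mem_coe, mem_signs, Set.mem_insert_iff, Set.mem_singleton_iff, Subtype.ext_iff,
        Subtype.ext_iff]
      rfl
    rw [← SetLike.coe_sort_coe, this, Nat.card_coe_set_eq, Set.ncard_pair]
    intro h1
    exact neg_one_ne_one h2 (congrArg Subtype.val h1).symm
  · left
    rw [Subgroup.card_eq_one, Subgroup.eq_bot_iff_forall]
    intro g hg
    rcases mem_signs.1 hg with h1 | h1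
    · exact Subtype.ext h1
    · exact absurd (h1 ▸ g.2) h

theorem card_orbit_mul_card_stabilizer' [Finite H] [Finite (axes H)] (x : axes H) :
    Nat.card (MulAction.orbit H x) * Nat.card (MulAction.stabilizer H x) = Nat.card H := by
  classical
  have := Fintype.ofFinite (axes H)
  have := Fintype.ofFinite H
  simp only [Nat.card_eq_fintype_card]
  exact MulAction.card_orbit_mul_card_stabilizer_eq_card_group H x

/-- The classical equation `1/m₁ + 1/m₂ + 1/m₃ = 1 + 2/N` for the orders of the stabilizers modulo
`±1`. -/
theorem three_orbit_arith {N n₁ n₂ n₃ m₁ m₂ m₃ : ℕ} (hm : 2 ≤ m₁) (h12 : m₁ ≤ m₂) (h23 : m₂ ≤ m₃)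
    (h1 : n₁ * m₁ = N) (h2 : n₂ * m₂ = N) (h3 : n₃ * m₃ = N) (hN : n₁ + n₂ + n₃ = N + 2) :
    m₁ = 2 ∧ ((m₂ = 2 ∧ N = 2 * m₃) ∨ (m₂ = 3 ∧ ((m₃ = 3 ∧ N = 12) ∨ (m₃ = 4 ∧ N = 24) ∨
      (m₃ = 5 ∧ N = 60)))) := by
  have hm1 : m₁ = 2 := by
    by_contra h
    have e1 : n₁ * 3 ≤ N := h1 ▸ Nat.mul_le_mul_left _ (by omega)
    have e2 : n₂ * 3 ≤ N := h2 ▸ Nat.mul_le_mul_left _ (by omega)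
    have e3 : n₃ * 3 ≤ N := h3 ▸ Nat.mul_le_mul_left _ (by omega)
    omega
  subst hm1
  refine ⟨rfl, ?_⟩
  have hm2 : m₂ < 4 := by
    by_contra h
    have e2 : n₂ * 4 ≤ N := h2 ▸ Nat.mul_le_mul_left _ (by omega)
    have e3 : n₃ * 4 ≤ N := h3 ▸ Nat.mul_le_mul_left _ (by omega)
    omega
  have hm2' : m₂ = 2 ∨ m₂ = 3 := by omega
  rcases hm2' with rfl | rfl
  · left
    have : n₃ = 2 := by omega
    subst this
    exact ⟨rfl, h3.symm⟩
  · right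
    refine ⟨rfl, ?_⟩
    have hm3 : m₃ < 6 := by
      by_contra h
      have e3 : n₃ * 6 ≤ N := h3 ▸ Nat.mul_le_mul_left _ (by omega)
      omega
    interval_cases m₃ <;> omega

theorem injective_vec_three {α : Type*} {a b c : α} (hab : a ≠ b) (hac : a ≠ c) (hbc : b ≠ c) :
    Function.Injective ![a, b, c] := by
  intro i j hij
  fin_cases i <;> fin_cases j <;> simp_all

variable (H) in
/-- The group `H` has three orbits of axes, with stabilizers of the orders found in dihedral or
polyhedral groups. -/
def HasThreeOrbits : Prop :=
  (-1 : SL(2, K)) ∈ H ∧ ∃ (x : Fin 3 → axes H) (m : Fin 3 → ℕ) (N : ℕ),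
    (∀ y, ∃ i, y ∈ MulAction.orbit H (x i)) ∧
    (∀ i j, x i ∈ MulAction.orbit H (x j) → i = j) ∧
    (∀ i, Nat.card (MulAction.stabilizer H (x i)) = 2 * m i) ∧ Nat.card H = 2 * N ∧
    2 ≤ m 2 ∧
    m 0 = 2 ∧ ((m 1 = 2 ∧ N = 2 * m 2) ∨ (m 1 = 3 ∧ ((m 2 = 3 ∧ N = 12) ∨ (m 2 = 4 ∧ N = 24) ∨
    (m 2 = 5 ∧ N = 60))))

/-- Finite subgroups without nontrivial unipotent elements have no axis, or a common axis, or
exactly three orbits of axes, with well known stabilizers. -/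
theorem axes_classification [IsAlgClosed K] [Finite H] (h2 : (2 : K) ≠ 0)
    (hss : ∀ h ∈ H, (h : Matrix (Fin 2) (Fin 2) K).trace ^ 2 = 4 → h = 1 ∨ h = -1) :
    (∀ h ∈ H, h = 1 ∨ h = -1) ∨ (∃ x : axes H, ∀ h : H, h • x = x) ∨
    HasThreeOrbits H := by
  classical
  have hfin := finite_axes h2 hss
  have := Fintype.ofFinite (axes H)
  set Ω := MulAction.orbitRel.Quotient H (axes H) with hΩ
  have hB := card_axes_eq h2 hss
  set z := Nat.card (signs H) with hz
  have hz0 : 0 < z := Nat.card_pos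
  obtain ⟨N, hN⟩ : z ∣ Nat.card H := Subgroup.card_subgroup_dvd_card _
  have hH0 : 0 < Nat.card H := Nat.card_pos
  have hN0 : 0 < N := by
    rcases Nat.eq_zero_or_pos N with h | h
    · rw [h] at hN; omega
    · exact h
  -- Orders are measured modulo the `z` central elements. Each axis is fixed by a noncentral
  -- element, whence `2 ≤ m`.
  have hst : ∀ x : axes H, ∃ m, 2 ≤ m ∧ Nat.card (MulAction.stabilizer H x) = z * m ∧
      Nat.card (MulAction.orbit H x) * m = N := by
    intro x
    obtain ⟨m, hm⟩ : z ∣ Nat.card (MulAction.stabilizer H x) :=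
      Subgroup.card_dvd_of_le (signs_le_stabilizer x)
    have h3 := card_orbit_mul_card_stabilizer' x
    refine ⟨m, ?_, hm, ?_⟩
    · by_contra hlt
      have h4 : Nat.card (MulAction.stabilizer H x) ≤ z := by
        rw [hm]; nth_rewrite 2 [← mul_one z]; exact Nat.mul_le_mul_left _ (by omega)
      exact (signs_lt_stabilizer x).ne (Subgroup.eq_of_le_of_card_ge (signs_le_stabilizer x) h4)
    · rw [hm, hN] at h3
      apply Nat.eq_of_mul_eq_mul_left hz0
      rw [← h3]; ring
  have hcardX : Nat.card (axes H) = ∑ ω : Ω, Nat.card (MulAction.orbit H ω.out) := by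
    rw [Nat.card_congr (MulAction.selfEquivSigmaOrbits H (axes H)), Nat.card_sigma]
  have hE : (∑ ω : Ω, Nat.card (MulAction.orbit H ω.out)) + 2 * (N - 1) = Fintype.card Ω * N := by
    apply Nat.eq_of_mul_eq_mul_left hz0
    rw [← hcardX, mul_add, ← Nat.card_eq_fintype_card (α := Ω)]
    have : z * (2 * (N - 1)) = 2 * (Nat.card H - z) := by
      rw [hN, Nat.mul_sub, Nat.mul_sub, Nat.mul_sub]; ring_nf
    rw [this, hB, hN]; ring
  have hle : (∑ ω : Ω, Nat.card (MulAction.orbit H ω.out)) * 2 ≤ Fintype.card Ω * N := by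
    rw [Finset.sum_mul, Fintype.card, ← smul_eq_mul (Finset.card _), ← Finset.sum_const]
    refine Finset.sum_le_sum fun ω _ => ?_
    obtain ⟨m, hm, -, h3⟩ := hst ω.out
    rw [← h3]; exact Nat.mul_le_mul_left _ hm
  -- Orbits have at most `N / 2` elements, so `|Ω| N = ∑ |orbit| + 2 (N - 1)` forces `|Ω| N / 2 < 2
  -- N`.
  have hlt : Fintype.card Ω < 4 := by
    by_contra h
    have h4 : 4 * N ≤ Fintype.card Ω * N := Nat.mul_le_mul_right _ (by omega)
    omega
  have hpos : ∀ x : axes H, 0 < Nat.card (MulAction.orbit H x) := fun x =>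
    have : Nonempty (MulAction.orbit H x) := ⟨⟨x, MulAction.mem_orbit_self x⟩⟩
    Nat.card_pos
  have hcases : Fintype.card Ω = 0 ∨ Fintype.card Ω = 1 ∨ Fintype.card Ω = 2 ∨
    Fintype.card Ω = 3 := by omega
  have hfix : ∀ x : axes H, Nat.card (MulAction.orbit H x) = 1 → ∀ h : H, h • x = x := by
    intro x hx h
    have := (Nat.card_eq_one_iff_unique.1 hx).1
    have h3 := Subsingleton.elim (⟨h • x, MulAction.mem_orbit x h⟩ : MulAction.orbit H x)
      ⟨x, MulAction.mem_orbit_self x⟩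
    exact congrArg Subtype.val h3
  rcases hcases with h0 | h1 | h2' | h3
  · left
    intro h hh
    by_contra hcon
    rw [not_or] at hcon
    obtain ⟨x, -⟩ := exists_mem_axes hss (h := ⟨h, hh⟩) hcon.1 hcon.2
    have := Fintype.card_eq_zero_iff.1 h0
    exact this.elim (Quotient.mk _ x : Ω)
  · exfalso
    obtain ⟨ω, hω⟩ := Fintype.card_eq_one_iff.1 h1
    have hs : (∑ ω : Ω, Nat.card (MulAction.orbit H ω.out)) =
        Nat.card (MulAction.orbit H ω.out) := by
      rw [Finset.sum_eq_single ω (fun b _ hb => absurd (hω b) hb)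
        (fun hb => absurd (Finset.mem_univ _) hb)]
    have := hpos ω.out
    obtain ⟨m, hm, -, h4⟩ := hst ω.out
    rw [h1] at hE
    have hN1 : N = 1 := by omega
    rw [hN1] at h4
    have := Nat.eq_one_of_mul_eq_one_left h4
    omega
  · right; left
    obtain ⟨ω₁, ω₂, hne, hu⟩ := Finset.card_eq_two.1 (show (Finset.univ : Finset Ω).card = 2 from h2')
    rw [hu, Finset.sum_pair hne, h2'] at hE
    have e1 := hpos ω₁.out
    have e2 := hpos ω₂.out
    exact ⟨ω₁.out, hfix _ (by omega)⟩
  · right; right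
    obtain ⟨ω₁, ω₂, ω₃, h12, h13, h23, hu⟩ :=
      Finset.card_eq_three.1 (show (Finset.univ : Finset Ω).card = 3 from h3)
    have hs : Nat.card (MulAction.orbit H ω₁.out) + Nat.card (MulAction.orbit H ω₂.out)
        + Nat.card (MulAction.orbit H ω₃.out) = N + 2 := by
      have := hE
      rw [hu, Finset.sum_insert (by simp [h12, h13]), Finset.sum_pair h23, h3] at this
      omega
    have key : ∀ w : Fin 3 → Ω, Function.Injective w → ∀ m : Fin 3 → ℕ,
        (∀ i, Nat.card (MulAction.stabilizer H (w i).out) = z * m i) →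
        (∀ i, Nat.card (MulAction.orbit H (w i).out) * m i = N) →
        2 ≤ m 0 → m 0 ≤ m 1 → m 1 ≤ m 2 →
        Nat.card (MulAction.orbit H (w 0).out) + Nat.card (MulAction.orbit H (w 1).out)
        + Nat.card (MulAction.orbit H (w 2).out) = N + 2 →
        HasThreeOrbits H := by
      intro w hw m hms hmo h02 h01 h12' hsum
      have har := three_orbit_arith h02 h01 h12' (hmo 0) (hmo 1) (hmo 2) hsum
      -- Each solution has `N` even. By Cauchy `H` contains an involution, necessarily `-1`, and
      -- therefore `z = 2`.
      have heven : 2 ∣ N := by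
        rcases har.2 with h | h
        · exact ⟨_, h.2⟩
        · rcases h.2 with h | h | h <;> rw [h.2] <;> norm_num
      have hneg := neg_one_mem_of_even h2 (heven.trans ⟨z, by rw [hN, mul_comm]⟩)
      have hz2 : z = 2 := by
        rcases card_signs (H := H) h2 with h | h
        · exfalso
          have := Subgroup.card_eq_one.1 h
          have hm : (⟨-1, hneg⟩ : H) ∈ signs H := mem_signs.2 (Or.inr rfl)
          rw [this, Subgroup.mem_bot] at hm
          exact neg_one_ne_one h2 (congrArg Subtype.val hm)
        · exact h.1
      have hws : Function.Surjective w := by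
        have : Fintype.card (Fin 3) = Fintype.card Ω := by rw [h3]; simp
        exact ((Fintype.bijective_iff_injective_and_card w).2 ⟨hw, this⟩).2
      refine ⟨hneg, fun i => (w i).out, m, N, ?_, ?_, ?_, ?_, by omega, har⟩
      · intro y
        obtain ⟨i, hi⟩ := hws (Quotient.mk _ y : Ω)
        refine ⟨i, ?_⟩
        rw [← MulAction.orbitRel_apply]
        apply Quotient.exact
        rw [hi.symm]; exact (Quotient.out_eq' (w i)).symm
      · intro i j hij
        apply hw
        rw [← MulAction.orbitRel_apply] at hij
        have := Quotient.sound hij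
        rwa [Quotient.out_eq, Quotient.out_eq] at this
      · intro i; rw [hms, hz2]
      · rw [hN, hz2]
    obtain ⟨m₁, hm₁, hs₁, ho₁⟩ := hst ω₁.out
    obtain ⟨m₂, hm₂, hs₂, ho₂⟩ := hst ω₂.out
    obtain ⟨m₃, hm₃, hs₃, ho₃⟩ := hst ω₃.out
    have key' : ∀ w₁ w₂ w₃ : Ω, w₁ ≠ w₂ → w₁ ≠ w₃ → w₂ ≠ w₃ → ∀ m₁ m₂ m₃ : ℕ,
        Nat.card (MulAction.stabilizer H w₁.out) = z * m₁ →
        Nat.card (MulAction.stabilizer H w₂.out) = z * m₂ →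
        Nat.card (MulAction.stabilizer H w₃.out) = z * m₃ →
        Nat.card (MulAction.orbit H w₁.out) * m₁ = N →
        Nat.card (MulAction.orbit H w₂.out) * m₂ = N →
        Nat.card (MulAction.orbit H w₃.out) * m₃ = N →
        2 ≤ m₁ → m₁ ≤ m₂ → m₂ ≤ m₃ →
        Nat.card (MulAction.orbit H w₁.out) + Nat.card (MulAction.orbit H w₂.out)
        + Nat.card (MulAction.orbit H w₃.out) = N + 2 →
        HasThreeOrbits H :=
      fun w₁ w₂ w₃ a b c m₁ m₂ m₃ s₁ s₂ s₃ o₁ o₂ o₃ i₁ i₂ i₃ hsum =>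
        key ![w₁, w₂, w₃] (injective_vec_three a b c) ![m₁, m₂, m₃]
          (Fin.forall_fin_succ.2 ⟨s₁, Fin.forall_fin_two.2 ⟨s₂, s₃⟩⟩)
          (Fin.forall_fin_succ.2 ⟨o₁, Fin.forall_fin_two.2 ⟨o₂, o₃⟩⟩)
          i₁ i₂ i₃ hsum
    rcases le_total m₁ m₂ with a | a <;> rcases le_total m₂ m₃ with b | b <;>
      rcases le_total m₁ m₃ with c | c
    · exact key' ω₁ ω₂ ω₃ h12 h13 h23 _ _ _ hs₁ hs₂ hs₃ ho₁ ho₂ ho₃ hm₁ a b hs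
    · exact key' ω₁ ω₂ ω₃ h12 h13 h23 _ _ _ hs₁ hs₂ hs₃ ho₁ ho₂ ho₃ hm₁ a b hs
    · exact key' ω₁ ω₃ ω₂ h13 h12 h23.symm _ _ _ hs₁ hs₃ hs₂ ho₁ ho₃ ho₂ hm₁ c b (by omega)
    · exact key' ω₃ ω₁ ω₂ h13.symm h23.symm h12 _ _ _ hs₃ hs₁ hs₂ ho₃ ho₁ ho₂ hm₃ c a (by omega)
    · exact key' ω₂ ω₁ ω₃ h12.symm h23 h13 _ _ _ hs₂ hs₁ hs₃ ho₂ ho₁ ho₃ hm₂ a c (by omega)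
    · exact key' ω₂ ω₃ ω₁ h23 h12.symm h13.symm _ _ _ hs₂ hs₃ hs₁ ho₂ ho₃ ho₁ hm₂ b c (by omega)
    · exact key' ω₃ ω₂ ω₁ h23.symm h13.symm h12.symm _ _ _ hs₃ hs₂ hs₁ ho₃ ho₂ ho₁ hm₃ b a
        (by omega)
    · exact key' ω₃ ω₂ ω₁ h23.symm h13.symm h12.symm _ _ _ hs₃ hs₂ hs₁ ho₃ ho₂ ho₁ hm₃ b a
        (by omega)

end Axes

/-! ### Traces of elements of order `4`, `6`, `8`, `10`. -/

section TraceRelations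

variable {K : Type*} [Field K]

/-- The relation satisfied by the trace of an element of order `2k`, for `k = 3, 4, 5`. -/
def IsPolyTrace (k : ℕ) (τ : K) : Prop :=
  (k = 3 ∧ τ = 1) ∨ (k = 4 ∧ τ ^ 2 = 2) ∨ (k = 5 ∧ τ ^ 2 = τ + 1)

/-- For traces `1, τ, 0` the Fricke polynomial is `τ² - 3`, so standard generators always form an
irreducible pair. -/
theorem IsPolyTrace.sq_ne_three (h2 : (2 : K) ≠ 0) {k : ℕ} {τ : K} (h : IsPolyTrace k τ) :
    (1 : K) ^ 2 + τ ^ 2 + 0 ^ 2 - 1 * τ * 0 - 4 ≠ 0 := by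
  intro h0
  rcases h with ⟨-, h⟩ | ⟨-, h⟩ | ⟨-, h⟩
  · rw [h] at h0; exact h2 (by linear_combination -h0)
  · rw [h] at h0; exact one_ne_zero (α := K) (by linear_combination -h0)
  · have : τ = 2 := by linear_combination h0 - h
    rw [this] at h; exact one_ne_zero (α := K) (by linear_combination h)

/-- A noncentral `g` is linearly independent of `1`, since the scalars of determinant one are `±1`.
Relations between powers of `g` can thus be read off coefficientwise. -/
theorem scalar_relation {g : SL(2, K)} (h1 : g ≠ 1) (hm1 : g ≠ -1) {a b : K}
    (h : a • (g : Matrix (Fin 2) (Fin 2) K) = b • 1) : a = 0 ∧ b = 0 := by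
  have ha : a = 0 := by
    by_contra ha
    have hg' : (g : Matrix (Fin 2) (Fin 2) K) = (a⁻¹ * b) • 1 := by
      rw [mul_smul, ← h, inv_smul_smul₀ ha]
    have hd := g.2
    rw [hg', Matrix.det_smul, Matrix.det_one] at hd
    simp only [Fintype.card_fin, mul_one] at hd
    rcases sq_eq_sq_iff_eq_or_eq_neg.1 (hd.trans (one_pow 2).symm) with h | h <;> rw [h] at hg'
    · apply h1; apply Subtype.ext; rw [hg']; simp
    · apply hm1; apply Subtype.ext; rw [hg']; simp
  refine ⟨ha, ?_⟩
  rw [ha, zero_smul] at h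
  exact (smul_eq_zero.1 h.symm).resolve_right one_ne_zero

theorem coe_pow_two (g : SL(2, K)) : ((g ^ 2 : SL(2, K)) : Matrix (Fin 2) (Fin 2) K) =
    (g : Matrix (Fin 2) (Fin 2) K).trace • (g : Matrix (Fin 2) (Fin 2) K) - (1 : K) • 1 := by
  rw [pow_two, Matrix.SpecialLinearGroup.coe_mul, Matrix.mul_self_fin_two, g.2]

/-- Cayley-Hamilton gives the Chebyshev recursion for the coefficients of `gⁿ` in the basis `g`,
`1`. -/
theorem coe_pow_succ_of {g : SL(2, K)} {n : ℕ} {a b : K}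
    (h : ((g ^ n : SL(2, K)) : Matrix (Fin 2) (Fin 2) K) =
      a • (g : Matrix (Fin 2) (Fin 2) K) - b • 1) :
    ((g ^ (n + 1) : SL(2, K)) : Matrix (Fin 2) (Fin 2) K) =
      (a * (g : Matrix (Fin 2) (Fin 2) K).trace - b) • (g : Matrix (Fin 2) (Fin 2) K) - a • 1 := by
  rw [pow_succ, Matrix.SpecialLinearGroup.coe_mul, h, sub_mul, smul_mul_assoc, smul_mul_assoc,
    Matrix.mul_self_fin_two, g.2, one_mul]
  module

theorem coe_pow_three (g : SL(2, K)) : ((g ^ 3 : SL(2, K)) : Matrix (Fin 2) (Fin 2) K) =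
    ((g : Matrix (Fin 2) (Fin 2) K).trace ^ 2 - 1) • (g : Matrix (Fin 2) (Fin 2) K)
      - (g : Matrix (Fin 2) (Fin 2) K).trace • 1 := by
  rw [coe_pow_succ_of (coe_pow_two g)]; ring_nf

theorem coe_pow_four (g : SL(2, K)) : ((g ^ 4 : SL(2, K)) : Matrix (Fin 2) (Fin 2) K) =
    ((g : Matrix (Fin 2) (Fin 2) K).trace ^ 3 - 2 * (g : Matrix (Fin 2) (Fin 2) K).trace) •
      (g : Matrix (Fin 2) (Fin 2) K) - ((g : Matrix (Fin 2) (Fin 2) K).trace ^ 2 - 1) • 1 := by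
  rw [coe_pow_succ_of (coe_pow_three g)]; congr 2; ring

theorem coe_pow_five (g : SL(2, K)) : ((g ^ 5 : SL(2, K)) : Matrix (Fin 2) (Fin 2) K) =
    ((g : Matrix (Fin 2) (Fin 2) K).trace ^ 4 - 3 * (g : Matrix (Fin 2) (Fin 2) K).trace ^ 2 + 1) •
      (g : Matrix (Fin 2) (Fin 2) K) -
      ((g : Matrix (Fin 2) (Fin 2) K).trace ^ 3 - 2 * (g : Matrix (Fin 2) (Fin 2) K).trace) • 1 := by
  rw [coe_pow_succ_of (coe_pow_four g)]; congr 2; ring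

variable {g : SL(2, K)}

theorem ne_of_pow_eq_neg_one (h2 : (2 : K) ≠ 0) {n : ℕ} (hn : Even n) (h : g ^ n = -1) :
    g ≠ 1 ∧ g ≠ -1 := by
  constructor
  · rintro rfl; rw [one_pow] at h; exact neg_one_ne_one h2 h.symm
  · rintro rfl; rw [hn.neg_one_pow] at h; exact neg_one_ne_one h2 h.symm

theorem trace_eq_zero_iff (h2 : (2 : K) ≠ 0) :
    (g : Matrix (Fin 2) (Fin 2) K).trace = 0 ↔ g ^ 2 = -1 := by
  constructor
  · intro h
    apply Subtype.ext
    rw [coe_pow_two, h]; simp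
  · intro h
    obtain ⟨h1, hm1⟩ := ne_of_pow_eq_neg_one h2 even_two h
    have h3 := coe_pow_two g
    rw [h] at h3
    refine (scalar_relation h1 hm1 (b := 0) ?_).1
    rw [zero_smul]
    have : (g : Matrix (Fin 2) (Fin 2) K).trace • (g : Matrix (Fin 2) (Fin 2) K) =
      ((-1 : SL(2, K)) : Matrix (Fin 2) (Fin 2) K) + (1 : K) • 1 := by rw [h3]; abel
    rw [this]; simp

theorem pow_three_of_trace (h : (g : Matrix (Fin 2) (Fin 2) K).trace = 1) : g ^ 3 = -1 := by
  apply Subtype.ext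
  rw [coe_pow_three, h]; simp

theorem trace_of_pow_three (h1 : g ≠ 1) (hm1 : g ≠ -1) (h : g ^ 3 = -1) :
    (g : Matrix (Fin 2) (Fin 2) K).trace = 1 := by
  have h3 := coe_pow_three g
  rw [h] at h3
  have := (scalar_relation h1 hm1 (a := (g : Matrix (Fin 2) (Fin 2) K).trace ^ 2 - 1)
    (b := (g : Matrix (Fin 2) (Fin 2) K).trace - 1) (by
      rw [← sub_eq_zero] at h3 ⊢
      rw [← neg_eq_zero, ← h3]; simp; module)).2
  exact sub_eq_zero.1 this

theorem pow_four_iff (h2 : (2 : K) ≠ 0) :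
    (g : Matrix (Fin 2) (Fin 2) K).trace ^ 2 = 2 ↔ g ^ 4 = -1 := by
  constructor
  · intro h
    apply Subtype.ext
    have : (g : Matrix (Fin 2) (Fin 2) K).trace ^ 3 - 2 * (g : Matrix (Fin 2) (Fin 2) K).trace
      = 0 := by linear_combination (g : Matrix (Fin 2) (Fin 2) K).trace * h
    rw [coe_pow_four, this, h, zero_smul, zero_sub]
    norm_num
  · intro h
    obtain ⟨h1, hm1⟩ := ne_of_pow_eq_neg_one h2 ⟨2, rfl⟩ h
    have h3 := coe_pow_four g
    rw [h] at h3
    have := (scalar_relation h1 hm1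
      (a := (g : Matrix (Fin 2) (Fin 2) K).trace ^ 3 - 2 * (g : Matrix (Fin 2) (Fin 2) K).trace)
      (b := (g : Matrix (Fin 2) (Fin 2) K).trace ^ 2 - 2) (by
        rw [← sub_eq_zero] at h3 ⊢
        rw [← neg_eq_zero, ← h3]; simp; module)).2
    exact sub_eq_zero.1 this

theorem pow_five_of_trace
    (h : (g : Matrix (Fin 2) (Fin 2) K).trace ^ 2 = (g : Matrix (Fin 2) (Fin 2) K).trace + 1) :
    g ^ 5 = -1 := by
  apply Subtype.ext
  set c := (g : Matrix (Fin 2) (Fin 2) K).trace with hc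
  have e1 : c ^ 4 - 3 * c ^ 2 + 1 = 0 := by linear_combination (c ^ 2 + c - 1) * h
  have e2 : c ^ 3 - 2 * c = 1 := by linear_combination (c + 1) * h
  rw [coe_pow_five, ← hc, e1, e2]; simp

theorem trace_of_pow_five (h1 : g ≠ 1) (hm1 : g ≠ -1) (h : g ^ 5 = -1) :
    (g : Matrix (Fin 2) (Fin 2) K).trace ^ 2 = (g : Matrix (Fin 2) (Fin 2) K).trace + 1 := by
  have h3 := coe_pow_five g
  rw [h] at h3
  set c := (g : Matrix (Fin 2) (Fin 2) K).trace with hc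
  obtain ⟨e1, e2⟩ := scalar_relation h1 hm1 (a := c ^ 4 - 3 * c ^ 2 + 1)
    (b := c ^ 3 - 2 * c - 1) (by
      rw [← sub_eq_zero] at h3 ⊢
      rw [← neg_eq_zero, ← h3]; simp; module)
  -- The constant coefficient also admits the root `c = -1`, the trace of an element of order `3`.
  -- The coefficient of `g` rules it out.
  by_cases hc1 : c + 1 = 0
  · exfalso
    have : c = -1 := by linear_combination hc1
    rw [this] at e1
    exact one_ne_zero (α := K) (by linear_combination -e1)
  · have : (c + 1) * (c ^ 2 - c - 1) = 0 := by linear_combination e2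
    have := (mul_eq_zero.1 this).resolve_left hc1
    linear_combination this

theorem IsPolyTrace.pow_eq (h2 : (2 : K) ≠ 0) {k : ℕ}
    (h : IsPolyTrace k (g : Matrix (Fin 2) (Fin 2) K).trace) : g ^ k = -1 := by
  rcases h with ⟨rfl, h⟩ | ⟨rfl, h⟩ | ⟨rfl, h⟩
  · exact pow_three_of_trace h
  · exact (pow_four_iff h2).1 h
  · exact pow_five_of_trace h

theorem isPolyTrace_of_pow_eq (h2 : (2 : K) ≠ 0) (h1 : g ≠ 1) (hm1 : g ≠ -1) {k : ℕ}
    (hk : k = 3 ∨ k = 4 ∨ k = 5) (h : g ^ k = -1) :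
    IsPolyTrace k (g : Matrix (Fin 2) (Fin 2) K).trace := by
  rcases hk with rfl | rfl | rfl
  · exact Or.inl ⟨rfl, trace_of_pow_three h1 hm1 h⟩
  · exact Or.inr (Or.inl ⟨rfl, (pow_four_iff h2).2 h⟩)
  · exact Or.inr (Or.inr ⟨rfl, trace_of_pow_five h1 hm1 h⟩)

end TraceRelations

/-! ### Dihedral and polyhedral configurations of axes. -/

section Polyhedral

variable {K : Type*} [Field K] {H : Subgroup SL(2, K)}

theorem card_stabilizer_neg (x : axes H) :
    MulAction.stabilizer H (-x) = MulAction.stabilizer H x := by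
  ext h
  rw [MulAction.mem_stabilizer_iff, MulAction.mem_stabilizer_iff, smul_neg_axes, neg_inj]

theorem card_stabilizer_of_mem_orbit [Finite H] [Finite (axes H)] {x y : axes H}
    (h : y ∈ MulAction.orbit H x) :
    Nat.card (MulAction.stabilizer H y) = Nat.card (MulAction.stabilizer H x) := by
  have h1 := card_orbit_mul_card_stabilizer' x
  have h2 := card_orbit_mul_card_stabilizer' y
  rw [MulAction.orbit_eq_iff.2 h, ← h1] at h2
  have : Nonempty (MulAction.orbit H x) := ⟨⟨x, MulAction.mem_orbit_self x⟩⟩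
  exact Nat.eq_of_mul_eq_mul_left Nat.card_pos h2

theorem exists_generator_stabilizer [Finite H] (h2 : (2 : K) ≠ 0) (x : axes H) :
    ∃ t : H, orderOf t = Nat.card (MulAction.stabilizer H x) ∧ t • x = x ∧
      ∀ g : H, g • x = x → ∃ i : ℕ, t ^ i = g := by
  have := isCyclic_stabilizer h2 x
  obtain ⟨t, ht⟩ := IsCyclic.exists_generator (α := MulAction.stabilizer H x)
  refine ⟨t, ?_, t.2, fun g hg => ?_⟩
  · rw [Subgroup.orderOf_coe, orderOf_eq_card_of_forall_mem_zpowers ht]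
  · have h1 := ht ⟨g, hg⟩
    rw [← mem_powers_iff_mem_zpowers] at h1
    obtain ⟨i, hi⟩ := h1
    exact ⟨i, by simpa using congrArg Subtype.val hi⟩

theorem pow_half_eq_neg_one (h2 : (2 : K) ≠ 0) {t : SL(2, K)} {n : ℕ} (hn : 0 < n)
    (ht : orderOf t = 2 * n) : t ^ n = -1 := by
  have h1 : t ^ n * t ^ n = 1 := by
    rw [← pow_add, ← two_mul, ← ht, pow_orderOf_eq_one]
  rcases eq_one_or_eq_neg_one_of_sq h2 h1 with h | h
  · have := orderOf_dvd_of_pow_eq_one h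
    rw [ht] at this
    have := Nat.le_of_dvd hn this
    omega
  · exact h

/-- Two matrices of trace zero differing by an element of a torus reverse the torus. -/
theorem smul_eq_or_of_trace_eq_zero (h2 : (2 : K) ≠ 0) {x : axes H} {u c : H}
    (hu : ((u : SL(2, K)) : Matrix (Fin 2) (Fin 2) K).trace = 0)
    (huc : (((u * c : H) : SL(2, K)) : Matrix (Fin 2) (Fin 2) K).trace = 0)
    (hc : c • x = x) (h1 : (c : SL(2, K)) ≠ 1) (hm1 : (c : SL(2, K)) ≠ -1) :
    u • x = x ∨ u • x = -x := by
  have e1 : (u : SL(2, K)) * u = -1 := by rw [← pow_two]; exact (trace_eq_zero_iff h2).1 hu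
  have e2 : (u * c : SL(2, K)) * (u * c) = -1 := by
    rw [← pow_two]; exact (trace_eq_zero_iff h2).1 huc
  -- Since `u² = (u c)² = -1`, one gets `c u c = u`. Hence `c` fixes `u • x`, which must be `x` or
  -- `-x`.
  have e3 : (c : SL(2, K)) * u * c = u := by
    have h3 : (u : SL(2, K)) * (c * u * c) = u * u := by rw [e1, ← e2]; group
    exact mul_left_cancel h3
  have e4 : c * u * c = u := Subtype.ext e3
  have e5 : c • (u • x) = u • x := by
    nth_rewrite 2 [← e4]
    rw [mul_smul, mul_smul, hc]
  rcases eq_or_eq_neg_axes h2 h1 hm1 hc e5 with h | h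
  · exact Or.inl h
  · exact Or.inr h

/-- In the dihedral case the group is generated by a rotation and a reversing element. -/
theorem exists_dihedral_generators [Finite H] (h2 : (2 : K) ≠ 0) {x : axes H} {n : ℕ}
    (hn : 2 ≤ n) (hx : Nat.card (MulAction.stabilizer H x) = 2 * n) (hH : Nat.card H = 4 * n) :
    ∃ a b : H, orderOf a = 2 * n ∧ b * a * b⁻¹ = a⁻¹ ∧ ((b : SL(2, K)) ^ 2 = -1) ∧
      ∀ i : ℕ, a ^ i ≠ b := by
  obtain ⟨a, ha, hax, hgen⟩ := exists_generator_stabilizer h2 x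
  rw [hx] at ha
  have hidx : (MulAction.stabilizer H x).index = 2 := by
    have := (MulAction.stabilizer H x).card_mul_index
    rw [hx, hH] at this
    have h3 : 2 * n * (MulAction.stabilizer H x).index = 2 * n * 2 := by rw [this]; ring
    exact Nat.eq_of_mul_eq_mul_left (by omega) h3
  have hnorm := Subgroup.normal_of_index_eq_two hidx
  obtain ⟨b, hb⟩ : ∃ b, b ∉ MulAction.stabilizer H x := by
    by_contra! h
    have : MulAction.stabilizer H x = ⊤ := by ext; simp [h]
    rw [this, Subgroup.index_top] at hidx
    omega
  have ha1 : (a : SL(2, K)) ≠ 1 := by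
    intro h
    have : a = 1 := Subtype.ext h
    rw [this, orderOf_one] at ha; omega
  have ham1 : (a : SL(2, K)) ≠ -1 := by
    intro h
    have : a ^ 2 = 1 := Subtype.ext (by simp [h])
    have := Nat.le_of_dvd (by norm_num) (orderOf_dvd_of_pow_eq_one this)
    omega
  -- The stabilizer has index two and is normal, so `a` fixes `b • x`. This leaves `±x`, and `b`
  -- does not fix `x`.
  have hbx : b • x = -x := by
    have h3 : a • (b • x) = b • x := by
      have h4 := hnorm.conj_mem a hax b⁻¹
      rw [inv_inv, MulAction.mem_stabilizer_iff, mul_smul, mul_smul, inv_smul_eq_iff] at h4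
      exact h4
    rcases eq_or_eq_neg_axes h2 ha1 ham1 hax h3 with h | h
    · exact absurd h hb
    · exact h
  have hbJ : ((b : SL(2, K)) : Matrix (Fin 2) (Fin 2) K) * x
      = -(x * ((b : SL(2, K)) : Matrix (Fin 2) (Fin 2) K)) := by
    rw [(smul_eq_iff_axes b x (-x)).1 hbx, coe_neg_axes, neg_mul]
  have htr := x.2.1.trace_eq_zero h2 hbJ
  -- Both `b` and `b a` reverse the axis, so they have trace zero and square `-1`, whence `a b a =
  -- b`.
  have hba : b * a * b⁻¹ = a⁻¹ := by
    have hab : (((b * a : H) : SL(2, K)) : Matrix (Fin 2) (Fin 2) K) * x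
      = -(x * (((b * a : H) : SL(2, K)) : Matrix (Fin 2) (Fin 2) K)) := by
      have : (b * a) • x = -x := by rw [mul_smul, hax, hbx]
      rw [(smul_eq_iff_axes (b * a) x (-x)).1 this, coe_neg_axes, neg_mul]
    have e1 : (b : SL(2, K)) * b = -1 := by rw [← pow_two]; exact (trace_eq_zero_iff h2).1 htr
    have e2 : (b * a : SL(2, K)) * (b * a) = -1 := by
      rw [← pow_two]; exact (trace_eq_zero_iff h2).1 (x.2.1.trace_eq_zero h2 hab)
    have : (a : SL(2, K)) * b * a = b := by
      have h3 : (b : SL(2, K)) * (a * b * a) = b * b := by rw [e1, ← e2]; group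
      exact mul_left_cancel h3
    rw [mul_inv_eq_iff_eq_mul, eq_inv_mul_iff_mul_eq, ← mul_assoc]
    exact Subtype.ext this
  refine ⟨a, b, ha, hba, (trace_eq_zero_iff h2).1 htr, fun i hi => hb ?_⟩
  rw [← hi]
  exact Subgroup.pow_mem _ hax i

variable (H) in
/-- The binary polyhedral groups, described through their action on axes. -/
structure IsPolyhedral (k : ℕ) : Prop where
  hk : k = 3 ∨ k = 4 ∨ k = 5
  neg_one_mem : (-1 : SL(2, K)) ∈ H
  -- This encodes the orders `24`, `48`, `120` for `k = 3`, `4`, `5`.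
  card_eq : Nat.card H * (6 - k) = 24 * k
  exists_four : ∃ x : axes H, Nat.card (MulAction.stabilizer H x) = 4
  exists_max : ∃ x : axes H, Nat.card (MulAction.stabilizer H x) = 2 * k
  card_stabilizer : ∀ x : axes H, Nat.card (MulAction.stabilizer H x) = 4 ∨
    Nat.card (MulAction.stabilizer H x) = 6 ∨ Nat.card (MulAction.stabilizer H x) = 2 * k
  -- The sign is needed for `k = 3`: a tetrahedron joins a vertex to the opposite face, so an axis
  -- and its reverse lie in different orbits.
  trans : ∀ x y : axes H, Nat.card (MulAction.stabilizer H x) = 2 * k →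
    Nat.card (MulAction.stabilizer H y) = 2 * k → ∃ h : H, h • x = y ∨ h • x = -y
  neg : k ≠ 3 → ∀ x : axes H, Nat.card (MulAction.stabilizer H x) = 2 * k → ∃ h : H, h • x = -x

/-- In a group of order `24` an axis of order `6` cannot be reversed. -/
theorem neg_not_mem_orbit [Finite H] [Finite (axes H)] (h2 : (2 : K) ≠ 0)
    (hH : Nat.card H = 24) {x : axes H} (hx : Nat.card (MulAction.stabilizer H x) = 6) :
    -x ∉ MulAction.orbit H x := by
  intro hneg
  have hO : (MulAction.orbit H x).ncard = 4 := by
    have h1 := card_orbit_mul_card_stabilizer' x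
    rw [hx, hH, Nat.card_coe_set_eq] at h1
    omega
  have hfin : (MulAction.orbit H x).Finite := Set.toFinite _
  have hnegO : ∀ y ∈ MulAction.orbit H x, -y ∈ MulAction.orbit H x := by
    rintro _ ⟨h, rfl⟩
    change -(h • x) ∈ _
    rw [← smul_neg_axes]
    exact MulAction.mem_orbit_of_mem_orbit _ hneg
  obtain ⟨y, hy, hyx⟩ : ∃ y ∈ MulAction.orbit H x, y ∉ ({x, -x} : Set (axes H)) := by
    by_contra! h
    have := Set.ncard_le_ncard (show MulAction.orbit H x ⊆ {x, -x} from h)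
    rw [hO, Set.ncard_pair (neg_ne_axes h2 x).symm] at this
    omega
  rw [Set.mem_insert_iff, Set.mem_singleton_iff, not_or] at hyx
  -- If `-x` were in the orbit, the four elements of the orbit would be `±x`, `±y`. A generator of
  -- order six of the stabilizer of `x` permutes `±y`, so its square, still noncentral, fixes both
  -- `x` and `y`, which is impossible.
  have hset : ({x, -x, y, -y} : Set (axes H)) = MulAction.orbit H x := by
    apply Set.eq_of_subset_of_ncard_le _ _ hfin
    · rintro z (rfl | rfl | rfl | rfl)
      exacts [MulAction.mem_orbit_self _, hneg, hy, hnegO _ hy]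
    · rw [hO, Set.ncard_insert_of_notMem, Set.ncard_insert_of_notMem,
        Set.ncard_pair (neg_ne_axes h2 y).symm]
      · rintro (h | h)
        · exact hyx.2 h.symm
        · exact hyx.1 (neg_injective h).symm
      · rintro (h | h | h)
        · exact neg_ne_axes h2 x h.symm
        · exact hyx.1 h.symm
        · exact hyx.2 (by rw [h, neg_neg])
  obtain ⟨t, ht, htx, -⟩ := exists_generator_stabilizer h2 x
  rw [hx] at ht
  have hty : t • y = y ∨ t • y = -y := by
    have h1 : t • y ∈ ({x, -x, y, -y} : Set (axes H)) := by
      rw [hset]; exact MulAction.mem_orbit_of_mem_orbit _ hy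
    rcases h1 with h | h | h | h
    · exfalso; apply hyx.1
      rw [← htx] at h; exact MulAction.injective t h
    · exfalso; apply hyx.2
      rw [← htx, ← smul_neg_axes, ← htx] at h
      have := MulAction.injective t h
      rwa [htx] at this
    · exact Or.inl h
    · exact Or.inr h
  have ht2 : (t ^ 2) • y = y := by
    rw [pow_two, mul_smul]
    rcases hty with h | h
    · rw [h, h]
    · rw [h, smul_neg_axes, h, neg_neg]
  have ht2x : (t ^ 2) • x = x := by rw [pow_two, mul_smul, htx, htx]
  have h1 : ((t ^ 2 : H) : SL(2, K)) ≠ 1 := by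
    intro h
    have := Nat.le_of_dvd (by norm_num) (orderOf_dvd_of_pow_eq_one (Subtype.ext h : t ^ 2 = 1))
    omega
  have hm1 : ((t ^ 2 : H) : SL(2, K)) ≠ -1 := by
    intro h
    have h3 : t ^ 4 = 1 := by
      apply Subtype.ext
      have : t ^ 4 = t ^ 2 * t ^ 2 := by rw [← pow_add]
      rw [this, Subgroup.coe_mul, h]; simp
    have := Nat.le_of_dvd (by norm_num) (orderOf_dvd_of_pow_eq_one h3)
    omega
  rcases eq_or_eq_neg_axes h2 h1 hm1 ht2x ht2 with h | h
  exacts [hyx.1 h, hyx.2 h]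

/-- For `k = 4, 5` the axes with stabilizer of order `2k` form one orbit, closed under negation. For
`k = 3` there are two such orbits, and negation exchanges them by `neg_not_mem_orbit`. -/
theorem HasThreeOrbits.dihedral_or_polyhedral [Finite H] [Finite (axes H)] (h2 : (2 : K) ≠ 0)
    (h : HasThreeOrbits H) :
    (∃ n, 2 ≤ n ∧ Nat.card H = 4 * n ∧ ∃ x : axes H,
      Nat.card (MulAction.stabilizer H x) = 2 * n) ∨ ∃ k, IsPolyhedral H k := by
  obtain ⟨hneg, x, m, N, hcov, hdisj, hst, hN, hm2, hm0, h⟩ := h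
  rcases h with ⟨-, h⟩ | ⟨hm1, h⟩
  · exact Or.inl ⟨m 2, hm2, by rw [hN, h]; ring, x 2, hst 2⟩
  · right
    have hk : m 2 = 3 ∨ m 2 = 4 ∨ m 2 = 5 := by omega
    have hs : ∀ y, Nat.card (MulAction.stabilizer H y) = 4 ∧ y ∈ MulAction.orbit H (x 0) ∨
        Nat.card (MulAction.stabilizer H y) = 6 ∧ y ∈ MulAction.orbit H (x 1) ∨
        Nat.card (MulAction.stabilizer H y) = 2 * m 2 ∧ y ∈ MulAction.orbit H (x 2) := by
      intro y
      obtain ⟨i, hi⟩ := hcov y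
      have h3 := card_stabilizer_of_mem_orbit hi
      rw [hst] at h3
      fin_cases i
      · exact Or.inl ⟨by rw [h3]; simp [hm0], hi⟩
      · exact Or.inr (Or.inl ⟨by rw [h3]; simp [hm1], hi⟩)
      · exact Or.inr (Or.inr ⟨h3, hi⟩)
    have htr : ∀ {y y' z : axes H}, y ∈ MulAction.orbit H z → y' ∈ MulAction.orbit H z →
        ∃ h : H, h • y = y' := by
      intro y y' z h1 h3
      rw [← MulAction.orbit_eq_iff.2 h1] at h3
      exact h3
    have hneg3 : m 2 ≠ 3 → ∀ y, Nat.card (MulAction.stabilizer H y) = 2 * m 2 →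
        y ∈ MulAction.orbit H (x 2) := by
      intro h3 y hy
      rcases hs y with h | h | h
      · omega
      · omega
      · exact h.2
    have hcross : m 2 = 3 → ∀ y ∈ MulAction.orbit H (x 1), -y ∈ MulAction.orbit H (x 2) := by
      intro h3 y hy
      have hH : Nat.card H = 24 := by omega
      have hy6 : Nat.card (MulAction.stabilizer H y) = 6 := by
        rw [card_stabilizer_of_mem_orbit hy, hst, hm1]
      have h4 := neg_not_mem_orbit h2 hH hy6
      rw [MulAction.orbit_eq_iff.2 hy] at h4
      have h5 : Nat.card (MulAction.stabilizer H (-y)) = 6 := by rw [card_stabilizer_neg, hy6]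
      rcases hs (-y) with h | h | h
      · omega
      · exact absurd h.2 h4
      · exact h.2
    refine ⟨m 2, hk, hneg, ?_, ⟨x 0, by rw [hst, hm0]⟩, ⟨x 2, hst 2⟩, ?_, ?_, ?_⟩
    · rw [hN]
      rcases h with h | h | h <;> rw [h.1, h.2]
    · intro y
      rcases hs y with h | h | h
      exacts [Or.inl h.1, Or.inr (Or.inl h.1), Or.inr (Or.inr h.1)]
    · intro y y' hy hy'
      by_cases h3 : m 2 = 3
      · rcases hs y with h4 | h4 | h4
        · omega
        · rcases hs y' with h5 | h5 | h5
          · omega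
          · obtain ⟨g, hg⟩ := htr h4.2 h5.2
            exact ⟨g, Or.inl hg⟩
          · obtain ⟨g, hg⟩ := htr (hcross h3 _ h4.2) h5.2
            exact ⟨g, Or.inr (by rw [← hg, smul_neg_axes, neg_neg])⟩
        · rcases hs y' with h5 | h5 | h5
          · omega
          · obtain ⟨g, hg⟩ := htr h4.2 (hcross h3 _ h5.2)
            exact ⟨g, Or.inr hg⟩
          · obtain ⟨g, hg⟩ := htr h4.2 h5.2
            exact ⟨g, Or.inl hg⟩
      · obtain ⟨g, hg⟩ := htr (hneg3 h3 y hy) (hneg3 h3 y' hy')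
        exact ⟨g, Or.inl hg⟩
    · intro h3 y hy
      exact htr (hneg3 h3 y hy) (hneg3 h3 (-y) (by rw [card_stabilizer_neg, hy]))

end Polyhedral

/-! ### Standard generators in a polyhedral group. -/

section Polyhedral

variable {K : Type*} [Field K] {H : Subgroup SL(2, K)}

theorem trace_mul_inv (g h : SL(2, K)) :
    ((g * h⁻¹ : SL(2, K)) : Matrix (Fin 2) (Fin 2) K).trace =
      (g : Matrix (Fin 2) (Fin 2) K).trace * (h : Matrix (Fin 2) (Fin 2) K).trace
      - ((g * h : SL(2, K)) : Matrix (Fin 2) (Fin 2) K).trace := by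
  rw [Matrix.SpecialLinearGroup.coe_mul, Matrix.SpecialLinearGroup.coe_mul,
    Matrix.SpecialLinearGroup.coe_inv, Matrix.adjugate_fin_two]
  simp [Matrix.trace_fin_two, Matrix.mul_apply, Fin.sum_univ_two]
  ring

theorem trace_mul_pow_two (g h : SL(2, K)) :
    ((g * h ^ 2 : SL(2, K)) : Matrix (Fin 2) (Fin 2) K).trace =
      ((g * h : SL(2, K)) : Matrix (Fin 2) (Fin 2) K).trace *
        (h : Matrix (Fin 2) (Fin 2) K).trace - (g : Matrix (Fin 2) (Fin 2) K).trace := by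
  rw [Matrix.SpecialLinearGroup.coe_mul, coe_pow_two, Matrix.SpecialLinearGroup.coe_mul, mul_sub,
    mul_smul_comm, mul_smul_comm, mul_one, Matrix.trace_sub, Matrix.trace_smul, Matrix.trace_smul]
  simp [mul_comm]

theorem trace_neg_coe (g : SL(2, K)) : ((-g : SL(2, K)) : Matrix (Fin 2) (Fin 2) K).trace =
    -(g : Matrix (Fin 2) (Fin 2) K).trace := by
  rw [Matrix.SpecialLinearGroup.coe_neg, Matrix.trace_neg]

theorem IsPolyhedral.k_bounds {k : ℕ} (hP : IsPolyhedral H k) : 3 ≤ k ∧ k ≤ 5 := by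
  rcases hP.hk with h | h | h <;> omega

/-- Let `u` of order four fix an axis `y` with stabilizer of order four. If every trace zero element
preserved `±x`, all conjugates of `u` would reverse `x`, because `u` fixes no axis in the orbit of
`x`. So `u` and its conjugates reverse the whole orbit of `x`, and the product of `u` with a
conjugate fixes this orbit pointwise and is central. Then `u` fixes every `g • y`, the orbit of `y`
has at most two elements, and `H` is too small. -/
theorem IsPolyhedral.exists_involution [Finite H] [Finite (axes H)] (h2 : (2 : K) ≠ 0) {k : ℕ}
    (hP : IsPolyhedral H k) {x : axes H} (hx : Nat.card (MulAction.stabilizer H x) = 2 * k) :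
    ∃ u : H, ((u : SL(2, K)) : Matrix (Fin 2) (Fin 2) K).trace = 0 ∧ u • x ≠ x ∧ u • x ≠ -x := by
  obtain ⟨hk3, hk5⟩ := hP.k_bounds
  obtain ⟨y, hy⟩ := hP.exists_four
  obtain ⟨u, hu, huy, -⟩ := exists_generator_stabilizer h2 y
  rw [hy] at hu
  have hu' : orderOf (u : SL(2, K)) = 2 * 2 := by rw [Subgroup.orderOf_coe, hu]
  have hu2 := pow_half_eq_neg_one h2 (by norm_num) hu'
  obtain ⟨hu1, hum1⟩ := ne_of_pow_eq_neg_one h2 even_two hu2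
  have hH : Nat.card H = 24 ∨ Nat.card H = 48 ∨ Nat.card H = 120 := by
    have := hP.card_eq
    rcases hP.hk with rfl | rfl | rfl <;> omega
  by_contra! hcon
  have hconj : ∀ g : H, (g⁻¹ * u * g) • x = -x := by
    intro g
    have htr : (((g⁻¹ * u * g : H) : SL(2, K)) : Matrix (Fin 2) (Fin 2) K).trace = 0 := by
      rw [trace_eq_zero_iff h2, ← Subgroup.coe_pow]
      have : (g⁻¹ * u * g) ^ 2 = g⁻¹ * u ^ 2 * g := by simp [pow_two, mul_assoc]
      rw [this, Subgroup.coe_mul, Subgroup.coe_mul, Subgroup.coe_pow, hu2]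
      simp
    by_contra h
    have h3 : (g⁻¹ * u * g) • x = x := by
      by_contra h4; exact h (hcon _ htr h4)
    rw [mul_assoc, mul_smul, inv_smul_eq_iff, mul_smul] at h3
    have h5 : Nat.card (MulAction.stabilizer H (g • x)) = 2 * k := by
      rw [card_stabilizer_of_mem_orbit (MulAction.mem_orbit x g), hx]
    rcases eq_or_eq_neg_axes h2 hu1 hum1 huy h3 with h6 | h6
    · rw [h6] at h5; omega
    · rw [h6, card_stabilizer_neg] at h5; omega
  have hO : ∀ z ∈ MulAction.orbit H x, u • z = -z := by
    rintro _ ⟨g, rfl⟩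
    have := hconj g
    rw [mul_assoc, mul_smul, inv_smul_eq_iff, mul_smul, smul_neg_axes] at this
    exact this
  have hsmul : ∀ g : H, g • y = y ∨ g • y = -y := by
    intro g
    have hfix : ∀ z ∈ MulAction.orbit H x, (u * (g * u * g⁻¹)) • z = z := by
      intro z hz
      have e1 : (g * u * g⁻¹) • z = -z := by
        rw [mul_smul, mul_smul, hO _ (MulAction.mem_orbit_of_mem_orbit _ hz), smul_neg_axes,
          smul_inv_smul]
      rw [mul_smul, e1, smul_neg_axes, hO z hz, neg_neg]
    have hcen : ((u * (g * u * g⁻¹) : H) : SL(2, K)) = 1 ∨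
        ((u * (g * u * g⁻¹) : H) : SL(2, K)) = -1 := by
      by_contra hc
      rw [not_or] at hc
      have hsub : MulAction.orbit H x ⊆ {x, -x} := by
        intro z hz
        exact eq_or_eq_neg_axes h2 hc.1 hc.2 (hfix x (MulAction.mem_orbit_self x)) (hfix z hz)
      have h3 := Set.ncard_le_ncard hsub
      rw [Set.ncard_pair (neg_ne_axes h2 x).symm] at h3
      have h4 := card_orbit_mul_card_stabilizer' x
      rw [hx, Nat.card_coe_set_eq] at h4
      have h5 := Nat.mul_le_mul_right (2 * k) h3
      rcases hP.hk with rfl | rfl | rfl <;> have := hP.card_eq <;> omega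
    have h3 : u • (g • y) = g • y := by
      have e1 : (g * u * g⁻¹) • (g • y) = g • y := by
        rw [mul_smul, mul_smul, inv_smul_smul, huy]
      have e2 := smul_axes_of_central hcen (g • y)
      rw [mul_smul, e1] at e2
      exact e2
    exact eq_or_eq_neg_axes h2 hu1 hum1 huy h3
  have hsub : MulAction.orbit H y ⊆ {y, -y} := by
    rintro _ ⟨g, rfl⟩
    exact hsmul g
  have h3 := Set.ncard_le_ncard hsub
  rw [Set.ncard_pair (neg_ne_axes h2 y).symm] at h3
  have h4 := card_orbit_mul_card_stabilizer' y
  rw [hy, Nat.card_coe_set_eq] at h4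
  omega

theorem IsPolyhedral.trace_cases [IsAlgClosed K] [Finite H] (h2 : (2 : K) ≠ 0)
    (hss : ∀ h ∈ H, (h : Matrix (Fin 2) (Fin 2) K).trace ^ 2 = 4 → h = 1 ∨ h = -1) {k : ℕ}
    (hP : IsPolyhedral H k) {g : H} (h1 : (g : SL(2, K)) ≠ 1) (hm1 : (g : SL(2, K)) ≠ -1) :
    ((g : SL(2, K)) : Matrix (Fin 2) (Fin 2) K).trace = 0 ∨
    ((g : SL(2, K)) : Matrix (Fin 2) (Fin 2) K).trace = 1 ∨
    ((g : SL(2, K)) : Matrix (Fin 2) (Fin 2) K).trace = -1 ∨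
    IsPolyTrace k ((g : SL(2, K)) : Matrix (Fin 2) (Fin 2) K).trace ∨
    IsPolyTrace k (-((g : SL(2, K)) : Matrix (Fin 2) (Fin 2) K).trace) := by
  obtain ⟨x, hx⟩ := exists_mem_axes hss h1 hm1
  have hn1 : (-g : SL(2, K)) ≠ 1 := fun h => hm1 (by rw [← h, neg_neg])
  have hnm1 : (-g : SL(2, K)) ≠ -1 := fun h => h1 (neg_injective h)
  have hpow : ∀ n, Nat.card (MulAction.stabilizer H x) = 2 * n →
      (g : SL(2, K)) ^ n = 1 ∨ (g : SL(2, K)) ^ n = -1 := by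
    intro n hn
    have h3 : (⟨g, hx⟩ : MulAction.stabilizer H x) ^ (2 * n) = 1 := by
      rw [← hn]; exact pow_card_eq_one'
    have h4 : g ^ (2 * n) = 1 := by simpa using congrArg Subtype.val h3
    have h5 : (g : SL(2, K)) ^ (2 * n) = 1 := by
      rw [← Subgroup.coe_pow, h4]; rfl
    apply eq_one_or_eq_neg_one_of_sq h2
    rw [← pow_add, ← two_mul, h5]
  have h4 : (g : SL(2, K)) ^ 4 = 1 →
      ((g : SL(2, K)) : Matrix (Fin 2) (Fin 2) K).trace = 0 := by
    intro h
    rw [trace_eq_zero_iff h2]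
    rcases eq_one_or_eq_neg_one_of_sq h2 (g := (g : SL(2, K)) ^ 2) (by rw [← pow_add, h])
      with h3 | h3
    · rw [pow_two] at h3
      rcases eq_one_or_eq_neg_one_of_sq h2 h3 with h3 | h3
      exacts [absurd h3 h1, absurd h3 hm1]
    · exact h3
  have hodd : ∀ n, n = 3 ∨ n = 4 ∨ n = 5 →
      ((g : SL(2, K)) ^ n = 1 ∨ (g : SL(2, K)) ^ n = -1) → 
      ((g : SL(2, K)) : Matrix (Fin 2) (Fin 2) K).trace = 0 ∨
      IsPolyTrace n ((g : SL(2, K)) : Matrix (Fin 2) (Fin 2) K).trace ∨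
      IsPolyTrace n (-((g : SL(2, K)) : Matrix (Fin 2) (Fin 2) K).trace) := by
    intro n hn h
    rcases h with h | h
    · by_cases h5 : n = 4
      · subst h5; exact Or.inl (h4 h)
      · right; right
        rw [← trace_neg_coe]
        apply isPolyTrace_of_pow_eq h2 hn1 hnm1 hn
        have : Odd n := by
          rcases hn with rfl | rfl | rfl
          exacts [⟨1, rfl⟩, absurd rfl h5, ⟨2, rfl⟩]
        rw [this.neg_pow, h]
    · exact Or.inr (Or.inl (isPolyTrace_of_pow_eq h2 h1 hm1 hn h))
  have hthree : ∀ τ : K, IsPolyTrace 3 τ → τ = 1 := by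
    rintro τ (h | h | h)
    · exact h.2
    · omega
    · omega
  rcases hP.card_stabilizer x with h | h | h
  · rcases hpow 2 h with h3 | h3
    · exact Or.inl (h4 (by rw [show 4 = 2 * 2 from rfl, pow_mul, h3, one_pow]))
    · exact Or.inl (h4 (by rw [show 4 = 2 * 2 from rfl, pow_mul, h3]; simp))
  · rcases hodd 3 (Or.inl rfl) (hpow 3 h) with h3 | h3 | h3
    · exact Or.inl h3
    · exact Or.inr (Or.inl (hthree _ h3))
    · exact Or.inr (Or.inr (Or.inl (neg_eq_iff_eq_neg.1 (hthree _ h3))))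
  · rcases hodd k hP.hk (hpow k h) with h3 | h3
    · exact Or.inl h3
    · exact Or.inr (Or.inr (Or.inr h3))

/-- Take `s = ± u t⁻¹`: then `s t = ± u` has trace zero, and `tr(u t⁻¹) = -tr(u t)` lets the sign be
chosen so that `tr s = 1`. -/
theorem exists_pair_of_involution {u t : H} (hm : (-1 : SL(2, K)) ∈ H)
    (hu : ((u : SL(2, K)) : Matrix (Fin 2) (Fin 2) K).trace = 0)
    (hut : (((u * t : H) : SL(2, K)) : Matrix (Fin 2) (Fin 2) K).trace = 1 ∨
      (((u * t : H) : SL(2, K)) : Matrix (Fin 2) (Fin 2) K).trace = -1) :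
    ∃ s : H, ((s : SL(2, K)) : Matrix (Fin 2) (Fin 2) K).trace = 1 ∧
      (((s * t : H) : SL(2, K)) : Matrix (Fin 2) (Fin 2) K).trace = 0 := by
  have h1 := trace_mul_inv (u : SL(2, K)) t
  rw [hu, zero_mul, zero_sub] at h1
  rcases hut with h | h
  · refine ⟨⟨-1, hm⟩ * (u * t⁻¹), ?_, ?_⟩
    · rw [Subgroup.coe_mul] at h
      simp only [Subgroup.coe_mul, Subgroup.coe_inv, neg_mul, one_mul]
      rw [trace_neg_coe, h1, h, neg_neg]
    · simp only [Subgroup.coe_mul, Subgroup.coe_inv, neg_mul, one_mul, inv_mul_cancel_right]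
      rw [trace_neg_coe, hu, neg_zero]
  · refine ⟨u * t⁻¹, ?_, ?_⟩
    · rw [Subgroup.coe_mul] at h
      simp only [Subgroup.coe_mul, Subgroup.coe_inv]
      rw [h1, h, neg_neg]
    · rw [inv_mul_cancel_right, hu]

/-- Let `t` generate the stabilizer of `x`, let `u` be a half-turn moving `x` off `±x`, and put `w =
tr(u t)`, which is nonzero. The goal is `w = ±1`, after which `exists_pair_of_involution` applies.
For `k = 3` there is no other value. For `k = 4` the other value has `w² = 2`, so `tr(u t²)² = (w
τ)² = 4`, which is excluded. For `k = 5` the possible traces of `u t²` force `w τ = ±1`, and `-t²`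
replaces `t`. -/
theorem IsPolyhedral.exists_pair [IsAlgClosed K] [Finite H] (h2 : (2 : K) ≠ 0)
    (hss : ∀ h ∈ H, (h : Matrix (Fin 2) (Fin 2) K).trace ^ 2 = 4 → h = 1 ∨ h = -1) {k : ℕ}
    (hP : IsPolyhedral H k) :
    ∃ s t : H, ((s : SL(2, K)) : Matrix (Fin 2) (Fin 2) K).trace = 1 ∧
      IsPolyTrace k ((t : SL(2, K)) : Matrix (Fin 2) (Fin 2) K).trace ∧
      (((s * t : H) : SL(2, K)) : Matrix (Fin 2) (Fin 2) K).trace = 0 := by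
  have := finite_axes h2 hss
  obtain ⟨hk3, hk5⟩ := hP.k_bounds
  obtain ⟨x, hx⟩ := hP.exists_max
  obtain ⟨u, hu, hux, hux'⟩ := hP.exists_involution h2 hx
  obtain ⟨t, ht, htx, -⟩ := exists_generator_stabilizer h2 x
  rw [hx, ← Subgroup.orderOf_coe] at ht
  have htne : (t : SL(2, K)) ≠ 1 ∧ (t : SL(2, K)) ≠ -1 := by
    constructor
    · intro h; rw [h, orderOf_one] at ht; omega
    · intro h
      have := Nat.le_of_dvd (by norm_num)
        (orderOf_dvd_of_pow_eq_one (show (t : SL(2, K)) ^ 2 = 1 by rw [h]; simp))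
      omega
  have hτ := isPolyTrace_of_pow_eq h2 htne.1 htne.2 hP.hk (pow_half_eq_neg_one h2 (by omega) ht)
  set τ := ((t : SL(2, K)) : Matrix (Fin 2) (Fin 2) K).trace with hτdef
  have hnot : ∀ c : H, c • x = x → ((u * c : H) : SL(2, K)) ≠ 1 ∧ ((u * c : H) : SL(2, K)) ≠ -1 := by
    intro c hc
    have h3 : (u * c) • x ≠ x := by rw [mul_smul, hc]; exact hux
    exact ⟨fun h => h3 (smul_axes_of_central (Or.inl h) x),
      fun h => h3 (smul_axes_of_central (Or.inr h) x)⟩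
  have ht2x : (t ^ 2) • x = x := by rw [pow_two, mul_smul, htx, htx]
  obtain ⟨e1, e2⟩ := hnot t htx
  obtain ⟨f1, f2⟩ := hnot (t ^ 2) ht2x
  have hw0 : (((u * t : H) : SL(2, K)) : Matrix (Fin 2) (Fin 2) K).trace ≠ 0 := fun h => by
    rcases smul_eq_or_of_trace_eq_zero h2 hu h htx htne.1 htne.2 with h | h
    exacts [hux h, hux' h]
  have hv : (((u * t ^ 2 : H) : SL(2, K)) : Matrix (Fin 2) (Fin 2) K).trace =
      (((u * t : H) : SL(2, K)) : Matrix (Fin 2) (Fin 2) K).trace * τ := by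
    have := trace_mul_pow_two (u : SL(2, K)) t
    rw [hu, sub_zero] at this
    exact this
  have hw := hP.trace_cases h2 hss e1 e2
  have hv' := hP.trace_cases h2 hss f1 f2
  have hvc : (((u * t ^ 2 : H) : SL(2, K)) : Matrix (Fin 2) (Fin 2) K).trace ^ 2 ≠ 4 := fun h => by
    rcases hss _ (u * t ^ 2).2 h with h | h
    exacts [f1 h, f2 h]
  rw [hv] at hv' hvc
  set w := (((u * t : H) : SL(2, K)) : Matrix (Fin 2) (Fin 2) K).trace with hwdef
  by_cases hw1 : w = 1 ∨ w = -1
  · obtain ⟨s, hs, hst⟩ := exists_pair_of_involution hP.neg_one_mem hu hw1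
    exact ⟨s, t, hs, hτ, hst⟩
  rw [not_or] at hw1
  have hww : IsPolyTrace k w ∨ IsPolyTrace k (-w) := by
    rcases hw with h | h | h | h
    exacts [absurd h hw0, absurd h hw1.1, absurd h hw1.2, h]
  have hk : k = 5 := by
    rcases hP.hk with rfl | rfl | rfl
    · rcases hww with h | h <;> rcases h with h | h | h <;> first | omega | skip
      · exact absurd h.2 hw1.1
      · exact absurd (by rw [← h.2, neg_neg]) hw1.2
    · exfalso
      have h3 : w ^ 2 = 2 := by
        rcases hww with h | h <;> rcases h with h | h | h <;> first | omega | skip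
        · exact h.2
        · rw [← h.2]; ring
      have h4 : τ ^ 2 = 2 := by
        rcases hτ with h | h | h <;> first | omega | exact h.2
      apply hvc; rw [mul_pow, h3, h4]; norm_num
    · rfl
  subst hk
  have hp5 : ∀ c : K, IsPolyTrace 5 c → c ^ 2 = c + 1 := by
    rintro c (h | h | h)
    · omega
    · omega
    · exact h.2
  have hτ5 := hp5 _ hτ
  have hv1 : w * τ = 1 ∨ w * τ = -1 := by
    have hτ0 : τ ≠ 0 := by
      intro h; rw [h] at hτ5; exact one_ne_zero (α := K) (by linear_combination -hτ5)
    obtain ⟨ε, hε, hwε⟩ : ∃ ε : K, (ε = 1 ∨ ε = -1) ∧ (ε * w) ^ 2 = ε * w + 1 := by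
      rcases hww with h | h
      · exact ⟨1, Or.inl rfl, by simpa using hp5 _ h⟩
      · exact ⟨-1, Or.inr rfl, by simpa using hp5 _ h⟩
    have hε2 : ε * ε = 1 := by rcases hε with rfl | rfl <;> ring
    have hfac : (ε * w - τ) * (ε * w - (1 - τ)) = 0 := by linear_combination hwε - hτ5
    rcases mul_eq_zero.1 hfac with h | h
    · have hwt : w = ε * τ := by linear_combination ε * h - w * hε2
      rcases hv' with h3 | h3 | h3 | h3
      · exact absurd h3 (mul_ne_zero hw0 hτ0)
      · exact Or.inl h3
      · exact Or.inr h3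
      · exfalso
        have h4 : w * τ = ε * (τ + 1) := by rw [hwt]; linear_combination ε * hτ5
        rw [h4] at h3
        have h5 : (τ + 1) ^ 2 = (τ + 1) + 1 ∨ (τ + 1) ^ 2 = -(τ + 1) + 1 := by
          rcases hε with rfl | rfl <;> rcases h3 with h3 | h3 <;> have h6 := hp5 _ h3
          · left; linear_combination h6
          · right; linear_combination h6
          · right; linear_combination h6
          · left; linear_combination h6
        rcases h5 with h5 | h5
        · have : (2 : K) * τ = 0 := by linear_combination h5 - hτ5
          exact (mul_ne_zero h2 hτ0) this
        · have h6 : (2 : K) * (2 * τ + 1) = 0 := by linear_combination h5 - hτ5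
          have h7 : 2 * τ + 1 = 0 := (mul_eq_zero.1 h6).resolve_left h2
          exact one_ne_zero (α := K) (by linear_combination (2 * τ - 3) * h7 - 4 * hτ5)
    · have hwt : w = ε * (1 - τ) := by linear_combination ε * h - w * hε2
      have : w * τ = -ε := by rw [hwt]; linear_combination -ε * hτ5
      rw [this]
      rcases hε with rfl | rfl
      · exact Or.inr rfl
      · exact Or.inl (neg_neg _)
  -- Its trace is `2 - τ² = 1 - τ`, the other root of `X² = X + 1`, and `tr(u t') = -w τ = ±1`.
  let t' : H := ⟨-1, hP.neg_one_mem⟩ * t ^ 2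
  have ht'c : (t' : SL(2, K)) = -((t ^ 2 : H) : SL(2, K)) := by
    simp only [t', Subgroup.coe_mul, neg_mul, one_mul]
  have hut' : (((u * t' : H) : SL(2, K)) : Matrix (Fin 2) (Fin 2) K).trace = 1 ∨
      (((u * t' : H) : SL(2, K)) : Matrix (Fin 2) (Fin 2) K).trace = -1 := by
    rw [Subgroup.coe_mul, ht'c, mul_neg, trace_neg_coe, ← Subgroup.coe_mul, hv]
    rcases hv1 with h | h <;> rw [h]
    · exact Or.inr rfl
    · exact Or.inl (neg_neg _)
  obtain ⟨s, hs, hst⟩ := exists_pair_of_involution hP.neg_one_mem hu hut'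
  refine ⟨s, t', hs, Or.inr (Or.inr ⟨rfl, ?_⟩), hst⟩
  rw [ht'c, trace_neg_coe, Subgroup.coe_pow, coe_pow_two, Matrix.trace_sub, Matrix.trace_smul,
    Matrix.trace_smul, Matrix.trace_one, ← hτdef]
  simp only [smul_eq_mul, Fintype.card_fin]
  push_cast
  linear_combination (τ ^ 2 - 3 + τ + 1 + 1) * hτ5

end Polyhedral

/-! ### Uniqueness of standard generators and the normalizer of a polyhedral group. -/

section Polyhedral

variable {K : Type*} [Field K] {H : Subgroup SL(2, K)}

theorem trace_combo {C : Type*} [CommRing C] (s t : Matrix (Fin 2) (Fin 2) C) (a b c d : C) :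
    (combo s t a b c d).trace = 2 * a + b * s.trace + c * t.trace + d * (s * t).trace := by
  simp [combo, Matrix.trace_add, Matrix.trace_smul]; ring

/-- In the icosahedral group the word `s² t s²` is a half-turn in a different position from `s t`
relative to the axis of `t`. -/
theorem TracePair.trace_word {s t : Matrix (Fin 2) (Fin 2) K} {τ : K} (h : TracePair 1 τ 0 s t)
    (hs : s.trace = 1) (ht : t.trace = τ) (hst : (s * t).trace = 0) :
    (s * s * t * s * s).trace = 0 := by
  have hw : s = combo s t (0 : K) 1 0 0 := by simp [combo]
  nth_rewrite 1 [hw]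
  rw [h.combo_mul_left, h.combo_mul_right, h.combo_mul_left, h.combo_mul_left, trace_combo, hs, ht,
    hst]
  ring

theorem TracePair.trace_word_mul {s t : Matrix (Fin 2) (Fin 2) K} {τ : K}
    (h : TracePair 1 τ 0 s t) (hs : s.trace = 1) (ht : t.trace = τ) (hst : (s * t).trace = 0)
    (hτ : τ ^ 2 = τ + 1) : (s * s * t * s * s * t).trace = τ - 1 := by
  have hw : s = combo s t (0 : K) 1 0 0 := by simp [combo]
  nth_rewrite 1 [hw]
  rw [h.combo_mul_left, h.combo_mul_right, h.combo_mul_left, h.combo_mul_left, h.combo_mul_right,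
    trace_combo, hs, ht, hst]
  linear_combination hτ

theorem tracePair_of_traces {s t : SL(2, K)} {τ : K}
    (hs : (s : Matrix (Fin 2) (Fin 2) K).trace = 1)
    (ht : (t : Matrix (Fin 2) (Fin 2) K).trace = τ)
    (hst : ((s * t : SL(2, K)) : Matrix (Fin 2) (Fin 2) K).trace = 0) :
    TracePair (1 : K) τ 0 (s : Matrix (Fin 2) (Fin 2) K) (t : Matrix (Fin 2) (Fin 2) K) := by
  have := Matrix.SpecialLinearGroup.tracePair s t
  rwa [hs, ht, ← Matrix.SpecialLinearGroup.coe_mul, hst] at this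

theorem TracePair.not_commute {x y z : K} {s t : SL(2, K)}
    (h : TracePair x y z (s : Matrix (Fin 2) (Fin 2) K) (t : Matrix (Fin 2) (Fin 2) K))
    (hk : x ^ 2 + y ^ 2 + z ^ 2 - x * y * z - 4 ≠ 0) : s * t ≠ t * s := by
  intro hc
  have h1 := h.comm_mul_comm
  rw [← Matrix.SpecialLinearGroup.coe_mul, ← Matrix.SpecialLinearGroup.coe_mul, hc, sub_self,
    mul_zero] at h1
  exact hk ((smul_eq_zero.1 h1.symm).resolve_right one_ne_zero)

theorem IsPolyTrace.orderOf_eq (h2 : (2 : K) ≠ 0) {k : ℕ} (hk : k = 3 ∨ k = 4 ∨ k = 5)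
    {t : SL(2, K)} (h1 : t ≠ 1) (hm1 : t ≠ -1)
    (h : IsPolyTrace k (t : Matrix (Fin 2) (Fin 2) K).trace) : orderOf t = 2 * k := by
  have e1 := h.pow_eq h2
  have e2 : orderOf t ∣ 2 * k := orderOf_dvd_of_pow_eq_one (by rw [two_mul, pow_add, e1]; simp)
  have e3 : ¬ orderOf t ∣ k := by
    intro h3
    rw [orderOf_dvd_iff_pow_eq_one, e1] at h3
    exact neg_one_ne_one h2 h3
  have e4 : orderOf t ≠ 2 := by
    intro h3
    have := pow_orderOf_eq_one t
    rw [h3, pow_two] at this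
    rcases eq_one_or_eq_neg_one_of_sq h2 this with h4 | h4
    exacts [h1 h4, hm1 h4]
  have e5 := Nat.le_of_dvd (by omega) e2
  rcases hk with rfl | rfl | rfl <;> interval_cases orderOf t <;> omega

theorem exists_axis_of_orderOf [Finite H] {k : ℕ}
    (hP : IsPolyhedral H k) {t : H} (ht : orderOf t = 2 * k) {x : axes H} (hx : t • x = x) :
    Nat.card (MulAction.stabilizer H x) = 2 * k ∧ ∀ g : H, g • x = x → ∃ i : ℕ, t ^ i = g := by
  have hle : Subgroup.zpowers t ≤ MulAction.stabilizer H x := by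
    rw [Subgroup.zpowers_le]; exact hx
  have hdvd := Subgroup.card_dvd_of_le hle
  rw [Nat.card_zpowers, ht] at hdvd
  have hc : Nat.card (MulAction.stabilizer H x) = 2 * k := by
    obtain ⟨hk3, hk5⟩ := hP.k_bounds
    rcases hP.card_stabilizer x with h | h | h
    · rw [h] at hdvd
      have := Nat.le_of_dvd (by norm_num) hdvd
      omega
    · rw [h] at hdvd
      have := Nat.le_of_dvd (by norm_num) hdvd
      omega
    · exact h
  refine ⟨hc, fun g hg => ?_⟩
  have heq : Subgroup.zpowers t = MulAction.stabilizer H x :=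
    Subgroup.eq_of_le_of_card_ge hle (by rw [hc, Nat.card_zpowers, ht])
  have : g ∈ Subgroup.zpowers t := by rw [heq]; exact hg
  rw [← mem_powers_iff_mem_zpowers] at this
  exact this

/-- A half-turn is determined up to sign by the image of `x`, if this is not `±x`. Indeed `u'⁻¹ (c u
c⁻¹)` fixes `x` and carries `u'` to another half-turn, so were it noncentral, `u'` would preserve
`±x`. -/
theorem conj_eq_or_eq_neg (h2 : (2 : K) ≠ 0) {x : axes H} {u u' c : H}
    (hu : ((u : SL(2, K)) : Matrix (Fin 2) (Fin 2) K).trace = 0)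
    (hu' : ((u' : SL(2, K)) : Matrix (Fin 2) (Fin 2) K).trace = 0) (hc : c • x = x)
    (h : c • u • x = u' • x) (h1 : u' • x ≠ x) (h1' : u' • x ≠ -x) :
    ((c * u * c⁻¹ : H) : SL(2, K)) = u' ∨ ((c * u * c⁻¹ : H) : SL(2, K)) = -u' := by
  have e1 : (u'⁻¹ * (c * u * c⁻¹)) • x = x := by
    have : c⁻¹ • x = x := by rw [inv_smul_eq_iff, hc]
    rw [mul_smul, mul_smul, mul_smul, this, h, inv_smul_smul]
  have e2 : u' * (u'⁻¹ * (c * u * c⁻¹)) = c * u * c⁻¹ := by rw [mul_inv_cancel_left]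
  have e3 : (((u' * (u'⁻¹ * (c * u * c⁻¹)) : H) : SL(2, K)) :
      Matrix (Fin 2) (Fin 2) K).trace = 0 := by
    rw [e2, trace_eq_zero_iff h2, ← Subgroup.coe_pow]
    have : (c * u * c⁻¹) ^ 2 = c * u ^ 2 * c⁻¹ := by simp [pow_two, mul_assoc]
    rw [this, Subgroup.coe_mul, Subgroup.coe_mul, Subgroup.coe_pow, (trace_eq_zero_iff h2).1 hu]
    simp
  by_contra hcon
  rw [not_or] at hcon
  have h3 : ((u'⁻¹ * (c * u * c⁻¹) : H) : SL(2, K)) ≠ 1 := fun h3 => hcon.1 (by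
    rw [← e2, Subgroup.coe_mul, h3, mul_one])
  have h4 : ((u'⁻¹ * (c * u * c⁻¹) : H) : SL(2, K)) ≠ -1 := fun h4 => hcon.2 (by
    rw [← e2, Subgroup.coe_mul, h4, mul_neg, mul_one])
  rcases smul_eq_or_of_trace_eq_zero h2 hu' e3 e1 h3 h4 with h4 | h4
  exacts [h1 h4, h1' h4]

theorem trace_conj_mul {u t c : H} (hc : c * t = t * c) :
    ((((c * u * c⁻¹) * t : H) : SL(2, K)) : Matrix (Fin 2) (Fin 2) K).trace =
      (((u * t : H) : SL(2, K)) : Matrix (Fin 2) (Fin 2) K).trace := by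
  have : (c * u * c⁻¹) * t = c * (u * t) * c⁻¹ := by
    have h1 : c⁻¹ * t = t * c⁻¹ := by
      rw [inv_mul_eq_iff_eq_mul, ← mul_assoc, hc, mul_inv_cancel_right]
    rw [mul_assoc, h1]; group
  rw [this, Subgroup.coe_mul, Subgroup.coe_mul, Subgroup.coe_inv, ← glConj_coe, trace_glConj]

/-- Modulo `±1` the powers of `t` act freely on the axes other than `±x`. -/
theorem ncard_powers_smul [Finite H] (h2 : (2 : K) ≠ 0) {k : ℕ} {t : H} (ht : orderOf t = 2 * k)
    {x y : axes H} (hx : t • x = x) (hy : y ≠ x) (hy' : y ≠ -x) :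
    ((fun i : ℕ => t ^ i • y) '' (Set.Iio k)).ncard = k := by
  have hfix : ∀ i : ℕ, (t ^ i) • y = y → k ∣ i := by
    intro i hi
    have hix : (t ^ i) • x = x := by
      have : t ^ i ∈ MulAction.stabilizer H x := Subgroup.pow_mem _ hx i
      exact this
    have hcen : ((t ^ i : H) : SL(2, K)) = 1 ∨ ((t ^ i : H) : SL(2, K)) = -1 := by
      by_contra hc
      rw [not_or] at hc
      rcases eq_or_eq_neg_axes h2 hc.1 hc.2 hix hi with h | h
      exacts [hy h, hy' h]
    have : t ^ (2 * i) = 1 := by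
      apply Subtype.ext
      rw [mul_comm, pow_mul, Subgroup.coe_pow]
      rcases hcen with h | h <;> rw [h] <;> simp
    have := orderOf_dvd_of_pow_eq_one this
    rw [ht] at this
    exact Nat.dvd_of_mul_dvd_mul_left (by norm_num) this
  rw [Set.InjOn.ncard_image, Set.ncard_eq_toFinset_card']
  · simp
  · have key : ∀ i j : ℕ, i ≤ j → j < k → t ^ i • y = t ^ j • y → i = j := by
      intro i j hij hj h
      obtain ⟨d, rfl⟩ := Nat.exists_eq_add_of_le hij
      rw [pow_add, mul_smul] at h
      have := hfix d (MulAction.injective _ h).symm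
      rcases Nat.eq_zero_or_pos d with h0 | h0
      · omega
      · have := Nat.le_of_dvd h0 this; omega
    intro i hi j hj h
    rcases le_total i j with h1 | h1
    · exact key i j h1 hj h
    · exact (key j i h1 hi h.symm).symm

theorem powers_smul_subset {t : H} {k : ℕ} {x y : axes H} (hx : t • x = x)
    (hy : y ∈ MulAction.orbit H x \ {x, -x}) :
    (fun i : ℕ => t ^ i • y) '' (Set.Iio k) ⊆ MulAction.orbit H x \ {x, -x} := by
  rintro _ ⟨i, -, rfl⟩
  have hix : (t ^ i) • x = x := by
    have : t ^ i ∈ MulAction.stabilizer H x := Subgroup.pow_mem _ hx i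
    exact this
  refine ⟨MulAction.mem_orbit_of_mem_orbit _ hy.1, ?_⟩
  rintro (h | h)
  · apply hy.2; left
    exact MulAction.injective (t ^ i) (h.trans hix.symm)
  · apply hy.2; right
    apply MulAction.injective (t ^ i)
    change t ^ i • y = t ^ i • (-x)
    rw [smul_neg_axes, hix]; exact h

/-- Given `t` of order `2k`, the elements `s` of trace one with `s t` of trace zero form a single
orbit under conjugation by powers of `t`. -/
theorem IsPolyhedral.exists_conj_pow [IsAlgClosed K] [Finite H] (h2 : (2 : K) ≠ 0)
    (hss : ∀ h ∈ H, (h : Matrix (Fin 2) (Fin 2) K).trace ^ 2 = 4 → h = 1 ∨ h = -1) {k : ℕ}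
    (hP : IsPolyhedral H k) {s s' t : H}
    (hs : ((s : SL(2, K)) : Matrix (Fin 2) (Fin 2) K).trace = 1)
    (hs' : ((s' : SL(2, K)) : Matrix (Fin 2) (Fin 2) K).trace = 1)
    (ht : IsPolyTrace k ((t : SL(2, K)) : Matrix (Fin 2) (Fin 2) K).trace)
    (hst : (((s * t : H) : SL(2, K)) : Matrix (Fin 2) (Fin 2) K).trace = 0)
    (hst' : (((s' * t : H) : SL(2, K)) : Matrix (Fin 2) (Fin 2) K).trace = 0)
    (hord : orderOf t = 2 * k) {x : axes H} (hx : t • x = x) :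
    ∃ i : ℕ, t ^ i * s * (t ^ i)⁻¹ = s' := by
  have := finite_axes h2 hss
  obtain ⟨hcard, hgen⟩ := exists_axis_of_orderOf hP hord hx
  have hmove : ∀ s : H, ((s : SL(2, K)) : Matrix (Fin 2) (Fin 2) K).trace = 1 →
      (((s * t : H) : SL(2, K)) : Matrix (Fin 2) (Fin 2) K).trace = 0 →
      (s * t) • x ≠ x ∧ (s * t) • x ≠ -x := by
    intro s hs hst
    rw [mul_smul, hx]
    constructor
    · intro h
      obtain ⟨i, hi⟩ := hgen s h
      have h3 := (tracePair_of_traces hs rfl hst).not_commute (ht.sq_ne_three h2)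
      apply h3
      have : s * t = t * s := by rw [← hi, ← pow_succ, ← pow_succ']
      exact congrArg Subtype.val this
    · intro h
      have hJ : ((s : SL(2, K)) : Matrix (Fin 2) (Fin 2) K) * x
          = -(x * ((s : SL(2, K)) : Matrix (Fin 2) (Fin 2) K)) := by
        rw [(smul_eq_iff_axes s x (-x)).1 h, coe_neg_axes, neg_mul]
      have := x.2.1.trace_eq_zero h2 hJ
      rw [hs] at this
      exact one_ne_zero this
  obtain ⟨hm1, hm2⟩ := hmove s hs hst
  obtain ⟨hm1', hm2'⟩ := hmove s' hs' hst'
  have hixx : ∀ i : ℕ, (t ^ i) • x = x := fun i => by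
    have : t ^ i ∈ MulAction.stabilizer H x := Subgroup.pow_mem _ hx i
    exact this
  -- Half-turns are compared through the images of `x`, which lie in `P`. Orbits of the powers of
  -- `t` on `P` have `k` elements. For `k = 3, 4` the set `P` has at most `k` elements and is a
  -- single orbit. For `k = 5` it has `10` elements and is a union of two orbits.
  set P := MulAction.orbit H x \ {x, -x} with hPdef
  have hPfin : P.Finite := Set.toFinite _
  have hOcard : (MulAction.orbit H x).ncard * (2 * k) = Nat.card H := by
    rw [← card_orbit_mul_card_stabilizer' x, hcard, Nat.card_coe_set_eq]
  have hyP : (s * t) • x ∈ P := ⟨MulAction.mem_orbit _ _, by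
    rintro (h | h); exacts [hm1 h, hm2 h]⟩
  have hyP' : (s' * t) • x ∈ P := ⟨MulAction.mem_orbit _ _, by
    rintro (h | h); exacts [hm1' h, hm2' h]⟩
  have hPcard : k ≠ 3 → P.ncard + 2 = (MulAction.orbit H x).ncard := by
    intro hk
    obtain ⟨g, hg⟩ := hP.neg hk x hcard
    have hsub : ({x, -x} : Set (axes H)) ⊆ MulAction.orbit H x := by
      rintro z (rfl | rfl)
      · exact MulAction.mem_orbit_self _
      · exact ⟨g, hg⟩
    have := Set.ncard_sdiff_add_ncard_of_subset hsub (Set.toFinite _)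
    rw [Set.ncard_pair (neg_ne_axes h2 x).symm] at this
    exact this
  have hfinish : ∀ i : ℕ, t ^ i • (s * t) • x = (s' * t) • x → t ^ i * s * (t ^ i)⁻¹ = s' := by
    intro i hi
    have hcomm : t ^ i * t⁻¹ = t⁻¹ * t ^ i := by
      rw [eq_inv_mul_iff_mul_eq, ← mul_assoc, ← pow_succ', pow_succ, mul_inv_cancel_right]
    have hconj : t ^ i * (s * t) * (t ^ i)⁻¹ = t ^ i * s * (t ^ i)⁻¹ * t := by
      have : t * (t ^ i)⁻¹ = (t ^ i)⁻¹ * t := by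
        rw [eq_inv_mul_iff_mul_eq, ← mul_assoc, ← pow_succ, pow_succ', mul_inv_cancel_right]
      rw [mul_assoc, mul_assoc, this]; group
    rcases conj_eq_or_eq_neg h2 hst hst' (hixx i) hi hm1' hm2' with h | h
    · rw [hconj] at h
      exact mul_right_cancel (Subtype.ext h)
    · exfalso
      rw [hconj, Subgroup.coe_mul, Subgroup.coe_mul H s' t, ← neg_mul] at h
      have h3 := mul_right_cancel h
      have h4 := trace_neg_coe (s' : SL(2, K))
      rw [← h3, hs', Subgroup.coe_mul, Subgroup.coe_mul, Subgroup.coe_inv, ← glConj_coe,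
        trace_glConj, hs] at h4
      exact h2 (by linear_combination h4)
  have hA := powers_smul_subset (k := k) hx hyP
  have hAcard := ncard_powers_smul h2 hord hx hm1 hm2
  by_cases hk : k = 5
  · subst hk
    have hH : Nat.card H = 120 := by have := hP.card_eq; omega
    have hP10 : P.ncard = 10 := by have := hPcard (by norm_num); omega
    set τ := ((t : SL(2, K)) : Matrix (Fin 2) (Fin 2) K).trace with hτ
    have hτ5 : τ ^ 2 = τ + 1 := by
      rcases ht with h | h | h
      · omega
      · omega
      · exact h.2
    have htp := tracePair_of_traces hs hτ.symm hst
    -- This half-turn supplies the second orbit. Conjugation by powers of `t` preserves traces of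
    -- products with `t`, and `tr(u t) = τ - 1` differs from `±1 = ± tr(s t t)`.
    let u : H := s * s * t * s * s
    have hucoe : ((u : SL(2, K)) : Matrix (Fin 2) (Fin 2) K) =
        ((s : SL(2, K)) : Matrix (Fin 2) (Fin 2) K) * ((s : SL(2, K)) : Matrix (Fin 2) (Fin 2) K) *
        ((t : SL(2, K)) : Matrix (Fin 2) (Fin 2) K) * ((s : SL(2, K)) : Matrix (Fin 2) (Fin 2) K) *
        ((s : SL(2, K)) : Matrix (Fin 2) (Fin 2) K) := by
      simp only [u, Subgroup.coe_mul, Matrix.SpecialLinearGroup.coe_mul]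
    have hu0 : ((u : SL(2, K)) : Matrix (Fin 2) (Fin 2) K).trace = 0 := by
      rw [hucoe]
      exact htp.trace_word hs hτ.symm hst
    have hut : (((u * t : H) : SL(2, K)) : Matrix (Fin 2) (Fin 2) K).trace = τ - 1 := by
      rw [Subgroup.coe_mul, Matrix.SpecialLinearGroup.coe_mul, hucoe]
      exact htp.trace_word_mul hs hτ.symm hst hτ5
    have hu1 : u • x ≠ x := by
      intro h
      have h3 : (⟨u, h⟩ : MulAction.stabilizer H x) ^ (2 * 5) = 1 := by
        rw [← hcard]; exact pow_card_eq_one'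
      have h4 : u ^ (2 * 5) = 1 := by simpa using congrArg Subtype.val h3
      have h5 : ((u : SL(2, K)) ^ 2) ^ 5 = 1 := by
        rw [← pow_mul, ← Subgroup.coe_pow, h4]; rfl
      rw [(trace_eq_zero_iff h2).1 hu0, Odd.neg_one_pow (by decide : Odd 5)] at h5
      exact neg_one_ne_one h2 h5
    have hu2 : u • x ≠ -x := by
      intro h
      have hJ : (((u * t : H) : SL(2, K)) : Matrix (Fin 2) (Fin 2) K) * x
          = -(x * (((u * t : H) : SL(2, K)) : Matrix (Fin 2) (Fin 2) K)) := by
        have : (u * t) • x = -x := by rw [mul_smul, hx, h]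
        rw [(smul_eq_iff_axes _ x (-x)).1 this, coe_neg_axes, neg_mul]
      have := x.2.1.trace_eq_zero h2 hJ
      rw [hut] at this
      have h3 : τ = 1 := by linear_combination this
      rw [h3] at hτ5
      exact one_ne_zero (α := K) (by linear_combination -hτ5)
    have huP : u • x ∈ P := ⟨MulAction.mem_orbit _ _, by rintro (h | h); exacts [hu1 h, hu2 h]⟩
    have hB := powers_smul_subset (k := 5) hx huP
    have hBcard := ncard_powers_smul h2 hord hx hu1 hu2
    have hdiff : ∀ s : H, ((s : SL(2, K)) : Matrix (Fin 2) (Fin 2) K).trace = 1 →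
      (((s * t : H) : SL(2, K)) : Matrix (Fin 2) (Fin 2) K).trace = 0 →
      ∀ g : H, g • x = x → g • u • x ≠ (s * t) • x := by
      intro s hs hst g hg h
      obtain ⟨i, rfl⟩ := hgen g hg
      have hc : t ^ i * t = t * t ^ i := by rw [← pow_succ, ← pow_succ']
      have e1 := trace_conj_mul (u := u) hc
      have e2 : ((((s * t) * t : H) : SL(2, K)) : Matrix (Fin 2) (Fin 2) K).trace = -1 := by
        have := trace_mul_inv ((s * t : H) : SL(2, K)) t
        rw [hst, Subgroup.coe_mul, mul_inv_cancel_right, hs] at this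
        rw [Subgroup.coe_mul, Subgroup.coe_mul]
        linear_combination this
      rw [hut, Subgroup.coe_mul] at e1
      have e3 : τ - 1 = -1 ∨ τ - 1 = 1 := by
        rcases conj_eq_or_eq_neg h2 hu0 hst hg h (hmove s hs hst).1 (hmove s hs hst).2 with h4 | h4
        · left; rw [← e1, h4, ← e2]; rfl
        · right
          rw [← e1, h4, neg_mul, trace_neg_coe, ← Subgroup.coe_mul, e2, neg_neg]
      rcases e3 with h4 | h4
      · have h3 : τ = 0 := by linear_combination h4
        rw [h3] at hτ5
        exact one_ne_zero (α := K) (by linear_combination -hτ5)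
      · have h3 : τ = 2 := by linear_combination h4
        rw [h3] at hτ5
        exact one_ne_zero (α := K) (by linear_combination hτ5)
    have hdisj : Disjoint ((fun i : ℕ => t ^ i • (s * t) • x) '' (Set.Iio 5))
        ((fun i : ℕ => t ^ i • u • x) '' (Set.Iio 5)) := by
      rw [Set.disjoint_left]
      rintro _ ⟨i, -, rfl⟩ ⟨j, -, h⟩
      refine hdiff s hs hst ((t ^ i)⁻¹ * t ^ j) ?_ ?_
      · rw [mul_smul, hixx, inv_smul_eq_iff, hixx]
      · rw [mul_smul, inv_smul_eq_iff]; exact h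
    have hun := Set.ncard_union_eq hdisj (Set.toFinite _) (Set.toFinite _)
    have hset := Set.eq_of_subset_of_ncard_le (Set.union_subset hA hB) (by
      rw [hun, hAcard, hBcard, ← hPdef, hP10]) hPfin
    have hmem : (s' * t) • x ∈ (fun i : ℕ => t ^ i • (s * t) • x) '' (Set.Iio 5) ∪
        (fun i : ℕ => t ^ i • u • x) '' (Set.Iio 5) := by rw [hset]; exact hyP'
    rcases hmem with ⟨i, -, hi⟩ | ⟨i, -, hi⟩
    · exact ⟨i, hfinish i hi⟩
    · exact absurd hi (hdiff s' hs' hst' _ (hixx i))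
  · have hle : P.ncard ≤ k := by
      rcases hP.hk with rfl | rfl | rfl
      · have hsub : P ⊆ MulAction.orbit H x \ {x} :=
          Set.sdiff_subset_sdiff_right (by simp)
        have h3 := Set.ncard_le_ncard hsub
        rw [Set.ncard_sdiff_singleton_of_mem (MulAction.mem_orbit_self x)] at h3
        have := hP.card_eq
        omega
      · have := hPcard (by norm_num)
        have := hP.card_eq
        omega
      · exact absurd rfl hk
    have hset := Set.eq_of_subset_of_ncard_le hA (by rw [hAcard]; exact hle) hPfin
    have hmem : (s' * t) • x ∈ (fun i : ℕ => t ^ i • (s * t) • x) '' (Set.Iio k) := by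
      rw [hset]; exact hyP'
    obtain ⟨i, -, hi⟩ := hmem
    exact ⟨i, hfinish i hi⟩

/-- The normalizer of a binary polyhedral group in `GL₂` is, up to scalars, the group itself, or
for the tetrahedral group is generated by the group and one more element `n`. -/
theorem IsPolyhedral.exists_fix_of_normalizes [IsAlgClosed K] [Finite H] (h2 : (2 : K) ≠ 0)
    (hss : ∀ h ∈ H, (h : Matrix (Fin 2) (Fin 2) K).trace ^ 2 = 4 → h = 1 ∨ h = -1) {k : ℕ}
    (hP : IsPolyhedral H k) {s t : H}
    (hs : ((s : SL(2, K)) : Matrix (Fin 2) (Fin 2) K).trace = 1)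
    (ht : IsPolyTrace k ((t : SL(2, K)) : Matrix (Fin 2) (Fin 2) K).trace)
    (hst : (((s * t : H) : SL(2, K)) : Matrix (Fin 2) (Fin 2) K).trace = 0)
    {g n : GL (Fin 2) K} (hg : ∀ h ∈ H, glConj g h ∈ H) (hn : ∀ h ∈ H, glConj n h ∈ H)
    (hnt : glConj n t = (t : SL(2, K))⁻¹) :
    ∃ h h' : H, (glConj (((h : SL(2, K)) : GL (Fin 2) K) * g) s = s ∧
        glConj (((h : SL(2, K)) : GL (Fin 2) K) * g) t = t) ∨
      (k = 3 ∧ glConj (((h : SL(2, K)) : GL (Fin 2) K) * n *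
        ((h' : SL(2, K)) : GL (Fin 2) K) * g) s = s ∧
        glConj (((h : SL(2, K)) : GL (Fin 2) K) * n *
        ((h' : SL(2, K)) : GL (Fin 2) K) * g) t = t) := by
  have := finite_axes h2 hss
  have htne : (t : SL(2, K)) ≠ 1 ∧ (t : SL(2, K)) ≠ -1 := by
    have h3 := (tracePair_of_traces hs rfl hst).not_commute (ht.sq_ne_three h2)
    constructor <;> intro h <;> rw [h] at h3 <;> simp at h3
  have hord' := ht.orderOf_eq h2 hP.hk htne.1 htne.2
  have hord : orderOf t = 2 * k := by rw [← Subgroup.orderOf_coe, hord']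
  obtain ⟨x, hx⟩ := exists_mem_axes hss htne.1 htne.2
  obtain ⟨hcard, hgen⟩ := exists_axis_of_orderOf hP hord hx
  have hxc := (smul_eq_iff_axes _ _ _).1 hx
  have hxc' : ((t : SL(2, K)) : Matrix (Fin 2) (Fin 2) K) * (x : Matrix (Fin 2) (Fin 2) K)
      = (x : Matrix (Fin 2) (Fin 2) K) * ((t : SL(2, K)) : Matrix (Fin 2) (Fin 2) K) := hxc
  -- If `g` fixes the axis of `t`, it centralizes `t`. The conjugate of `s` then satisfies the same
  -- trace conditions, so a power of `t` carries it back to `s`.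
  have stepA : ∀ g : GL (Fin 2) K, (∀ h ∈ H, glConj g h ∈ H) →
      axConj g x = (x : Matrix (Fin 2) (Fin 2) K) →
      ∃ h : H, glConj (((h : SL(2, K)) : GL (Fin 2) K) * g) s = s ∧
        glConj (((h : SL(2, K)) : GL (Fin 2) K) * g) t = t := by
    intro g hg hgx
    have hgt : glConj g t = t := by
      rw [glConj_eq_iff]
      exact x.2.1.commute_of_axis h2 (axConj_eq_iff.1 hgx) hxc'
    let s' : H := ⟨glConj g s, hg _ s.2⟩
    obtain ⟨i, hi⟩ := hP.exists_conj_pow h2 hss (s := s) (s' := s') (t := t) hs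
      ((trace_glConj _ _).trans hs) ht hst (by
        have : ((s' * t : H) : SL(2, K)) = glConj g (s * t) := by
          rw [Subgroup.coe_mul, map_mul, hgt]
        rw [this, trace_glConj]; exact hst) hord hx
    have hi' : (t : SL(2, K)) ^ i * s * ((t : SL(2, K)) ^ i)⁻¹ = glConj g s := by
      have := congrArg Subtype.val hi
      simpa using this
    refine ⟨(t ^ i)⁻¹, ?_, ?_⟩
    · rw [glConj_mul, ← hi', glConj_coe]
      simp only [Subgroup.coe_inv, Subgroup.coe_pow, inv_inv]
      group
    · rw [glConj_mul, hgt, glConj_coe]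
      simp only [Subgroup.coe_inv, Subgroup.coe_pow, inv_inv]
      group
  have hcoe : ∀ (h : H) (g : GL (Fin 2) K), (∀ h ∈ H, glConj g h ∈ H) →
      ∀ h' ∈ H, glConj (((h : SL(2, K)) : GL (Fin 2) K) * g) h' ∈ H := by
    intro h g hg h' hh'
    rw [glConj_mul]
    exact glConj_mem_of_mem h.2 (hg _ hh')
  let x' : axes H := ⟨axConj g x, axConj_mem_axes hg x.2⟩
  have hx'card : Nat.card (MulAction.stabilizer H x') = 2 * k := by
    let t' : H := ⟨glConj g t, hg _ t.2⟩
    have ht' : orderOf t' = 2 * k := by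
      rw [← Subgroup.orderOf_coe, ← hord']
      exact MulEquiv.orderOf_eq (glConj g) t
    refine (exists_axis_of_orderOf hP ht' (x := x') ?_).1
    rw [smul_eq_iff_axes]
    change (glConj g t : Matrix (Fin 2) (Fin 2) K) * axConj g x = axConj g x * glConj g t
    rw [coe_glConj, axConj]
    have : ∀ A B : Matrix (Fin 2) (Fin 2) K,
        (g : Matrix (Fin 2) (Fin 2) K) * A * ((g⁻¹ : GL (Fin 2) K) : Matrix (Fin 2) (Fin 2) K) *
        ((g : Matrix (Fin 2) (Fin 2) K) * B * ((g⁻¹ : GL (Fin 2) K) : Matrix (Fin 2) (Fin 2) K))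
        = (g : Matrix (Fin 2) (Fin 2) K) * (A * B) *
          ((g⁻¹ : GL (Fin 2) K) : Matrix (Fin 2) (Fin 2) K) := by
      intro A B; simp [mul_assoc]
    rw [this, this, hxc']
  have hax : ∀ (h : H) (y : axes H) (g' : GL (Fin 2) K), axConj g' x = y →
      axConj (((h : SL(2, K)) : GL (Fin 2) K) * g') x = ((h • y : axes H) : Matrix _ _ K) := by
    intro h y g' hy
    rw [axConj_mul, hy, coe_smul_axes]
  -- An element of `H` moves `g x` to `x` or `-x`. In the second case the axis is reversed by
  -- another element of `H` if `k ≠ 3`, and by `n` if `k = 3`.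
  obtain ⟨h, hh⟩ := hP.trans x' x hx'card hcard
  rcases hh with hh | hh
  · obtain ⟨h₁, h₁s, h₁t⟩ := stepA (((h : SL(2, K)) : GL (Fin 2) K) * g) (hcoe h g hg)
      (by rw [hax h x' g rfl, hh])
    refine ⟨h₁ * h, 1, Or.inl ?_⟩
    rw [Subgroup.coe_mul, map_mul, mul_assoc]
    exact ⟨h₁s, h₁t⟩
  · by_cases hk : k = 3
    · have hnx : axConj n x = ((-x : axes H) : Matrix (Fin 2) (Fin 2) K) := by
        let y : axes H := ⟨axConj n x, axConj_mem_axes hn x.2⟩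
        have hty : t • y = y := by
          have h3 : t⁻¹ • y = y := by
            rw [smul_eq_iff_axes, Subgroup.coe_inv, ← hnt]
            change (glConj n t : Matrix (Fin 2) (Fin 2) K) * axConj n x = axConj n x * glConj n t
            rw [coe_glConj, axConj]
            have : ∀ A B : Matrix (Fin 2) (Fin 2) K,
                (n : Matrix (Fin 2) (Fin 2) K) * A *
                  ((n⁻¹ : GL (Fin 2) K) : Matrix (Fin 2) (Fin 2) K) *
                ((n : Matrix (Fin 2) (Fin 2) K) * B *
                  ((n⁻¹ : GL (Fin 2) K) : Matrix (Fin 2) (Fin 2) K))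
                = (n : Matrix (Fin 2) (Fin 2) K) * (A * B) *
                  ((n⁻¹ : GL (Fin 2) K) : Matrix (Fin 2) (Fin 2) K) := by
              intro A B; simp [mul_assoc]
            rw [this, this, hxc']
          rw [inv_smul_eq_iff] at h3
          exact h3.symm
        rcases eq_or_eq_neg_axes h2 htne.1 htne.2 hx hty with h3 | h3
        · exfalso
          have h4 : glConj n t = t := by
            rw [glConj_eq_iff]
            exact x.2.1.commute_of_axis h2 (axConj_eq_iff.1 (congrArg Subtype.val h3)) hxc'
          rw [h4] at hnt
          rcases eq_one_or_eq_neg_one_of_sq h2 (g := (t : SL(2, K)))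
            (by nth_rewrite 1 [hnt]; simp) with h5 | h5
          exacts [htne.1 h5, htne.2 h5]
        · exact congrArg Subtype.val h3
      have hN : ∀ h' ∈ H, glConj (n * (((h : SL(2, K)) : GL (Fin 2) K) * g)) h' ∈ H := by
        intro h' hh'
        rw [glConj_mul]
        exact hn _ (hcoe h g hg h' hh')
      obtain ⟨h₁, h₁s, h₁t⟩ := stepA (n * (((h : SL(2, K)) : GL (Fin 2) K) * g)) hN (by
        rw [axConj_mul, hax h x' g rfl, hh, coe_neg_axes, axConj_neg, hnx, coe_neg_axes, neg_neg])
      refine ⟨h₁, h, Or.inr ⟨hk, ?_⟩⟩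
      rw [mul_assoc, mul_assoc]
      exact ⟨h₁s, h₁t⟩
    · obtain ⟨h', hh'⟩ := hP.neg hk x hcard
      obtain ⟨h₁, h₁s, h₁t⟩ := stepA (((h' : SL(2, K)) : GL (Fin 2) K) *
        (((h : SL(2, K)) : GL (Fin 2) K) * g)) (hcoe h' _ (hcoe h g hg)) (by
          rw [hax h' (h • x') _ (hax h x' g rfl), hh, smul_neg_axes, hh', neg_neg])
      refine ⟨h₁ * h' * h, 1, Or.inl ?_⟩
      rw [Subgroup.coe_mul, map_mul, Subgroup.coe_mul, map_mul, mul_assoc, mul_assoc]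
      exact ⟨h₁s, h₁t⟩

end Polyhedral

/-! ### Quadratic integers and their reduction modulo `p`. -/

theorem nonempty_range_mulEquiv_range {G A B : Type*} [Group G] [Group A] [Group B]
    (f : G →* A) (g : G →* B) (h : ∀ x, f x = 1 ↔ g x = 1) : Nonempty (f.range ≃* g.range) := by
  have : f.ker = g.ker := by ext x; exact h x
  exact ⟨(QuotientGroup.quotientKerEquivRange f).symm.trans
    ((QuotientGroup.quotientMulEquivOfEq this).trans (QuotientGroup.quotientKerEquivRange g))⟩

section QuadraticIntegers

variable {α β : ℤ} {C : Type*} [CommRing C]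

/-- The ring homomorphism `ℤ[θ] → C` with `θ ↦ τ`, for a root `τ` of the polynomial of `θ`. -/
noncomputable def evalQuadratic (τ : C) (h : τ * τ = α + β * τ) : QuadraticAlgebra ℤ α β →+* C :=
  (QuadraticAlgebra.lift (R := ℤ) (a := α) (b := β) (A := C)
    ⟨τ, by simpa using h⟩).toRingHom

theorem evalQuadratic_apply {τ : C} (h : τ * τ = α + β * τ) (r : QuadraticAlgebra ℤ α β) :
    evalQuadratic τ h r = r.re + r.im * τ := by
  simp [evalQuadratic, QuadraticAlgebra.lift]

theorem evalQuadratic_star {τ₀ τ₁ : C} (h₀ : τ₀ * τ₀ = α + β * τ₀) (h₁ : τ₁ * τ₁ = α + β * τ₁)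
    (h : τ₀ + τ₁ = β) (r : QuadraticAlgebra ℤ α β) :
    evalQuadratic τ₀ h₀ (star r) = evalQuadratic τ₁ h₁ r := by
  rw [evalQuadratic_apply, evalQuadratic_apply]
  simp
  linear_combination (-r.im : C) * h

theorem evalQuadratic_omega {τ : C} (h : τ * τ = α + β * τ) :
    evalQuadratic τ h QuadraticAlgebra.omega = τ := by
  rw [evalQuadratic_apply]; simp

variable {p : ℕ} {τ : ZMod p}

/-- The kernel of reduction is generated by `p` and `θ - m`, with `m` an integer lifting `τ`. The
norm `m² - β m - α` of `θ - m` is divisible by `p`, so the kernel times its conjugate lies in `(p)`.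
-/
theorem exists_mul_star_eq (h : τ * τ = α + β * τ) {v w : QuadraticAlgebra ℤ α β}
    (hv : evalQuadratic τ h v = 0) (hw : evalQuadratic τ h w = 0) :
    ∃ r, v * star w = (p : QuadraticAlgebra ℤ α β) * r := by
  obtain ⟨m, rfl⟩ := ZMod.intCast_surjective τ
  rw [evalQuadratic_apply] at hv hw
  have hv' : ((v.re + v.im * m : ℤ) : ZMod p) = 0 := by push_cast; exact hv
  have hw' : ((w.re + w.im * m : ℤ) : ZMod p) = 0 := by push_cast; exact hw
  have hm : ((m * m - α - β * m : ℤ) : ZMod p) = 0 := by push_cast; linear_combination h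
  rw [ZMod.intCast_zmod_eq_zero_iff_dvd] at hv' hw' hm
  obtain ⟨v', hv'⟩ := hv'
  obtain ⟨w', hw'⟩ := hw'
  obtain ⟨m', hm⟩ := hm
  refine ⟨⟨v' * w' * p + v' * w.im * β - v' * w.im * m - v.im * w' * m + v.im * w.im * m', ?_⟩, ?_⟩
  · exact v.im * w' - v' * w.im
  have e1 : v.re = p * v' - v.im * m := by linear_combination hv'
  have e2 : w.re = p * w' - w.im * m := by linear_combination hw'
  ext
  · simp [e1, e2]
    linear_combination (v.im * w.im) * hm
  · simp [e1, e2]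
    ring

/-- Expand the norm as `∑ (vᵢ v̄ⱼ)(wᵢ w̄ⱼ)`: both factors of each term are divisible by `p`. -/
theorem sq_dvd_norm (h : τ * τ = α + β * τ) {ι : Type*} (S : Finset ι)
    (v w : ι → QuadraticAlgebra ℤ α β) (hv : ∀ i ∈ S, evalQuadratic τ h (v i) = 0)
    (hw : ∀ i ∈ S, evalQuadratic τ h (w i) = 0) :
    ((p : ℤ) ^ 2) ∣ QuadraticAlgebra.norm (∑ i ∈ S, v i * w i) := by
  have key : ∃ r, (∑ i ∈ S, v i * w i) * star (∑ i ∈ S, v i * w i) =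
      (p : QuadraticAlgebra ℤ α β) ^ 2 * r := by
    rw [star_sum, Finset.sum_mul_sum]
    change (p : QuadraticAlgebra ℤ α β) ^ 2 ∣ _
    refine Finset.dvd_sum fun i hi => Finset.dvd_sum fun j hj => ?_
    obtain ⟨r, hr⟩ := exists_mul_star_eq h (hv i hi) (hv j hj)
    obtain ⟨r', hr'⟩ := exists_mul_star_eq h (hw i hi) (hw j hj)
    refine ⟨r * r', ?_⟩
    rw [star_mul', mul_mul_mul_comm, hr, hr']; ring
  obtain ⟨r, hr⟩ := key
  rw [← QuadraticAlgebra.algebraMap_norm_eq_mul_star] at hr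
  refine ⟨r.re, ?_⟩
  have := congrArg QuadraticAlgebra.re hr
  have hp : (p : QuadraticAlgebra ℤ α β) ^ 2 =
      algebraMap ℤ (QuadraticAlgebra ℤ α β) ((p : ℤ) ^ 2) := by simp
  rw [hp, ← Algebra.smul_def, QuadraticAlgebra.re_smul, smul_eq_mul] at this
  exact this

/-- The values of `f₀ = evalQuadratic τ₀` and its conjugate on a sum of products of elements in
the kernel of a reduction mod `p` have an integral product that is divisible by `p²`. -/
theorem evalQuadratic_mul_eq_zero {τ₀ τ₁ : ℝ} (h : τ * τ = α + β * τ)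
    (h₀ : τ₀ * τ₀ = α + β * τ₀) (h₁ : τ₁ * τ₁ = α + β * τ₁) (h01 : τ₀ + τ₁ = β) (hp : 5 ≤ p)
    {ι : Type*} (S : Finset ι)
    (v w : ι → QuadraticAlgebra ℤ α β) (hv : ∀ i ∈ S, evalQuadratic τ h (v i) = 0)
    (hw : ∀ i ∈ S, evalQuadratic τ h (w i) = 0)
    (b₀ : 0 ≤ evalQuadratic τ₀ h₀ (∑ i ∈ S, v i * w i))
    (b₀' : evalQuadratic τ₀ h₀ (∑ i ∈ S, v i * w i) ≤ 4)
    (b₁ : 0 ≤ evalQuadratic τ₁ h₁ (∑ i ∈ S, v i * w i))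
    (b₁' : evalQuadratic τ₁ h₁ (∑ i ∈ S, v i * w i) ≤ 4) :
    evalQuadratic τ₀ h₀ (∑ i ∈ S, v i * w i) = 0 ∨
      evalQuadratic τ₁ h₁ (∑ i ∈ S, v i * w i) = 0 := by
  have hd := sq_dvd_norm h S v w hv hw
  set u := ∑ i ∈ S, v i * w i with hu
  have hN : ((QuadraticAlgebra.norm u : ℤ) : ℝ) =
      evalQuadratic τ₀ h₀ u * evalQuadratic τ₁ h₁ u := by
    rw [← evalQuadratic_star h₀ h₁ h01, ← map_mul, ← QuadraticAlgebra.algebraMap_norm_eq_mul_star]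
    simp
  rw [← mul_eq_zero, ← hN]
  norm_cast
  obtain ⟨c, hc⟩ := hd
  have l1 : (0 : ℤ) ≤ QuadraticAlgebra.norm u := by
    have : (0 : ℝ) ≤ ((QuadraticAlgebra.norm u : ℤ) : ℝ) := by rw [hN]; exact mul_nonneg b₀ b₁
    exact_mod_cast this
  have l2 : QuadraticAlgebra.norm u ≤ 16 := by
    have : ((QuadraticAlgebra.norm u : ℤ) : ℝ) ≤ 16 := by rw [hN]; nlinarith
    exact_mod_cast this
  have hp' : (25 : ℤ) ≤ (p : ℤ) ^ 2 := by
    have : (5 : ℤ) ≤ p := by exact_mod_cast hp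
    nlinarith
  -- The norm is `p² c` with `p² ≥ 25`, and it lies between `0` and `16`.
  have : c = 0 := by nlinarith
  rw [hc, this, mul_zero]

end QuadraticIntegers

/-! ### Pairs of unit quaternions with given traces. -/

section Quaternions

open Quaternion

/-- Unit quaternions with real parts `1/2` and `τ/2` whose product is purely imaginary. -/
structure QuaternionPair (τ : ℝ) (s t : Quaternion ℝ) : Prop where
  re_left : s.re = 1 / 2
  re_right : t.re = τ / 2
  normSq_left : Quaternion.normSq s = 1
  normSq_right : Quaternion.normSq t = 1
  re_mul : (s * t).re = 0

namespace QuaternionPair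

variable {τ : ℝ} {s t : Quaternion ℝ}

theorem tracePair (h : QuaternionPair τ s t) : TracePair (1 : ℝ) τ 0 s t := by
  have h1 := h.re_left
  have h2 := h.re_right
  have h3 := h.normSq_left
  have h4 := h.normSq_right
  have h5 := h.re_mul
  rw [Quaternion.normSq_def'] at h3 h4
  rw [Quaternion.re_mul] at h5
  refine ⟨?_, ?_, ?_⟩
  · ext <;> simp
    · linear_combination (2 * s.re) * h1 - h3
    · linear_combination (2 * s.imI) * h1
    · linear_combination (2 * s.imJ) * h1
    · linear_combination (2 * s.imK) * h1
  · ext <;> simp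
    · linear_combination (2 * t.re) * h2 - h4
    · linear_combination (2 * t.imI) * h2
    · linear_combination (2 * t.imJ) * h2
    · linear_combination (2 * t.imK) * h2
  · ext <;> simp
    · linear_combination 2 * h5 - τ * h1 - h2 
    · linear_combination (2 * t.imI) * h1 + (2 * s.imI) * h2
    · linear_combination (2 * t.imJ) * h1 + (2 * s.imJ) * h2
    · linear_combination (2 * t.imK) * h1 + (2 * s.imK) * h2

/-- The norm form has coefficients in `ℤ[τ]`, so the norm of an element with coordinates in `ℤ[θ]`
is again a quadratic integer, a sum of nine products. -/
theorem normSq_combo (h : QuaternionPair τ s t) (a b c d : ℝ) :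
    Quaternion.normSq (combo s t a b c d) = a * a + b * b + c * c + d * d + a * b + τ * a * c +
      τ * b * c + τ * b * d + c * d := by
  have h1 := h.re_left
  have h2 := h.re_right
  have h3 := h.normSq_left
  have h4 := h.normSq_right
  have h5 := h.re_mul
  rw [Quaternion.normSq_def'] at h3 h4
  rw [Quaternion.re_mul] at h5
  rw [Quaternion.normSq_def', combo]
  simp
  simp only [h1, h2] at h3 h4 h5 ⊢
  linear_combination (b ^ 2 + 2 * b * d * (τ / 2) + d ^ 2 * (τ ^ 2 / 4 + t.imI ^ 2 + t.imJ ^ 2 + t.imK ^ 2)) * h3 + (c ^ 2 + d ^ 2 + 2 * c * d * (1 / 2)) * h4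
    + (2 * a * d - 2 * b * c) * h5

end QuaternionPair

end Quaternions

/-! ### Comparison of a quaternion group with its reduction modulo `p`. -/

section Reduction

variable {R C A : Type*} [CommRing R] [CommRing C] [Ring A] [Algebra C A] {s t : A}

theorem combo_sub (a b c d a' b' c' d' : C) : combo s t (a - a') (b - b') (c - c') (d - d') =
    combo s t a b c d - combo s t a' b' c' d' := by
  simp only [combo]; module

theorem combo_one : combo s t (1 : C) 0 0 0 = 1 := by simp [combo]

variable (f : R →+* C) {θ : R}

theorem TracePair.combo_map_mul_left (h : TracePair 1 (f θ) 0 s t) (a b c d : R) :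
    combo s t (f a) (f b) (f c) (f d) * s =
      combo s t (f (-b - c * θ - θ * d)) (f (a + b + θ * c)) (f (c + d)) (f (-c)) := by
  rw [h.combo_mul_left]; congr 1 <;> simp <;> ring

theorem TracePair.combo_map_mul_right (h : TracePair 1 (f θ) 0 s t) (a b c d : R) :
    combo s t (f a) (f b) (f c) (f d) * t =
      combo s t (f (-c)) (f (-d)) (f (a + θ * c)) (f (b + θ * d)) := by
  rw [h.combo_mul_right]; congr 1 <;> simp

theorem TracePair.mul_left_inv {x y z : C} (h : TracePair x y z s t) :
    s * (x • (1 : A) - s) = 1 := by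
  rw [mul_sub, h.sq_left, mul_smul_comm, mul_one, sub_sub_cancel]

theorem TracePair.mul_right_inv {x y z : C} (h : TracePair x y z s t) :
    t * (y • (1 : A) - t) = 1 := by
  rw [mul_sub, h.sq_right, mul_smul_comm, mul_one, sub_sub_cancel]

theorem TracePair.combo_map_mul_left_inv (h : TracePair 1 (f θ) 0 s t) {s' : A} (hs : s' * s = 1)
    (a b c d : R) :
    combo s t (f a) (f b) (f c) (f d) * s' =
      combo s t (f (a - (-b - c * θ - θ * d))) (f (b - (a + b + θ * c))) (f (c - (c + d)))
        (f (d - -c)) := by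
  have : s' = (1 : C) • (1 : A) - s := by
    have := congrArg (s' * ·) h.mul_left_inv
    simpa [← mul_assoc, hs] using this.symm
  simp only [map_sub f a, map_sub f b, map_sub f c, map_sub f d]
  rw [combo_sub, ← h.combo_map_mul_left, this, mul_sub, one_smul, mul_one]

theorem TracePair.combo_map_mul_right_inv (h : TracePair 1 (f θ) 0 s t) {t' : A} (ht : t' * t = 1)
    (a b c d : R) :
    combo s t (f a) (f b) (f c) (f d) * t' =
      combo s t (f (θ * a - -c)) (f (θ * b - -d)) (f (θ * c - (a + θ * c)))
        (f (θ * d - (b + θ * d))) := by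
  have : t' = (f θ) • (1 : A) - t := by
    have := congrArg (t' * ·) h.mul_right_inv
    simpa [← mul_assoc, ht] using this.symm
  simp only [map_sub f (θ * a), map_sub f (θ * b), map_sub f (θ * c), map_sub f (θ * d)]
  rw [combo_sub, ← h.combo_map_mul_right, this, mul_sub]
  simp [combo, smul_smul]

end Reduction

section Closure

variable {α β : ℤ} {p : ℕ} [Fact p.Prime]

/-- Simultaneous words in the generators have common coordinates in `ℤ[θ]`, evaluated at `τ₀`, `τ₁`
and `τ`. The projections to the first quaternion group and to `SL₂(𝔽_p)` have the same kernel. In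
the hard direction the coordinates of `g - 1` reduce to zero, and `evalQuadratic_mul_eq_zero`
applies to its norm. The conjugate pair `s₁`, `t₁` serves to bound the second real value of this
norm. Finiteness of the groups plays no role. -/
theorem nonempty_closure_mulEquiv {τ : ZMod p} {τ₀ τ₁ : ℝ} (hp : 5 ≤ p)
    (h : τ * τ = α + β * τ) (h₀ : τ₀ * τ₀ = α + β * τ₀) (h₁ : τ₁ * τ₁ = α + β * τ₁)
    (h01 : τ₀ + τ₁ = β) (hz01 : ∀ r, evalQuadratic τ₀ h₀ r = 0 ↔ evalQuadratic τ₁ h₁ r = 0)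
    (hz : ∀ r, evalQuadratic τ₀ h₀ r = 0 → evalQuadratic τ h r = 0)
    (hκ : (1 : ZMod p) ^ 2 + τ ^ 2 + 0 ^ 2 - 1 * τ * 0 - 4 ≠ 0)
    (hκ₀ : (1 : ℝ) ^ 2 + τ₀ ^ 2 + 0 ^ 2 - 1 * τ₀ * 0 - 4 ≠ 0)
    {s₀ t₀ s₁ t₁ : (Quaternion ℝ)ˣ} (hq₀ : QuaternionPair τ₀ (s₀ : Quaternion ℝ) t₀)
    (hq₁ : QuaternionPair τ₁ (s₁ : Quaternion ℝ) t₁) {s t : SL(2, ZMod p)}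
    (hst : TracePair 1 τ 0 (s : Matrix (Fin 2) (Fin 2) (ZMod p)) (t : Matrix _ _ (ZMod p))) :
    Nonempty (Subgroup.closure {s₀, t₀} ≃* Subgroup.closure {s, t}) := by
  let G := (Quaternion ℝ)ˣ × (Quaternion ℝ)ˣ × SL(2, ZMod p)
  let Γ : Subgroup G := Subgroup.closure {((s₀, s₁, s) : G), (t₀, t₁, t)}
  set f₀ := evalQuadratic τ₀ h₀ with hf₀
  set f₁ := evalQuadratic τ₁ h₁ with hf₁
  set f := evalQuadratic τ h with hf
  let θ : QuadraticAlgebra ℤ α β := QuadraticAlgebra.omega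
  have hp₀ : TracePair 1 (f₀ θ) 0 (s₀ : Quaternion ℝ) (t₀ : Quaternion ℝ) := by
    rw [hf₀, evalQuadratic_omega]; exact hq₀.tracePair
  have hp₁ : TracePair 1 (f₁ θ) 0 (s₁ : Quaternion ℝ) (t₁ : Quaternion ℝ) := by
    rw [hf₁, evalQuadratic_omega]; exact hq₁.tracePair
  have hpf : TracePair 1 (f θ) 0 (s : Matrix (Fin 2) (Fin 2) (ZMod p))
      (t : Matrix _ _ (ZMod p)) := by
    rw [hf, evalQuadratic_omega]; exact hst
  have key : ∀ g ∈ Γ, (∃ a b c d : QuadraticAlgebra ℤ α β,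
      (g.1 : Quaternion ℝ) = combo (s₀ : Quaternion ℝ) t₀ (f₀ a) (f₀ b) (f₀ c) (f₀ d) ∧
      (g.2.1 : Quaternion ℝ) = combo (s₁ : Quaternion ℝ) t₁ (f₁ a) (f₁ b) (f₁ c) (f₁ d) ∧
      (g.2.2 : Matrix (Fin 2) (Fin 2) (ZMod p)) =
        combo (s : Matrix (Fin 2) (Fin 2) (ZMod p)) t (f a) (f b) (f c) (f d)) := by
    intro g hg
    induction hg using Subgroup.closure_induction_right with
    | one => exact ⟨1, 0, 0, 0, by simp [combo], by simp [combo], by simp [combo]⟩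
    | mul_right x hx y hy ih =>
      obtain ⟨a, b, c, d, e₀, e₁, e⟩ := ih
      rcases hy with rfl | rfl
      · exact ⟨_, _, _, _, by
          rw [Prod.fst_mul, Units.val_mul, e₀]; exact hp₀.combo_map_mul_left f₀ a b c d, by
          rw [Prod.snd_mul, Prod.fst_mul, Units.val_mul, e₁]
          exact hp₁.combo_map_mul_left f₁ a b c d, by
          rw [Prod.snd_mul, Prod.snd_mul, Matrix.SpecialLinearGroup.coe_mul, e]
          exact hpf.combo_map_mul_left f a b c d⟩
      · exact ⟨_, _, _, _, by
          rw [Prod.fst_mul, Units.val_mul, e₀]; exact hp₀.combo_map_mul_right f₀ a b c d, by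
          rw [Prod.snd_mul, Prod.fst_mul, Units.val_mul, e₁]
          exact hp₁.combo_map_mul_right f₁ a b c d, by
          rw [Prod.snd_mul, Prod.snd_mul, Matrix.SpecialLinearGroup.coe_mul, e]
          exact hpf.combo_map_mul_right f a b c d⟩
    | mul_inv_cancel x hx y hy ih =>
      obtain ⟨a, b, c, d, e₀, e₁, e⟩ := ih
      have hinv : ∀ w : SL(2, ZMod p), ((w⁻¹ : SL(2, ZMod p)) : Matrix (Fin 2) (Fin 2) (ZMod p)) *
          (w : Matrix (Fin 2) (Fin 2) (ZMod p)) = 1 := fun w => by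
        rw [← Matrix.SpecialLinearGroup.coe_mul, inv_mul_cancel, Matrix.SpecialLinearGroup.coe_one]
      rcases hy with rfl | rfl
      · exact ⟨_, _, _, _, by
          rw [Prod.fst_mul, Units.val_mul, e₀]
          exact hp₀.combo_map_mul_left_inv f₀ (Units.inv_mul _) a b c d, by
          rw [Prod.snd_mul, Prod.fst_mul, Units.val_mul, e₁]
          exact hp₁.combo_map_mul_left_inv f₁ (Units.inv_mul _) a b c d, by
          rw [Prod.snd_mul, Prod.snd_mul, Matrix.SpecialLinearGroup.coe_mul, e]
          exact hpf.combo_map_mul_left_inv f (hinv _) a b c d⟩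
      · exact ⟨_, _, _, _, by
          rw [Prod.fst_mul, Units.val_mul, e₀]
          exact hp₀.combo_map_mul_right_inv f₀ (Units.inv_mul _) a b c d, by
          rw [Prod.snd_mul, Prod.fst_mul, Units.val_mul, e₁]
          exact hp₁.combo_map_mul_right_inv f₁ (Units.inv_mul _) a b c d, by
          rw [Prod.snd_mul, Prod.snd_mul, Matrix.SpecialLinearGroup.coe_mul, e]
          exact hpf.combo_map_mul_right_inv f (hinv _) a b c d⟩
  let N : (Quaternion ℝ)ˣ →* ℝˣ := Units.map (Quaternion.normSq : Quaternion ℝ →*₀ ℝ).toMonoidHom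
  have hN : ∀ u : (Quaternion ℝ)ˣ, u ∈ N.ker ↔ Quaternion.normSq (u : Quaternion ℝ) = 1 := by
    intro u
    rw [MonoidHom.mem_ker, Units.ext_iff]; rfl
  have hΓ₀ : Γ ≤ N.ker.comap (MonoidHom.fst _ _) := by
    rw [Subgroup.closure_le]
    rintro _ (rfl | rfl)
    · exact (hN s₀).2 hq₀.normSq_left
    · exact (hN t₀).2 hq₀.normSq_right
  have hΓ₁ : Γ ≤ N.ker.comap ((MonoidHom.fst _ _).comp (MonoidHom.snd _ _)) := by
    rw [Subgroup.closure_le]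
    rintro _ (rfl | rfl)
    · exact (hN s₁).2 hq₁.normSq_left
    · exact (hN t₁).2 hq₁.normSq_right
  have hbound : ∀ u : Quaternion ℝ, Quaternion.normSq u = 1 → Quaternion.normSq (u - 1) ≤ 4 := by
    intro u hu
    rw [Quaternion.normSq_eq_norm_mul_self] at hu ⊢
    have h1 : ‖u‖ = 1 := by nlinarith [norm_nonneg u]
    have h2 : ‖u - 1‖ ≤ 2 := by
      refine (norm_sub_le _ _).trans ?_
      rw [h1, norm_one]; norm_num
    nlinarith [norm_nonneg (u - 1)]
  let π₀ : Γ →* (Quaternion ℝ)ˣ := (MonoidHom.fst _ _).comp Γ.subtype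
  let π : Γ →* SL(2, ZMod p) := ((MonoidHom.snd _ _).comp (MonoidHom.snd _ _)).comp Γ.subtype
  have hker : ∀ g : Γ, π₀ g = 1 ↔ π g = 1 := by
    rintro ⟨⟨x₀, x₁, y⟩, hg⟩
    obtain ⟨a, b, c, d, e₀, e₁, e⟩ := key _ hg
    change x₀ = 1 ↔ y = 1
    have hx₀ : x₀ = 1 ↔ f₀ (a - 1) = 0 ∧ f₀ b = 0 ∧ f₀ c = 0 ∧ f₀ d = 0 := by
      rw [← Units.val_eq_one, show (x₀ : Quaternion ℝ) = _ from e₀]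
      constructor
      · intro h
        rw [← combo_one (C := ℝ) (s := (s₀ : Quaternion ℝ)) (t := (t₀ : Quaternion ℝ))] at h
        obtain ⟨h1, h2, h3, h4⟩ := hq₀.tracePair.combo_injective hκ₀ h
        exact ⟨by rw [map_sub, h1, map_one, sub_self], h2, h3, h4⟩
      · rintro ⟨h1, h2, h3, h4⟩
        rw [map_sub, map_one, sub_eq_zero] at h1
        rw [h1, h2, h3, h4, combo_one]
    have hy : y = 1 ↔ f (a - 1) = 0 ∧ f b = 0 ∧ f c = 0 ∧ f d = 0 := by
      have hy1 : y = 1 ↔ (y : Matrix (Fin 2) (Fin 2) (ZMod p)) = 1 :=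
        ⟨by rintro rfl; rfl, fun h => Subtype.ext h⟩
      rw [hy1, show (y : Matrix (Fin 2) (Fin 2) (ZMod p)) = _ from e]
      constructor
      · intro h
        rw [← combo_one (C := ZMod p) (s := (s : Matrix (Fin 2) (Fin 2) (ZMod p)))
          (t := (t : Matrix (Fin 2) (Fin 2) (ZMod p)))] at h
        obtain ⟨h1, h2, h3, h4⟩ := hst.combo_injective hκ h
        exact ⟨by rw [map_sub, h1, map_one, sub_self], h2, h3, h4⟩
      · rintro ⟨h1, h2, h3, h4⟩
        rw [map_sub, map_one, sub_eq_zero] at h1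
        rw [h1, h2, h3, h4, combo_one]
    rw [hx₀, hy]
    refine ⟨fun ⟨h1, h2, h3, h4⟩ => ⟨hz _ h1, hz _ h2, hz _ h3, hz _ h4⟩,
      fun ⟨h1, h2, h3, h4⟩ => ?_⟩
    rw [← hx₀, ← Units.val_eq_one, ← sub_eq_zero, ← Quaternion.normSq_eq_zero]
    -- The nine monomials of `normSq_combo`, each split into two factors in the kernel of reduction.
    let v : Fin 9 → QuadraticAlgebra ℤ α β :=
      ![a - 1, b, c, d, a - 1, θ * (a - 1), θ * b, θ * b, c]
    let w : Fin 9 → QuadraticAlgebra ℤ α β := ![a - 1, b, c, d, b, c, c, d, d]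
    have n₀ : Quaternion.normSq ((x₀ : Quaternion ℝ) - 1) = f₀ (∑ i, v i * w i) := by
      have : (x₀ : Quaternion ℝ) - 1 =
          combo (s₀ : Quaternion ℝ) t₀ (f₀ (a - 1)) (f₀ b) (f₀ c) (f₀ d) := by
        rw [show (x₀ : Quaternion ℝ) = _ from e₀, map_sub, map_one]; simp only [combo]; module
      rw [this, hq₀.normSq_combo]
      simp only [Fin.sum_univ_succ, v, w, θ, map_add, map_mul, hf₀]
      simp [map_mul, evalQuadratic_omega]
      ring
    have n₁ : Quaternion.normSq ((x₁ : Quaternion ℝ) - 1) = f₁ (∑ i, v i * w i) := by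
      have : (x₁ : Quaternion ℝ) - 1 =
          combo (s₁ : Quaternion ℝ) t₁ (f₁ (a - 1)) (f₁ b) (f₁ c) (f₁ d) := by
        rw [show (x₁ : Quaternion ℝ) = _ from e₁, map_sub, map_one]; simp only [combo]; module
      rw [this, hq₁.normSq_combo]
      simp only [Fin.sum_univ_succ, v, w, θ, map_add, map_mul, hf₁]
      simp [map_mul, evalQuadratic_omega]
      ring
    have hu₀ := hbound x₀ ((hN x₀).1 (hΓ₀ hg))
    have hu₁ := hbound x₁ ((hN x₁).1 (hΓ₁ hg))
    rw [n₀] at hu₀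
    rw [n₁] at hu₁
    rcases evalQuadratic_mul_eq_zero h h₀ h₁ h01 hp Finset.univ v w
      (fun i _ => by fin_cases i <;> simp [v, map_mul, ← hf, h1, h2, h3, h4] )
      (fun i _ => by fin_cases i <;> simp [w, ← hf, h1, h2, h3, h4])
      (by rw [← hf₀, ← n₀]; exact Quaternion.normSq_nonneg) hu₀
      (by rw [← hf₁, ← n₁]; exact Quaternion.normSq_nonneg) hu₁ with h5 | h5
    · rw [n₀]; exact h5
    · rw [n₀]; exact (hz01 _).2 h5
  have r₀ : π₀.range = Subgroup.closure {s₀, t₀} := by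
    rw [MonoidHom.range_comp, Subgroup.range_subtype, MonoidHom.map_closure, Set.image_pair]; rfl
  have r : π.range = Subgroup.closure {s, t} := by
    rw [MonoidHom.range_comp, Subgroup.range_subtype, MonoidHom.map_closure, Set.image_pair]; rfl
  rw [← r₀, ← r]
  exact nonempty_range_mulEquiv_range π₀ π hker

end Closure

/-! ### Matching traces with the isomorphism types `2A₄`, `2S₄`, `2A₅`. -/

/-- Elements of `SL₂` with the traces of standard generators of a binary polyhedral group. -/
structure IsPolyPair {K : Type*} [Field K] (k : ℕ) (s t : SL(2, K)) : Prop where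
  trace_left : (s : Matrix (Fin 2) (Fin 2) K).trace = 1
  trace_right : IsPolyTrace k (t : Matrix (Fin 2) (Fin 2) K).trace
  trace_mul : ((s * t : SL(2, K)) : Matrix (Fin 2) (Fin 2) K).trace = 0

/-- The type of the binary polyhedral group with an element of order `2k`. -/
def polyType : ℕ → SubgroupType
  | 3 => .twoA4
  | 4 => .twoS4
  | _ => .twoA5

theorem quaternionSubgroup_eq (s t : (Quaternion ℝ)ˣ) :
    quaternionSubgroup s t = Subgroup.closure {s, t} := by
  rw [quaternionSubgroup]
  congr 1
  ext u
  simp [Units.ext_iff]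

section QuaternionPair

variable {τ : ℝ} {s t : Quaternion ℝ}

theorem QuaternionPair.mk_of {x0 x1 x2 x3 y0 y1 y2 y3 : ℝ} (h0 : x0 = 1 / 2) (h1 : y0 = τ / 2)
    (h2 : x0 ^ 2 + x1 ^ 2 + x2 ^ 2 + x3 ^ 2 = 1) (h3 : y0 ^ 2 + y1 ^ 2 + y2 ^ 2 + y3 ^ 2 = 1)
    (h4 : x0 * y0 - x1 * y1 - x2 * y2 - x3 * y3 = 0) :
    QuaternionPair τ ⟨x0, x1, x2, x3⟩ ⟨y0, y1, y2, y3⟩ where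
  re_left := h0
  re_right := h1
  normSq_left := (Quaternion.normSq_def' _).trans h2
  normSq_right := (Quaternion.normSq_def' _).trans h3
  re_mul := (Quaternion.re_mul _ _).trans h4

theorem QuaternionPair.exists_units (h : QuaternionPair τ s t) :
    ∃ u v : (Quaternion ℝ)ˣ, (u : Quaternion ℝ) = s ∧ (v : Quaternion ℝ) = t := by
  refine ⟨Units.mk0 s ?_, Units.mk0 t ?_, rfl, rfl⟩
  · rintro rfl; simpa using h.normSq_left
  · rintro rfl; simpa using h.normSq_right

theorem mul_self_of_normSq {w : Quaternion ℝ} (hw : Quaternion.normSq w = 1) :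
    w * w = (2 * w.re) • w - 1 := by
  rw [Quaternion.normSq_def'] at hw
  ext <;> simp [Quaternion.re_one, Quaternion.imI_one, Quaternion.imJ_one, Quaternion.imK_one]
  · linear_combination -hw
  · ring
  · ring
  · ring

theorem pow_eq_neg_one_of_isPolyTrace {A : Type*} [Ring A] [Algebra ℝ A] {w : A} {c : ℝ}
    (hw : w * w = c • w - 1) {k : ℕ} (hc : IsPolyTrace k c) : w ^ k = -1 := by
  have h2 : w ^ 2 = c • w - 1 := by rw [pow_two, hw]
  have h3 : w ^ 3 = (c ^ 2 - 1) • w - c • (1 : A) := by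
    rw [pow_succ, h2, sub_mul, smul_mul_assoc, hw, one_mul]; module
  have h4 : w ^ 4 = (c ^ 3 - 2 * c) • w - (c ^ 2 - 1) • (1 : A) := by
    rw [pow_succ, h3, sub_mul, smul_mul_assoc, hw]; simp only [smul_mul_assoc, one_mul]; module
  have h5 : w ^ 5 = (c ^ 4 - 3 * c ^ 2 + 1) • w - (c ^ 3 - 2 * c) • (1 : A) := by
    rw [pow_succ, h4, sub_mul, smul_mul_assoc, hw]; simp only [smul_mul_assoc, one_mul]; module
  rcases hc with ⟨rfl, h⟩ | ⟨rfl, h⟩ | ⟨rfl, h⟩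
  · rw [h3, h]; simp
  · rw [h4, show c ^ 3 - 2 * c = 0 by linear_combination c * h,
      show c ^ 2 - 1 = 1 by linear_combination h]; simp
  · rw [h5, show c ^ 4 - 3 * c ^ 2 + 1 = 0 by linear_combination (c ^ 2 + c - 1) * h,
      show c ^ 3 - 2 * c = 1 by linear_combination (c + 1) * h]; simp

theorem QuaternionPair.pow_eq (h : QuaternionPair τ s t) {k : ℕ} (hk : IsPolyTrace k τ) :
    s ^ 3 = -1 ∧ t ^ k = -1 ∧ (s * t) ^ 2 = -1 := by
  refine ⟨pow_eq_neg_one_of_isPolyTrace h.tracePair.sq_left (Or.inl ⟨rfl, rfl⟩),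
    pow_eq_neg_one_of_isPolyTrace h.tracePair.sq_right hk, ?_⟩
  have := mul_self_of_normSq (w := s * t) (by rw [map_mul, h.normSq_left, h.normSq_right, mul_one])
  rw [h.re_mul] at this
  rw [pow_two, this]; simp

theorem QuaternionPair.ne_neg_one (h : QuaternionPair τ s t) {k : ℕ} (hk : IsPolyTrace k τ) :
    s ≠ -1 ∧ t ≠ -1 := by
  constructor
  · rintro rfl
    have := h.re_left
    rw [Quaternion.re_neg, Quaternion.re_one] at this
    norm_num at this
  · rintro rfl
    have := h.re_right
    have : τ = -2 := by
      rw [Quaternion.re_neg, Quaternion.re_one] at this; linarith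
    subst this
    rcases hk with ⟨-, h⟩ | ⟨-, h⟩ | ⟨-, h⟩ <;> norm_num at h

end QuaternionPair

section Types

theorem evalQuadratic_eq_zero_of_irrational {α β : ℤ} {τ : ℝ} (hτ : Irrational τ)
    (h : τ * τ = α + β * τ) {r : QuadraticAlgebra ℤ α β} (hr : evalQuadratic τ h r = 0) :
    r = 0 := by
  rw [evalQuadratic_apply] at hr
  have him : r.im = 0 := by
    by_contra him
    have h1 := (hτ.intCast_mul him).intCast_add r.re
    rw [hr] at h1
    exact h1.ne_zero rfl
  rw [him] at hr
  ext
  · simpa using hr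
  · exact him

/-- A subgroup generated by a pair of elements with the traces of standard generators is a binary
polyhedral group. -/
theorem IsPolyPair.hasType {p : ℕ} [Fact p.Prime] (hp : 5 ≤ p) {k : ℕ} {s t : SL(2, ZMod p)}
    (h : IsPolyPair k s t) : HasType (Subgroup.closure {s, t}) (polyType k) := by
  have h2 : (2 : ZMod p) ≠ 0 := by
    intro h
    have : ((2 : ℕ) : ZMod p) = 0 := by exact_mod_cast h
    rw [ZMod.natCast_eq_zero_iff] at this
    have := Nat.le_of_dvd (by norm_num) this
    omega
  have hst := tracePair_of_traces h.trace_left rfl h.trace_mul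
  have hκ := h.trace_right.sq_ne_three h2
  have ht := h.trace_right
  have key : ∀ {α β : ℤ} {τ₀ τ₁ : ℝ}
    (e : (t : Matrix (Fin 2) (Fin 2) (ZMod p)).trace * (t : Matrix (Fin 2) (Fin 2) (ZMod p)).trace
      = α + β * (t : Matrix (Fin 2) (Fin 2) (ZMod p)).trace)
    (h₀ : τ₀ * τ₀ = α + β * τ₀) (h₁ : τ₁ * τ₁ = α + β * τ₁)
    (_ : τ₀ + τ₁ = β) (_ : ∀ r, evalQuadratic τ₀ h₀ r = 0 ↔ evalQuadratic τ₁ h₁ r = 0)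
    (_ : ∀ r, evalQuadratic τ₀ h₀ r = 0 → evalQuadratic _ e r = 0)
    (_ : IsPolyTrace k τ₀) {s₀ t₀ s₁ t₁ : Quaternion ℝ} (_ : QuaternionPair τ₀ s₀ t₀)
    (_ : QuaternionPair τ₁ s₁ t₁), 
    Nonempty (Subgroup.closure {s, t} ≃* quaternionSubgroup s₀ t₀) := by
    intro α β τ₀ τ₁ e h₀ h₁ h01 hz01 hz hk₀ s₀ t₀ s₁ t₁ hq₀ hq₁
    obtain ⟨s₀, t₀, rfl, rfl⟩ := hq₀.exists_units
    obtain ⟨s₁, t₁, rfl, rfl⟩ := hq₁.exists_units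
    rw [quaternionSubgroup_eq]
    obtain ⟨E⟩ := nonempty_closure_mulEquiv hp e h₀ h₁ h01 hz01 hz hκ
      (hk₀.sq_ne_three two_ne_zero) hq₀ hq₁ hst
    exact ⟨E.symm⟩
  have s2 : (√2 : ℝ) * √2 = 2 := Real.mul_self_sqrt (by norm_num)
  have s2' : (√2 : ℝ) ^ 2 = 2 := Real.sq_sqrt (by norm_num)
  have s20 : (√2 : ℝ) ≠ 0 := by positivity
  rcases ht with ⟨rfl, ht⟩ | ⟨rfl, ht⟩ | ⟨rfl, ht⟩
  -- The rational trace `1` is treated as the double root of `X² = 2 X - 1`, so that the tetrahedral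
  -- case fits the quadratic setting with both real pairs equal.
  · refine key (α := -1) (β := 2) (τ₀ := 1) (τ₁ := 1) (by rw [ht]; norm_num) (by norm_num)
      (by norm_num) (by norm_num) (fun r => Iff.rfl) (fun r hr => ?_) (Or.inl ⟨rfl, rfl⟩)
      (QuaternionPair.mk_of (by norm_num) (by norm_num) (by norm_num) (by norm_num)
        (by norm_num))
      (QuaternionPair.mk_of (x0 := 1 / 2) (x1 := 1 / 2) (x2 := 1 / 2) (x3 := 1 / 2) (y0 := 1 / 2)
        (y1 := 1 / 2) (y2 := 1 / 2) (y3 := -1 / 2) (by norm_num) (by norm_num) (by norm_num)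
        (by norm_num) (by norm_num))
    rw [evalQuadratic_apply, mul_one] at hr
    rw [evalQuadratic_apply, ht, mul_one]
    have : r.re + r.im = 0 := by exact_mod_cast hr
    exact_mod_cast congrArg (Int.cast : ℤ → ZMod p) this
  -- The second pair of quaternions is the Galois conjugate of the standard one. Irrationality makes
  -- `ℤ[θ] → ℝ` injective, so the kernel conditions are automatic; likewise for the golden ratio
  -- below.
  · have i0 : Irrational (√2) := irrational_sqrt_two
    refine key (α := 2) (β := 0) (τ₀ := √2) (τ₁ := -√2) (by rw [← pow_two, ht]; simp)
      (by rw [s2]; simp) (by rw [neg_mul_neg, s2]; simp) (by simp)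
      (fun r => ⟨fun hr => ?_, fun hr => ?_⟩) (fun r hr => ?_) (Or.inr (Or.inl ⟨rfl, s2'⟩))
      (QuaternionPair.mk_of (by norm_num) (by field_simp; rw [s2']) (by norm_num)
        (by field_simp; rw [s2']; norm_num) (by ring))
      (QuaternionPair.mk_of (x0 := 1 / 2) (x1 := 1 / 2) (x2 := 1 / 2) (x3 := 1 / 2)
        (y0 := -(1 / √2)) (y1 := -(1 / √2)) (y2 := 0) (y3 := 0) (by norm_num)
        (by field_simp; rw [s2']) (by norm_num)
        (by field_simp; rw [s2']; norm_num) (by ring))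
    · rw [evalQuadratic_eq_zero_of_irrational i0 _ hr, map_zero]
    · rw [evalQuadratic_eq_zero_of_irrational i0.neg _ hr, map_zero]
    · rw [evalQuadratic_eq_zero_of_irrational i0 _ hr, map_zero]
  · have i0 := Real.goldenRatio_irrational
    have i1 := Real.goldenConj_irrational
    have g0 := Real.goldenRatio_sq
    have g1 := Real.goldenConj_sq
    have g01 := Real.goldenRatio_add_goldenConj
    have m := Real.goldenRatio_mul_goldenConj
    have v0 := Real.inv_goldenRatio
    have v1 := Real.inv_goldenConj
    refine key (α := 1) (β := 1) (τ₀ := Real.goldenRatio) (τ₁ := Real.goldenConj)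
      (by rw [← pow_two, ht]; push_cast; ring)
      (by push_cast; linear_combination g0) (by push_cast; linear_combination g1)
      (by rw [g01]; simp)
      (fun r => ⟨fun hr => ?_, fun hr => ?_⟩) (fun r hr => ?_) (Or.inr (Or.inr ⟨rfl, g0⟩))
      (QuaternionPair.mk_of (by norm_num) rfl (by norm_num)
        (by rw [v0]; linear_combination (1 / 4 : ℝ) * g0 + (1 / 4 : ℝ) * g1 + (1 / 4 : ℝ) * g01)
        (by rw [v0]; linear_combination (1 / 4 : ℝ) * g01))
      (QuaternionPair.mk_of (x0 := 1 / 2) (x1 := 1 / 2) (x2 := 1 / 2) (x3 := 1 / 2)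
        (y0 := Real.goldenConj / 2) (y1 := Real.goldenConj⁻¹ / 2) (y2 := 1 / 2) (y3 := 0)
        (by norm_num) rfl (by norm_num)
        (by rw [v1]; linear_combination (1 / 4 : ℝ) * g0 + (1 / 4 : ℝ) * g1 + (1 / 4 : ℝ) * g01)
        (by rw [v1]; linear_combination (1 / 4 : ℝ) * g01))
    · rw [evalQuadratic_eq_zero_of_irrational i0 _ hr, map_zero]
    · rw [evalQuadratic_eq_zero_of_irrational i1 _ hr, map_zero]
    · rw [evalQuadratic_eq_zero_of_irrational i0 _ hr, map_zero]

/-- In the quaternion group `S³ = Tᵏ = (S T)² = E` with `E` an involution. An embedding in `SL₂`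
must send `E` to `-1`, and then these power relations determine the traces. -/
theorem exists_isPolyPair_of_mulEquiv {K : Type} [Field K] (h2 : (2 : K) ≠ 0) {k : ℕ} {τ : ℝ}
    {s₀ t₀ : (Quaternion ℝ)ˣ} (hq : QuaternionPair τ (s₀ : Quaternion ℝ) t₀)
    (hk : IsPolyTrace k τ) {H : Subgroup SL(2, K)} (e : H ≃* Subgroup.closure {s₀, t₀}) :
    ∃ s t : SL(2, K), IsPolyPair k s t ∧ Subgroup.closure {s, t} = H := by
  set B := Subgroup.closure {s₀, t₀} with hB
  let S : B := ⟨s₀, Subgroup.subset_closure (by simp)⟩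
  let T : B := ⟨t₀, Subgroup.subset_closure (by simp)⟩
  let φ : B →* SL(2, K) := H.subtype.comp e.symm.toMonoidHom
  have hφ : Function.Injective φ := H.subtype_injective.comp e.symm.injective
  have hr : φ.range = H := by
    rw [MonoidHom.range_comp, MonoidHom.range_eq_top.2 e.symm.surjective,
      ← MonoidHom.range_eq_map, Subgroup.range_subtype]
  have hcl : Subgroup.closure {S, T} = ⊤ := by
    rw [← Subgroup.closure_closure_coe_preimage]
    congr 1
    ext x
    simp [S, T, Subtype.ext_iff]
  obtain ⟨p1, p2, p3⟩ := hq.pow_eq hk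
  obtain ⟨n1, n2⟩ := hq.ne_neg_one hk
  let E : B := S ^ 3
  have hE : ((E : (Quaternion ℝ)ˣ) : Quaternion ℝ) = -1 := by
    simp [E, S, p1]
  have hT : T ^ k = E := by
    apply Subtype.ext; apply Units.ext; rw [hE]; simp [T, p2]
  have hST : (S * T) ^ 2 = E := by
    apply Subtype.ext; apply Units.ext; rw [hE]; simpa [S, T] using p3
  have hEE : E * E = 1 := by
    apply Subtype.ext; apply Units.ext; rw [Subgroup.coe_mul, Units.val_mul, hE]; simp
  have hE1 : E ≠ 1 := by
    intro h
    have := congrArg (fun x : B => (((x : (Quaternion ℝ)ˣ) : Quaternion ℝ)).re) h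
    simp only [hE, Subgroup.coe_one, Units.val_one, Quaternion.re_neg, Quaternion.re_one] at this
    norm_num at this
  have hSE : S ≠ E := by
    intro h; apply n1; rw [← hE, ← h]
  have hTE : T ≠ E := by
    intro h; apply n2; rw [← hE, ← h]
  have fE : φ E = -1 := by
    rcases eq_one_or_eq_neg_one_of_sq h2 (g := φ E) (by rw [← map_mul, hEE, map_one]) with h | h
    · exact absurd (hφ (h.trans φ.map_one.symm)) hE1
    · exact h
  have key : ∀ {X : B} {j : ℕ}, j ≠ 0 → X ^ j = E → φ X ≠ 1 := by
    intro X j _ hX h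
    rw [hφ (h.trans φ.map_one.symm), one_pow] at hX
    exact hE1 hX.symm
  refine ⟨φ S, φ T, ⟨?_, ?_, ?_⟩, ?_⟩
  · refine trace_of_pow_three (key (j := 3) (by norm_num) rfl) ?_ (by rw [← map_pow, fE])
    rw [← fE]; exact fun h => hSE (hφ h)
  · have hk' : k = 3 ∨ k = 4 ∨ k = 5 := by
      rcases hk with h | h | h
      exacts [Or.inl h.1, Or.inr (Or.inl h.1), Or.inr (Or.inr h.1)]
    refine isPolyTrace_of_pow_eq h2 (key (j := k) (by omega) hT) ?_ hk' (by
      rw [← map_pow, hT, fE])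
    rw [← fE]; exact fun h => hTE (hφ h)
  · rw [trace_eq_zero_iff h2, ← map_mul, ← map_pow, hST, fE]
  · rw [← hr, MonoidHom.range_eq_map, ← hcl, MonoidHom.map_closure, Set.image_pair]

theorem exists_isPolyPair_of_hasType {K : Type} [Field K] (h2 : (2 : K) ≠ 0) {k : ℕ}
    (hk : k = 3 ∨ k = 4 ∨ k = 5) {H : Subgroup SL(2, K)} (h : HasType H (polyType k)) :
    ∃ s t : SL(2, K), IsPolyPair k s t ∧ Subgroup.closure {s, t} = H := by
  have key : ∀ {τ : ℝ} {s₀ t₀ : Quaternion ℝ} (_ : QuaternionPair τ s₀ t₀) (_ : IsPolyTrace k τ)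
      (_ : Nonempty (H ≃* quaternionSubgroup s₀ t₀)),
      ∃ s t : SL(2, K), IsPolyPair k s t ∧ Subgroup.closure {s, t} = H := by
    intro τ s₀ t₀ hq hk he
    obtain ⟨s₀, t₀, rfl, rfl⟩ := hq.exists_units
    rw [quaternionSubgroup_eq] at he
    obtain ⟨e⟩ := he
    exact exists_isPolyPair_of_mulEquiv h2 hq hk e
  have s2' : (√2 : ℝ) ^ 2 = 2 := Real.sq_sqrt (by norm_num)
  have s20 : (√2 : ℝ) ≠ 0 := by positivity
  rcases hk with rfl | rfl | rfl
  · exact key (τ := 1) (QuaternionPair.mk_of (by norm_num) (by norm_num) (by norm_num)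
      (by norm_num) (by norm_num)) (Or.inl ⟨rfl, rfl⟩) h
  · exact key (τ := √2) (QuaternionPair.mk_of (by norm_num) (by field_simp; rw [s2'])
      (by norm_num) (by field_simp; rw [s2']; norm_num) (by ring))
      (Or.inr (Or.inl ⟨rfl, s2'⟩)) h
  · have g0 := Real.goldenRatio_sq
    have g1 := Real.goldenConj_sq
    have g01 := Real.goldenRatio_add_goldenConj
    have v0 := Real.inv_goldenRatio
    exact key (τ := Real.goldenRatio) (QuaternionPair.mk_of (by norm_num) rfl (by norm_num)
      (by rw [v0]; linear_combination (1 / 4 : ℝ) * g0 + (1 / 4 : ℝ) * g1 + (1 / 4 : ℝ) * g01)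
      (by rw [v0]; linear_combination (1 / 4 : ℝ) * g01)) (Or.inr (Or.inr ⟨rfl, g0⟩)) h

end Types

/-! ### Eigenvalues, unipotent elements and companion matrices. -/

section Eigenvalues

variable {K : Type*} [Field K]

theorem eigenvalue_pow (h2 : (2 : K) ≠ 0) {J : Matrix (Fin 2) (Fin 2) K} (hJ : IsAxis J)
    {g : SL(2, K)} (hg : (g : Matrix (Fin 2) (Fin 2) K) * J = J * g) (m : ℕ) :
    ((g ^ m : SL(2, K)) : Matrix (Fin 2) (Fin 2) K) * J = J * (g ^ m : SL(2, K)) ∧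
      IsAxis.eigenvalue J ((g ^ m : SL(2, K)) : Matrix (Fin 2) (Fin 2) K) = IsAxis.eigenvalue J g ^ m := by
  induction m with
  | zero => simp [hJ.eigenvalue_one h2]
  | succ m ih =>
    rw [pow_succ, Matrix.SpecialLinearGroup.coe_mul, hJ.eigenvalue_mul h2 ih.1 hg, ih.2, pow_succ]
    exact ⟨by rw [mul_assoc, hg, ← mul_assoc, ih.1, mul_assoc], rfl⟩

theorem exists_eigenvalue [IsAlgClosed K] (h2 : (2 : K) ≠ 0) {g : SL(2, K)}
    (hg : (g : Matrix (Fin 2) (Fin 2) K).trace ^ 2 ≠ 4) :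
    ∃ e : K, (∀ m : ℕ, e ^ m *
      (((g ^ m : SL(2, K)) : Matrix (Fin 2) (Fin 2) K).trace - e ^ m) = 1) ∧
      ∀ m : ℕ, g ^ m = 1 ↔ e ^ m = 1 := by
  obtain ⟨J, hJ, hgJ⟩ := exists_axis hg
  refine ⟨IsAxis.eigenvalue J g, fun m => ?_, fun m => ?_⟩
  · obtain ⟨h1, h3⟩ := eigenvalue_pow h2 hJ hgJ m
    rw [← h3]
    exact hJ.trace_eq_eigenvalue h2 h1
  · obtain ⟨h1, h3⟩ := eigenvalue_pow h2 hJ hgJ m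
    constructor
    · intro h
      rw [← h3, h, Matrix.SpecialLinearGroup.coe_one, hJ.eigenvalue_one h2]
    · intro h
      exact hJ.eq_one_of_eigenvalue h2 h1 (h3.trans h)

/-- Trace `±2` gives `(g² - 1)² = 0`, and the Frobenius identity in characteristic `p` turns `(g² -
1)ᵖ = 0` into `g²ᵖ = 1`. Squaring `g` treats both signs together. -/
theorem pow_two_mul_char_eq_one (p : ℕ) [Fact p.Prime] [CharP K p] {g : SL(2, K)}
    (hg : (g : Matrix (Fin 2) (Fin 2) K).trace ^ 2 = 4) : g ^ (2 * p) = 1 := by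
  have h1 := Matrix.mul_self_fin_two (g : Matrix (Fin 2) (Fin 2) K)
  rw [g.2, one_smul] at h1
  set x := (g : Matrix (Fin 2) (Fin 2) K).trace
  have h0 : ((g : Matrix (Fin 2) (Fin 2) K) ^ 2 - 1) ^ 2 = 0 := by
    have e : (g : Matrix (Fin 2) (Fin 2) K) ^ 2 - 1 = x • (g : Matrix (Fin 2) (Fin 2) K) - 2 := by
      rw [pow_two, h1, sub_sub]; norm_num
    have h22 : (2 : Matrix (Fin 2) (Fin 2) K) = (2 : K) • 1 := by
      rw [two_smul, one_add_one_eq_two]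
    rw [e, pow_two, h22, mul_sub, sub_mul, sub_mul, smul_mul_smul_comm, h1]
    simp only [smul_mul_assoc, mul_smul_comm, one_mul, mul_one, smul_sub, smul_smul]
    have h4 : x * x = 4 := by rw [← pow_two, hg]
    rw [h4]
    have : (4 * x - 2 * x - x * 2 : K) = 0 := by ring
    rw [← sub_eq_zero] 
    calc _ = (4 * x - 2 * x - x * 2 : K) • (g : Matrix (Fin 2) (Fin 2) K) := by module
      _ = 0 := by rw [this, zero_smul]
  have hp : 2 ≤ p := (Fact.out : p.Prime).two_le
  have h3 : ((g : Matrix (Fin 2) (Fin 2) K) ^ 2 - 1) ^ p = 0 := pow_eq_zero_of_le hp h0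
  rw [sub_pow_char_of_commute p (Commute.one_right _), one_pow, sub_eq_zero, ← pow_mul] at h3
  apply Subtype.ext
  rw [Matrix.SpecialLinearGroup.coe_pow, h3]; rfl

theorem eq_one_or_eq_neg_one_of_trace (p : ℕ) [Fact p.Prime] [CharP K p] (h2 : (2 : K) ≠ 0)
    {g : SL(2, K)} (hc : (orderOf g).Coprime p)
    (hg : (g : Matrix (Fin 2) (Fin 2) K).trace ^ 2 = 4) : g = 1 ∨ g = -1 := by
  have h1 := orderOf_dvd_of_pow_eq_one (pow_two_mul_char_eq_one p hg)
  have h3 := hc.dvd_of_dvd_mul_right h1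
  apply eq_one_or_eq_neg_one_of_sq h2
  rw [← pow_two]
  exact orderOf_dvd_iff_pow_eq_one.1 h3

theorem trace_sq_ne_four {n : ℕ} (p : ℕ) [Fact p.Prime] [CharP K p] (h2 : (2 : K) ≠ 0)
    (hn : 3 ≤ n) (hc : n.Coprime p) {g : SL(2, K)} (hg : orderOf g = n) :
    (g : Matrix (Fin 2) (Fin 2) K).trace ^ 2 ≠ 4 := by
  intro h
  rcases eq_one_or_eq_neg_one_of_trace p h2 (hg ▸ hc) h with h | h
  · rw [h, orderOf_one] at hg; omega
  · have : orderOf g ∣ 2 := orderOf_dvd_of_pow_eq_one (by rw [h]; simp)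
    have := Nat.le_of_dvd (by norm_num) this
    omega

/-- A nonscalar matrix in `SL₂` is similar to the companion matrix of its characteristic
polynomial. -/
theorem exists_companion {g : SL(2, K)} (hg : (g : Matrix (Fin 2) (Fin 2) K).trace ^ 2 ≠ 4) :
    ∃ P : GL (Fin 2) K, (g : Matrix (Fin 2) (Fin 2) K) * P =
      P * !![0, -1; 1, (g : Matrix (Fin 2) (Fin 2) K).trace] := by
  have hdet := g.2
  set M := (g : Matrix (Fin 2) (Fin 2) K) with hM
  rw [Matrix.det_fin_two] at hdet
  rw [Matrix.trace_fin_two] at hg ⊢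
  -- The columns of `P` are a vector and its image, and the condition says that the vector is
  -- cyclic. For nonscalar `M` one of `(1,0)`, `(0,1)`, `(1,1)` is cyclic.
  have key : ∀ u v : K, u * (M 1 0 * u + M 1 1 * v) - v * (M 0 0 * u + M 0 1 * v) ≠ 0 →
      ∃ P : GL (Fin 2) K, M * P = P * !![0, -1; 1, M 0 0 + M 1 1] := by
    intro u v h
    refine ⟨Matrix.GeneralLinearGroup.mkOfDetNeZero
      !![u, M 0 0 * u + M 0 1 * v; v, M 1 0 * u + M 1 1 * v] ?_, ?_⟩
    · rw [Matrix.det_fin_two_of]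
      intro h'; apply h; linear_combination h'
    · change M * !![u, M 0 0 * u + M 0 1 * v; v, M 1 0 * u + M 1 1 * v] =
        !![u, M 0 0 * u + M 0 1 * v; v, M 1 0 * u + M 1 1 * v] * _
      ext i j
      fin_cases i <;> fin_cases j <;> simp [Matrix.mul_apply, Fin.sum_univ_two]
      · linear_combination -u * hdet
      · linear_combination -v * hdet
  by_cases hc : M 1 0 = 0
  · by_cases hb : M 0 1 = 0
    · refine key 1 1 ?_
      rw [hc, hb]
      intro h
      apply hg
      rw [hc, hb] at hdet
      have : M 1 1 = M 0 0 := by linear_combination h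
      rw [this] at hdet ⊢
      linear_combination 4 * hdet
    · refine key 0 1 ?_
      intro h; apply hb; linear_combination -h
  · refine key 1 0 ?_
    intro h; apply hc; linear_combination h

theorem exists_glConj_eq_of_trace_eq {g h : SL(2, K)}
    (hg : (g : Matrix (Fin 2) (Fin 2) K).trace ^ 2 ≠ 4)
    (hgh : (h : Matrix (Fin 2) (Fin 2) K).trace = (g : Matrix (Fin 2) (Fin 2) K).trace) :
    ∃ P : GL (Fin 2) K, glConj P g = h := by
  obtain ⟨P, hP⟩ := exists_companion hg
  obtain ⟨Q, hQ⟩ := exists_companion (g := h) (by rwa [hgh])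
  rw [hgh] at hQ
  refine ⟨Q * P⁻¹, ?_⟩
  rw [glConj_eq_iff]
  have h1 : ((P⁻¹ : GL (Fin 2) K) : Matrix (Fin 2) (Fin 2) K) * g =
      !![0, -1; 1, (g : Matrix (Fin 2) (Fin 2) K).trace] * (P⁻¹ : GL (Fin 2) K) := by
    have := congrArg (fun X => ((P⁻¹ : GL (Fin 2) K) : Matrix (Fin 2) (Fin 2) K) * X *
      ((P⁻¹ : GL (Fin 2) K) : Matrix (Fin 2) (Fin 2) K)) hP
    beta_reduce at this
    rw [mul_assoc, mul_assoc, ← Units.val_mul, mul_inv_cancel, Units.val_one, mul_one,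
      ← mul_assoc (P⁻¹.val) P.val, ← Units.val_mul, inv_mul_cancel, Units.val_one, one_mul] at this
    exact this
  rw [Units.val_mul, mul_assoc, h1, ← mul_assoc, ← hQ, mul_assoc]

end Eigenvalues

/-! ### Orders of elements of `SL₂(𝔽_p)`. -/

section BaseChange

variable (p : ℕ) [Fact p.Prime]

/-- The inclusion of `SL₂(𝔽_p)` in the special linear group over an algebraic closure. -/
noncomputable def baseChange : SL(2, ZMod p) →* SL(2, AlgebraicClosure (ZMod p)) :=
  Matrix.SpecialLinearGroup.map (algebraMap (ZMod p) (AlgebraicClosure (ZMod p)))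

variable {p}

theorem coe_baseChange (g : SL(2, ZMod p)) :
    (baseChange p g : Matrix (Fin 2) (Fin 2) (AlgebraicClosure (ZMod p))) =
      (g : Matrix (Fin 2) (Fin 2) (ZMod p)).map (algebraMap _ _) := rfl

theorem baseChange_injective : Function.Injective (baseChange p) := by
  intro g h e
  apply Subtype.ext
  have := congrArg (fun x : SL(2, AlgebraicClosure (ZMod p)) =>
    (x : Matrix (Fin 2) (Fin 2) (AlgebraicClosure (ZMod p)))) e
  exact Matrix.map_injective (algebraMap (ZMod p) (AlgebraicClosure (ZMod p))).injective this

theorem trace_baseChange (g : SL(2, ZMod p)) :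
    (baseChange p g : Matrix (Fin 2) (Fin 2) (AlgebraicClosure (ZMod p))).trace =
      algebraMap _ _ (g : Matrix (Fin 2) (Fin 2) (ZMod p)).trace := by
  rw [coe_baseChange, ← RingHom.mapMatrix_apply, AddMonoidHom.map_trace]; rfl

theorem baseChange_neg_one : baseChange p (-1) = -1 := by
  apply Subtype.ext
  rw [coe_baseChange]
  ext i j
  fin_cases i <;> fin_cases j <;> simp

theorem two_ne_zero_zmod (hp : 3 < p) : (2 : ZMod p) ≠ 0 := by
  intro h
  have : ((2 : ℕ) : ZMod p) = 0 := by exact_mod_cast h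
  rw [ZMod.natCast_eq_zero_iff] at this
  have := Nat.le_of_dvd (by norm_num) this
  omega

theorem two_ne_zero_closure (hp : 3 < p) : (2 : AlgebraicClosure (ZMod p)) ≠ 0 := by
  have := (map_ne_zero (algebraMap (ZMod p) (AlgebraicClosure (ZMod p)))).2 (two_ne_zero_zmod hp)
  rwa [map_ofNat] at this

theorem exists_algebraMap_eq {x : AlgebraicClosure (ZMod p)} (hx : x ^ p = x) :
    ∃ y : ZMod p, algebraMap _ _ y = x := by
  have h1 := (Subfield.mem_bot_iff_pow_eq_self (AlgebraicClosure (ZMod p)) p).2 hx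
  have : (⊥ : Subfield (AlgebraicClosure (ZMod p))) ≤
    (algebraMap (ZMod p) (AlgebraicClosure (ZMod p))).fieldRange := bot_le
  exact this h1

theorem algebraMap_pow_char (y : ZMod p) :
    (algebraMap (ZMod p) (AlgebraicClosure (ZMod p)) y) ^ p = algebraMap _ _ y := by
  rw [← map_pow, ZMod.pow_card]

theorem congPM_iff {n : ℕ} : CongPM p n ↔ n ∣ p - 1 ∨ n ∣ p + 1 := by
  have h1 : 1 ≤ p := (Fact.out : p.Prime).one_le
  rw [CongPM]
  have e1 : (p : ℤ) ≡ 1 [ZMOD (n : ℤ)] ↔ n ∣ p - 1 := by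
    rw [Int.modEq_comm, Int.modEq_iff_dvd]
    constructor
    · intro h
      have : ((n : ℕ) : ℤ) ∣ ((p - 1 : ℕ) : ℤ) := by push_cast [h1]; exact h
      exact_mod_cast this
    · intro h
      have : ((n : ℕ) : ℤ) ∣ ((p - 1 : ℕ) : ℤ) := by exact_mod_cast h
      push_cast [h1] at this; exact this
  have e2 : (p : ℤ) ≡ -1 [ZMOD (n : ℤ)] ↔ n ∣ p + 1 := by
    rw [Int.modEq_comm, Int.modEq_iff_dvd, sub_neg_eq_add]
    exact_mod_cast Iff.rfl
  rw [e1, e2]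

theorem CongPM.coprime {n : ℕ} (h : CongPM p n) : n.Coprime p := by
  have hp : p.Prime := Fact.out
  rw [Nat.coprime_comm, hp.coprime_iff_not_dvd]
  intro hpn
  rw [congPM_iff] at h
  have h1 := hp.two_le
  rcases h with h | h
  · have := Nat.le_of_dvd (by omega) (hpn.trans h); omega
  · have h3 := (Nat.dvd_add_right (dvd_refl p)).1 (hpn.trans h)
    have := Nat.le_of_dvd (by norm_num) h3; omega

/-- The order of an element of `SL₂(𝔽_p)`, if prime to `p`, divides `p - 1` or `p + 1`. -/
theorem congPM_orderOf (hp : 3 < p) {g : SL(2, ZMod p)} (hc : (orderOf g).Coprime p) :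
    CongPM p (orderOf g) := by
  have h2 := two_ne_zero_closure hp
  rw [congPM_iff]
  by_cases hg : (g : Matrix (Fin 2) (Fin 2) (ZMod p)).trace ^ 2 = 4
  · have : Odd p := (Fact.out : p.Prime).odd_of_ne_two (by omega)
    left
    have h3 : orderOf g ∣ 2 := by
      apply orderOf_dvd_of_pow_eq_one
      rcases eq_one_or_eq_neg_one_of_trace p (two_ne_zero_zmod hp) hc hg with h | h <;>
        rw [h] <;> simp
    obtain ⟨m, hm⟩ := this
    exact h3.trans ⟨m, by omega⟩
  have hg' : (baseChange p g : Matrix (Fin 2) (Fin 2) (AlgebraicClosure (ZMod p))).trace ^ 2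
      ≠ 4 := by
    rw [trace_baseChange, ← map_pow]
    intro h
    apply hg
    apply (algebraMap (ZMod p) (AlgebraicClosure (ZMod p))).injective
    rw [h, map_ofNat]
  obtain ⟨e, he, hpow⟩ := exists_eigenvalue h2 hg'
  have he1 := he 1
  rw [pow_one, pow_one, trace_baseChange] at he1
  set c := algebraMap (ZMod p) (AlgebraicClosure (ZMod p))
    (g : Matrix (Fin 2) (Fin 2) (ZMod p)).trace with hc
  have he0 : e ≠ 0 := by rintro rfl; simp at he1
  have hcp : c ^ p = c := algebraMap_pow_char _
  have h3 : e ^ p * (c - e ^ p) = 1 := by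
    have := congrArg (· ^ p) he1
    simpa [mul_pow, sub_pow_char, hcp] using this
  -- Frobenius permutes the roots `e`, `e⁻¹` of the characteristic polynomial, which has
  -- coefficients in `𝔽_p`.
  have h4 : (e ^ p - e) * (e ^ p * e - 1) = 0 := by
    linear_combination e ^ p * he1 - e * h3
  have hord : ∀ m : ℕ, e ^ m = 1 → orderOf g ∣ m := by
    intro m hm
    apply orderOf_dvd_of_pow_eq_one
    apply baseChange_injective
    rw [map_pow, map_one]
    exact (hpow m).2 hm
  have h1 : 1 ≤ p := (Fact.out : p.Prime).one_le
  rcases mul_eq_zero.1 h4 with h5 | h5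
  · left
    apply hord
    apply mul_right_cancel₀ he0
    rw [← pow_succ, Nat.sub_add_cancel h1, one_mul]
    linear_combination h5
  · right
    apply hord
    rw [pow_succ]; linear_combination h5

theorem exists_trace_eq {n : ℕ} (h : CongPM p n) {ζ : AlgebraicClosure (ZMod p)}
    (hζ : ζ ^ n = 1) : ∃ c : ZMod p, algebraMap _ _ c = ζ + ζ⁻¹ := by
  apply exists_algebraMap_eq
  rw [add_pow_char, inv_pow]
  have h1 : 1 ≤ p := (Fact.out : p.Prime).one_le
  rw [congPM_iff] at h
  rcases h with ⟨m, hm⟩ | ⟨m, hm⟩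
  · have : ζ ^ p = ζ := by
      have : ζ ^ p = ζ ^ (p - 1) * ζ := by rw [← pow_succ, Nat.sub_add_cancel h1]
      rw [this, hm, pow_mul, hζ, one_pow, one_mul]
    rw [this]
  · have : ζ ^ p = ζ⁻¹ := by
      apply eq_inv_of_mul_eq_one_left
      rw [← pow_succ, hm, pow_mul, hζ, one_pow]
    rw [this, inv_inv, add_comm]

/-- Take the companion matrix with trace `ζ + ζ⁻¹`, where `ζ` is a primitive `n`-th root of unity.
The trace is fixed by Frobenius because `ζᵖ = ζ^{±1}`, and `n ≥ 3` gives `ζ ≠ ζ⁻¹`, so the order is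
that of `ζ`. -/
theorem exists_orderOf_eq (hp : 3 < p) {n : ℕ} (hn : 3 ≤ n) (h : CongPM p n) :
    ∃ g : SL(2, ZMod p), orderOf g = n := by
  have h2 := two_ne_zero_closure hp
  have : NeZero (n : ZMod p) := ⟨by
    intro h0
    rw [ZMod.natCast_eq_zero_iff] at h0
    exact ((Fact.out : p.Prime).coprime_iff_not_dvd.1 h.coprime.symm) h0⟩
  obtain ⟨ζ, hζ⟩ := HasEnoughRootsOfUnity.exists_primitiveRoot (AlgebraicClosure (ZMod p)) n
  have h0 : ζ ≠ 0 := hζ.ne_zero (by omega)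
  obtain ⟨c, hc⟩ := exists_trace_eq h hζ.pow_eq_one
  let g : SL(2, ZMod p) := ⟨!![0, -1; 1, c], by simp [Matrix.det_fin_two]⟩
  have hg : (g : Matrix (Fin 2) (Fin 2) (ZMod p)).trace = c := by
    simp [g, Matrix.trace_fin_two]
  have hζ2 : ζ ^ 2 ≠ 1 := fun h => by
    have := Nat.le_of_dvd (by norm_num) (hζ.dvd_of_pow_eq_one 2 h)
    omega
  have hg' : (baseChange p g : Matrix (Fin 2) (Fin 2) (AlgebraicClosure (ZMod p))).trace ^ 2
      ≠ 4 := by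
    rw [trace_baseChange, hg, hc]
    intro h
    have : (ζ ^ 2 - 1) ^ 2 = 0 := by
      have h3 : ζ * ζ⁻¹ = 1 := mul_inv_cancel₀ h0
      linear_combination ζ ^ 2 * h - (4 * ζ ^ 2 - 2 * ζ ^ 2 + ζ * ζ⁻¹ + 1 - 2 * ζ ^ 2 + 2 * ζ ^ 2) * h3
    exact hζ2 (by linear_combination (pow_eq_zero_iff two_ne_zero).1 this)
  obtain ⟨e, he, hpow⟩ := exists_eigenvalue h2 hg'
  have he1 := he 1
  rw [pow_one, pow_one, trace_baseChange, hg, hc] at he1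
  have hcases : e = ζ ∨ e = ζ⁻¹ := by
    have : (e - ζ) * (e - ζ⁻¹) = 0 := by
      have h3 : ζ * ζ⁻¹ = 1 := mul_inv_cancel₀ h0
      linear_combination -he1 + h3
    rcases mul_eq_zero.1 this with h | h
    · left; linear_combination h
    · right; linear_combination h
  have hprim : IsPrimitiveRoot e n := by
    rcases hcases with rfl | rfl
    exacts [hζ, hζ.inv]
  refine ⟨g, ?_⟩
  rw [← orderOf_injective _ baseChange_injective, hprim.eq_orderOf]
  exact orderOf_eq_orderOf_iff.2 hpow

/-- Two elements of the same order have the same trace after replacing one by a power. -/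
theorem exists_pow_trace_eq (hp : 3 < p) {n : ℕ} (hn : 3 ≤ n) (hnp : n.Coprime p)
    {g h : SL(2, ZMod p)} (hg : orderOf g = n) (hh : orderOf h = n) :
    ∃ i : ℕ, i.Coprime n ∧ ((g ^ i : SL(2, ZMod p)) : Matrix (Fin 2) (Fin 2) (ZMod p)).trace =
      (h : Matrix (Fin 2) (Fin 2) (ZMod p)).trace := by
  have h2 := two_ne_zero_closure hp
  have : NeZero n := ⟨by omega⟩
  have htr : ∀ {g : SL(2, ZMod p)}, orderOf g = n →
      (baseChange p g : Matrix (Fin 2) (Fin 2) (AlgebraicClosure (ZMod p))).trace ^ 2 ≠ 4 :=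
    fun hg => trace_sq_ne_four p h2 hn hnp (by rw [orderOf_injective _ baseChange_injective, hg])
  obtain ⟨e, he, hpow⟩ := exists_eigenvalue h2 (htr hg)
  obtain ⟨e', he', hpow'⟩ := exists_eigenvalue h2 (htr hh)
  have hprim : IsPrimitiveRoot e n := by
    rw [← hg, ← orderOf_injective _ baseChange_injective, orderOf_eq_orderOf_iff.2 hpow]
    exact IsPrimitiveRoot.orderOf e
  have hprim' : IsPrimitiveRoot e' n := by
    rw [← hh, ← orderOf_injective _ baseChange_injective, orderOf_eq_orderOf_iff.2 hpow']
    exact IsPrimitiveRoot.orderOf e'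
  obtain ⟨i, -, hi, rfl⟩ := (hprim.isPrimitiveRoot_iff).1 hprim'
  refine ⟨i, hi, ?_⟩
  apply (algebraMap (ZMod p) (AlgebraicClosure (ZMod p))).injective
  rw [← trace_baseChange, ← trace_baseChange, map_pow]
  have h3 := he i
  have h4 := he' 1
  rw [pow_one, pow_one] at h4
  have h0 : e ^ i ≠ 0 := pow_ne_zero _ (hprim.ne_zero (by omega))
  exact sub_left_injective (mul_left_cancel₀ h0 (h3.trans h4.symm))

end BaseChange

/-! ### Recognition of binary dihedral groups by generators. -/

section Dicyclic

variable {G : Type*} [Group G]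

/-- Standard generators of a binary dihedral group. -/
structure IsDicyclicPair (n : ℕ) (a b : G) : Prop where
  orderOf_eq : orderOf a = 2 * n
  conj : b * a * b⁻¹ = a⁻¹
  mul_self : b * b = a ^ n
  notMem : b ∉ Subgroup.zpowers a

namespace IsDicyclicPair

variable {n : ℕ} {a b : G}

theorem zpow_mul (h : IsDicyclicPair n a b) (i : ℤ) : a ^ i * b = b * a ^ (-i) := by
  have h1 : b * a ^ (-i) * b⁻¹ = a ^ i := by
    rw [← conj_zpow, h.conj, inv_zpow, zpow_neg, inv_inv]
  rw [← h1, inv_mul_cancel_right]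

theorem exists_hom [NeZero n] (h : IsDicyclicPair n a b) :
    ∃ f : QuaternionGroup n →* G, (∀ i : ℤ, f (.a i) = a ^ i) ∧ ∀ i : ℤ, f (.xa i) = b * a ^ i := by
  have hper : ∀ i j : ℤ, (i : ZMod (2 * n)) = j → a ^ i = a ^ j := by
    intro i j hij
    rw [ZMod.intCast_eq_intCast_iff, ← h.orderOf_eq] at hij
    exact zpow_eq_zpow_iff_modEq.2 hij
  let c : ZMod (2 * n) → ℤ := fun i => i.cast
  have hc : ∀ i : ZMod (2 * n), ((c i : ℤ) : ZMod (2 * n)) = i := fun i => ZMod.intCast_zmod_cast i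
  let f : QuaternionGroup n → G
    | .a i => a ^ c i
    | .xa i => b * a ^ c i
  have hfa : ∀ i : ℤ, f (.a i) = a ^ i := fun i => hper _ _ (hc _)
  have hfx : ∀ i : ℤ, f (.xa i) = b * a ^ i := fun i => congrArg (b * ·) (hper _ _ (hc _))
  have hn : a ^ (n : ℤ) = b * b := by rw [zpow_natCast, h.mul_self]
  refine ⟨MonoidHom.mk' f ?_, hfa, hfx⟩
  rintro (i | i) (j | j) <;> obtain ⟨i, rfl⟩ := ZMod.intCast_surjective i <;>
    obtain ⟨j, rfl⟩ := ZMod.intCast_surjective j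
  · rw [QuaternionGroup.a_mul_a, ← Int.cast_add, hfa, hfa, hfa, zpow_add]
  · rw [QuaternionGroup.a_mul_xa, ← Int.cast_sub, hfa, hfx, hfx, ← mul_assoc, h.zpow_mul,
      mul_assoc, ← zpow_add]
    congr 2; ring
  · rw [QuaternionGroup.xa_mul_a, ← Int.cast_add, hfa, hfx, hfx, mul_assoc, ← zpow_add]
  · have : ((n : ZMod (2 * n)) + (j : ZMod (2 * n)) - (i : ZMod (2 * n))) =
      ((n + j - i : ℤ) : ZMod (2 * n)) := by push_cast; rfl
    rw [QuaternionGroup.xa_mul_xa, this, hfa, hfx, hfx, mul_assoc, ← mul_assoc (a ^ i) b,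
      h.zpow_mul, mul_assoc b, ← zpow_add, ← mul_assoc, ← hn, ← zpow_add]
    congr 1; ring

theorem nonempty_mulEquiv [NeZero n] (h : IsDicyclicPair n a b) :
    Nonempty (Subgroup.closure {a, b} ≃* QuaternionGroup n) := by
  obtain ⟨f, hfa, hfx⟩ := h.exists_hom
  have hinj : Function.Injective f := by
    rw [injective_iff_map_eq_one]
    rintro (i | i) hi <;> obtain ⟨i, rfl⟩ := ZMod.intCast_surjective i
    · rw [hfa] at hi
      have h1 : a ^ i = a ^ (0 : ℤ) := by rw [hi, zpow_zero]
      rw [zpow_eq_zpow_iff_modEq, h.orderOf_eq, ← ZMod.intCast_eq_intCast_iff] at h1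
      rw [h1, Int.cast_zero]; rfl
    · exfalso
      rw [hfx] at hi
      apply h.notMem
      rw [eq_inv_of_mul_eq_one_left hi]
      exact Subgroup.inv_mem _ (Subgroup.zpow_mem _ (Subgroup.mem_zpowers a) i)
  have hr : f.range = Subgroup.closure {a, b} := by
    apply le_antisymm
    · rintro _ ⟨(i | i), rfl⟩ <;> obtain ⟨i, rfl⟩ := ZMod.intCast_surjective i
      · rw [hfa]
        exact Subgroup.zpow_mem _ (Subgroup.subset_closure (by simp)) i
      · rw [hfx]
        exact Subgroup.mul_mem _ (Subgroup.subset_closure (by simp))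
          (Subgroup.zpow_mem _ (Subgroup.subset_closure (by simp)) i)
    · rw [Subgroup.closure_le]
      rintro _ (rfl | rfl)
      · exact ⟨.a (1 : ℤ), by rw [hfa, zpow_one]⟩
      · exact ⟨.xa (0 : ℤ), by rw [hfx, zpow_zero, mul_one]⟩
  rw [← hr]
  exact ⟨(MonoidHom.ofInjective hinj).symm⟩

end IsDicyclicPair

theorem exists_isDicyclicPair {n : ℕ} [NeZero n] (e : G ≃* QuaternionGroup n) :
    ∃ a b : G, IsDicyclicPair n a b ∧ Subgroup.closure {a, b} = ⊤ := by
  have hone : ∀ i : ℕ, (QuaternionGroup.a 1 : QuaternionGroup n) ^ i = .a i :=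
    QuaternionGroup.a_one_pow
  refine ⟨e.symm (.a 1), e.symm (.xa 0), ⟨?_, ?_, ?_, ?_⟩, ?_⟩
  · rw [MulEquiv.orderOf_eq, QuaternionGroup.orderOf_a_one]
  · rw [← map_inv, ← map_inv, ← map_mul, ← map_mul]
    congr 1
    rw [mul_inv_eq_iff_eq_mul, eq_inv_mul_iff_mul_eq]
    simp
  · rw [← map_mul, ← map_pow, hone]
    simp
  · rintro ⟨i, hi⟩
    let f : Multiplicative (ZMod (2 * n)) →* QuaternionGroup n :=
      MonoidHom.mk' (fun i => .a i.toAdd) fun _ _ => rfl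
    have h1 : (QuaternionGroup.a 1 : QuaternionGroup n) ^ i = f (Multiplicative.ofAdd 1 ^ i) := by
      rw [map_zpow]; rfl
    have h3 : e.symm ((QuaternionGroup.a 1 : QuaternionGroup n) ^ i) = e.symm (.xa 0) := by
      rw [map_zpow]; exact hi
    rw [e.symm.injective.eq_iff, h1] at h3
    cases h3
  · rw [eq_top_iff]
    intro g _
    rw [← e.symm_apply_apply g]
    have ha : ∀ i : ZMod (2 * n), e.symm (.a i) ∈
        Subgroup.closure {e.symm (.a 1), e.symm (.xa 0)} := by
      intro i
      have : (QuaternionGroup.a i : QuaternionGroup n) = .a 1 ^ i.val := by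
        rw [hone, ZMod.natCast_zmod_val]
      rw [this, map_pow]
      exact Subgroup.pow_mem _ (Subgroup.subset_closure (by simp)) _
    rcases e g with i | i
    · exact ha i
    · have : (QuaternionGroup.xa i : QuaternionGroup n) = .xa 0 * .a i := by simp
      rw [this, map_mul]
      exact Subgroup.mul_mem _ (Subgroup.subset_closure (by simp)) (ha i)

/-- Elements outside the cyclic subgroup have order four. This separates dihedral from polyhedral
groups, whose standard generators have nontrivial fourth powers and do not commute. -/
theorem QuaternionGroup.commute_of_pow_four {n : ℕ} [NeZero n] {x y : QuaternionGroup n}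
    (hx : x ^ 4 ≠ 1) (hy : y ^ 4 ≠ 1) : x * y = y * x := by
  rcases x with i | i
  · rcases y with j | j
    · simp [add_comm]
    · exact absurd (by rw [← QuaternionGroup.orderOf_xa j, pow_orderOf_eq_one]) hy
  · exact absurd (by rw [← QuaternionGroup.orderOf_xa i, pow_orderOf_eq_one]) hx

end Dicyclic

/-! ### Invariance of types, and orders of standard generators. -/

theorem HasType.congr {G H : Type} [Group G] [Group H] {τ : SubgroupType} (e : G ≃* H)
    (h : HasType G τ) : HasType H τ := by
  cases τ <;> exact h.map e.symm.trans

theorem HasType.nonempty_mulEquiv {G H : Type} [Group G] [Group H] {τ : SubgroupType}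
    (hG : HasType G τ) (hH : HasType H τ) : Nonempty (G ≃* H) := by
  cases τ <;> exact ⟨(Classical.choice hG).trans (Classical.choice hH).symm⟩

section PolyPair

variable {K : Type*} [Field K] {k : ℕ} {s t : SL(2, K)}

theorem IsPolyPair.hk (h : IsPolyPair k s t) : k = 3 ∨ k = 4 ∨ k = 5 := by
  rcases h.trace_right with h | h | h
  exacts [Or.inl h.1, Or.inr (Or.inl h.1), Or.inr (Or.inr h.1)]

theorem IsPolyPair.not_commute (h2 : (2 : K) ≠ 0) (h : IsPolyPair k s t) : s * t ≠ t * s :=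
  (tracePair_of_traces h.trace_left rfl h.trace_mul).not_commute (h.trace_right.sq_ne_three h2)

theorem IsPolyPair.right_ne (h2 : (2 : K) ≠ 0) (h : IsPolyPair k s t) : t ≠ 1 ∧ t ≠ -1 := by
  constructor <;> (rintro rfl; apply h.not_commute h2; simp)

theorem IsPolyPair.left_ne (h2 : (2 : K) ≠ 0) (h : IsPolyPair k s t) : s ≠ 1 ∧ s ≠ -1 := by
  constructor <;> (rintro rfl; apply h.not_commute h2; simp)

theorem IsPolyPair.orderOf_right (h2 : (2 : K) ≠ 0) (h : IsPolyPair k s t) :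
    orderOf t = 2 * k :=
  h.trace_right.orderOf_eq h2 h.hk (h.right_ne h2).1 (h.right_ne h2).2

theorem IsPolyPair.orderOf_left (h2 : (2 : K) ≠ 0) (h : IsPolyPair k s t) : orderOf s = 6 :=
  IsPolyTrace.orderOf_eq h2 (Or.inl rfl) (h.left_ne h2).1 (h.left_ne h2).2
    (Or.inl ⟨rfl, h.trace_left⟩)

theorem IsPolyPair.pow_four_ne (h2 : (2 : K) ≠ 0) (h : IsPolyPair k s t) :
    s ^ 4 ≠ 1 ∧ t ^ 4 ≠ 1 := by
  constructor <;> intro h4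
  · have := orderOf_dvd_of_pow_eq_one h4
    rw [h.orderOf_left h2] at this
    omega
  · have := Nat.le_of_dvd (by norm_num) (orderOf_dvd_of_pow_eq_one h4)
    rw [h.orderOf_right h2] at this
    have := h.hk
    omega

end PolyPair

theorem HasType.mul_comm_of_pow_four {G : Type} [Group G] {τ : SubgroupType}
    (hτ : (∃ n, τ = .C n) ∨ ∃ n, n ≠ 0 ∧ τ = .twoD n) (h : HasType G τ) {x y : G}
    (hx : x ^ 4 ≠ 1) (hy : y ^ 4 ≠ 1) : x * y = y * x := by
  rcases hτ with ⟨n, rfl⟩ | ⟨n, hn, rfl⟩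
  · obtain ⟨e⟩ := h
    exact e.injective (by rw [map_mul, map_mul, mul_comm])
  · obtain ⟨e⟩ := h
    have : NeZero n := ⟨hn⟩
    apply e.injective
    rw [map_mul, map_mul]
    refine QuaternionGroup.commute_of_pow_four ?_ ?_
    · rw [← map_pow]; exact fun h => hx (e.injective (h.trans (map_one e).symm))
    · rw [← map_pow]; exact fun h => hy (e.injective (h.trans (map_one e).symm))

/-! ### Every subgroup of order prime to `p` has one of the five types. -/

section Classification

variable {p : ℕ} [Fact p.Prime] {H : Subgroup SL(2, ZMod p)}

theorem eq_one_or_eq_neg_one_of_mem_map (hp : 3 < p) (hc : (Nat.card H).Coprime p) :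
    ∀ h ∈ H.map (baseChange p),
      (h : Matrix (Fin 2) (Fin 2) (AlgebraicClosure (ZMod p))).trace ^ 2 = 4 →
        h = 1 ∨ h = -1 := by
  rintro _ ⟨h, hh, rfl⟩ htr
  refine eq_one_or_eq_neg_one_of_trace p (two_ne_zero_closure hp) ?_ htr
  rw [orderOf_injective _ baseChange_injective]
  exact hc.coprime_dvd_left (Subgroup.orderOf_dvd_natCard H hh)

theorem card_map_baseChange (H : Subgroup SL(2, ZMod p)) :
    Nat.card (H.map (baseChange p)) = Nat.card H :=
  Nat.card_congr (H.equivMapOfInjective _ baseChange_injective).symm.toEquiv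

/-- Axes need eigenvalues, so the orbit classification is applied to the image of `H` over an
algebraic closure and then carried back along the injection. -/
theorem isCyclic_or_dicyclic_or_polyhedral (hp : 3 < p) (hc : (Nat.card H).Coprime p) :
    IsCyclic H ∨ (∃ n, 2 ≤ n ∧ ∃ a b, IsDicyclicPair n a b ∧ Subgroup.closure {a, b} = H) ∨
      ∃ k, IsPolyhedral (H.map (baseChange p)) k := by
  have h2 := two_ne_zero_closure hp
  have h2' := two_ne_zero_zmod hp
  have hss := eq_one_or_eq_neg_one_of_mem_map hp hc
  set H' := H.map (baseChange p) with hH'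
  let E : H ≃* H' := H.equivMapOfInjective _ baseChange_injective
  have hE : ∀ h : H, (E h : SL(2, AlgebraicClosure (ZMod p))) = baseChange p h := fun h => rfl
  have : Finite H' := Finite.of_equiv _ E.toEquiv
  have := finite_axes h2 hss
  rcases axes_classification h2 hss with h | ⟨x, hx⟩ | h
  · left
    have hcen : ∀ g : H, g = 1 ∨ (g : SL(2, ZMod p)) = -1 := by
      intro g
      rcases h _ (E g).2 with h1 | h1
      · left; apply E.injective; apply Subtype.ext; rw [h1]; simp
      · right; apply baseChange_injective; rw [baseChange_neg_one]; exact h1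
    by_cases hex : ∃ g : H, g ≠ 1
    · obtain ⟨g, hg⟩ := hex
      refine ⟨g, fun g' => ?_⟩
      rcases hcen g' with h1 | h1
      · rw [h1]; exact Subgroup.one_mem (Subgroup.zpowers g)
      · have : g' = g := Subtype.ext (h1.trans ((hcen g).resolve_left hg).symm)
        rw [this]; exact Subgroup.mem_zpowers g
    · push Not at hex
      exact ⟨1, fun g' => by rw [hex g']; exact Subgroup.one_mem (Subgroup.zpowers 1)⟩
  · left
    have hcyc := isCyclic_stabilizer h2 x
    have htop : MulAction.stabilizer H' x = ⊤ := by
      rw [eq_top_iff]; exact fun h _ => hx h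
    rw [htop] at hcyc
    let e : (⊤ : Subgroup H') ≃* H := Subgroup.topEquiv.trans E.symm
    exact isCyclic_of_surjective e e.surjective
  · right
    rcases h.dihedral_or_polyhedral h2 with ⟨n, hn, hcard, x, hx⟩ | h
    · left
      obtain ⟨a, b, ha, hab, hb, hne⟩ := exists_dihedral_generators h2 hn hx hcard
      obtain ⟨a, rfl⟩ := E.surjective a
      obtain ⟨b, rfl⟩ := E.surjective b
      have ha' : orderOf (a : SL(2, ZMod p)) = 2 * n := by
        rw [Subgroup.orderOf_coe, ← MulEquiv.orderOf_eq E, ha]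
      have hD : IsDicyclicPair n (a : SL(2, ZMod p)) b := by
        refine ⟨ha', ?_, ?_, ?_⟩
        · rw [← map_inv, ← map_inv, ← map_mul, ← map_mul, E.injective.eq_iff] at hab
          exact congrArg Subtype.val hab
        · rw [pow_half_eq_neg_one h2' (by omega) ha', ← pow_two]
          apply baseChange_injective
          rw [map_pow, baseChange_neg_one, ← hE, hb]
        · intro h
          rw [← mem_powers_iff_mem_zpowers] at h
          obtain ⟨i, hi⟩ := h
          apply hne i
          rw [← map_pow, E.injective.eq_iff]
          exact Subtype.ext hi
      refine ⟨n, hn, a, b, hD, ?_⟩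
      have : NeZero n := ⟨by omega⟩
      obtain ⟨e⟩ := hD.nonempty_mulEquiv
      refine Subgroup.eq_of_le_of_card_ge ?_ (le_of_eq ?_)
      · rw [Subgroup.closure_le]
        rintro _ (rfl | rfl)
        exacts [a.2, b.2]
      · rw [Nat.card_congr e.toEquiv, ← card_map_baseChange H, hcard,
          Nat.card_eq_fintype_card (α := QuaternionGroup n), QuaternionGroup.card]
    · right; exact h

theorem IsPolyhedral.exists_isPolyPair (hp : 3 < p) (hc : (Nat.card H).Coprime p) {k : ℕ}
    (hP : IsPolyhedral (H.map (baseChange p)) k) : ∃ s ∈ H, ∃ t ∈ H, IsPolyPair k s t := by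
  have h2 := two_ne_zero_closure hp
  have hss := eq_one_or_eq_neg_one_of_mem_map hp hc
  have : Finite (H.map (baseChange p)) :=
    Finite.of_equiv _ (H.equivMapOfInjective _ baseChange_injective).toEquiv
  obtain ⟨⟨_, s, hs, rfl⟩, ⟨_, t, ht, rfl⟩, h1, h3, h4⟩ := hP.exists_pair h2 hss
  have hinj := (algebraMap (ZMod p) (AlgebraicClosure (ZMod p))).injective
  refine ⟨s, hs, t, ht, ?_, ?_, ?_⟩
  · rw [trace_baseChange] at h1
    exact hinj (by rw [h1, map_one])
  · rw [trace_baseChange] at h3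
    rcases h3 with ⟨hk, h⟩ | ⟨hk, h⟩ | ⟨hk, h⟩
    · exact Or.inl ⟨hk, hinj (by rw [h, map_one])⟩
    · exact Or.inr (Or.inl ⟨hk, hinj (by rw [map_pow, h, map_ofNat])⟩)
    · exact Or.inr (Or.inr ⟨hk, hinj (by rw [map_pow, h, map_add, map_one])⟩)
  · rw [Subgroup.coe_mul, ← map_mul, trace_baseChange] at h4
    exact hinj (by rw [h4, map_zero])

theorem IsPolyTrace.exists_isPolyPair (hp : 3 < p) {k : ℕ} {τ : ZMod p} (h : IsPolyTrace k τ) :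
    ∃ s t : SL(2, ZMod p), IsPolyPair k s t ∧
      (t : Matrix (Fin 2) (Fin 2) (ZMod p)).trace = τ := by
  have h2 := two_ne_zero_zmod hp
  have h3 : (3 : ZMod p) ≠ 0 := by
    intro h
    have : ((3 : ℕ) : ZMod p) = 0 := by exact_mod_cast h
    rw [ZMod.natCast_eq_zero_iff] at this
    have := Nat.le_of_dvd (by norm_num) this
    omega
  obtain ⟨s, t, hs, ht, hst⟩ := exists_pair_with_traces h2 (x := (1 : ZMod p)) (by
    intro h; apply h3; linear_combination -h) τ 0
  exact ⟨s, t, ⟨hs, by rw [ht]; exact h, hst⟩, ht⟩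

theorem five_le (hp : 3 < p) : 5 ≤ p := by
  have : p ≠ 4 := by
    rintro rfl
    exact absurd (Fact.out : Nat.Prime 4) (by norm_num)
  omega

theorem HasType.exists_injective {q : ℕ} [Fact q.Prime] (hq : 3 < q) {k : ℕ} {τ : ZMod q}
    (hτ : IsPolyTrace k τ) {G : Type} [Group G] (hG : HasType G (polyType k)) :
    ∃ f : G →* SL(2, ZMod q), Function.Injective f := by
  obtain ⟨s, t, hst, -⟩ := hτ.exists_isPolyPair hq
  obtain ⟨e⟩ := hG.nonempty_mulEquiv (hst.hasType (five_le hq))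
  exact ⟨(Subgroup.subtype _).comp e.toMonoidHom, (Subgroup.subtype_injective _).comp e.injective⟩

theorem HasType.card_dvd {q : ℕ} [Fact q.Prime] (hq : 3 < q) {k : ℕ} {τ : ZMod q}
    (hτ : IsPolyTrace k τ) {G : Type} [Group G] (hG : HasType G (polyType k)) :
    Nat.card G ∣ (q ^ 2 - 1) * (q ^ 2 - q) := by
  obtain ⟨f, hf⟩ := hG.exists_injective hq hτ
  have hcard : Nat.card (GL (Fin 2) (ZMod q)) = (q ^ 2 - 1) * (q ^ 2 - q) := by
    rw [Matrix.card_GL_field]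
    simp [Fin.prod_univ_two]
  rw [← hcard]
  let g : G →* GL (Fin 2) (ZMod q) := Matrix.SpecialLinearGroup.toGL.comp f
  exact Subgroup.card_dvd_of_injective g (Matrix.SpecialLinearGroup.toGL_injective.comp hf)

/-- The quaternion groups embed in `SL₂(𝔽_q)` whenever `𝔽_q` contains the required trace, so their
orders divide `|GL₂(𝔽_q)|`. A few small `q` leave only the prime factors `2`, `3`, and `5` for
`2A₅`. -/
theorem HasType.card_coprime (hp : 3 < p) {k : ℕ} (hk : k = 3 ∨ k = 4 ∨ k = 5)
    (hk5 : k = 5 → p ≠ 5) {G : Type} [Group G] (hG : HasType G (polyType k)) :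
    (Nat.card G).Coprime p := by
  have hpp : p.Prime := Fact.out
  have e7 : (3 : ZMod 7) ^ 2 = 2 := by decide
  have e17 : (6 : ZMod 17) ^ 2 = 2 := by decide
  have e5 : (3 : ZMod 5) ^ 2 = 3 + 1 := by decide
  have : Fact (Nat.Prime 5) := ⟨by norm_num⟩
  have : Fact (Nat.Prime 7) := ⟨by norm_num⟩
  have : Fact (Nat.Prime 17) := ⟨by norm_num⟩
  rw [Nat.coprime_comm, hpp.coprime_iff_not_dvd]
  intro hd
  have h23 : ∀ a b c : ℕ, p ∣ 2 ^ a * 3 ^ b * c → p ∣ c := by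
    intro a b c h
    rcases hpp.dvd_mul.1 h with h | h
    · rcases hpp.dvd_mul.1 h with h | h
      · have := Nat.le_of_dvd (by norm_num) (hpp.dvd_of_dvd_pow h); omega
      · have := Nat.le_of_dvd (by norm_num) (hpp.dvd_of_dvd_pow h); omega
    · exact h
  rcases hk with rfl | rfl | rfl
  · have h5 := hG.card_dvd (q := 5) (by norm_num) (τ := 1) (Or.inl ⟨rfl, rfl⟩)
    have h7 := hG.card_dvd (q := 7) (by norm_num) (τ := 1) (Or.inl ⟨rfl, rfl⟩)
    have := hd.trans (Nat.dvd_gcd h5 h7)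
    have := Nat.le_of_dvd (by norm_num) (h23 5 1 1 (by norm_num at this ⊢; exact this))
    omega
  · have h5 := hG.card_dvd (q := 7) (by norm_num) (τ := 3) (Or.inr (Or.inl ⟨rfl, e7⟩))
    have h7 := hG.card_dvd (q := 17) (by norm_num) (τ := 6) (Or.inr (Or.inl ⟨rfl, e17⟩))
    have := hd.trans (Nat.dvd_gcd h5 h7)
    have := Nat.le_of_dvd (by norm_num) (h23 5 2 1 (by norm_num at this ⊢; exact this))
    omega
  · have h5 := hG.card_dvd (q := 5) (by norm_num) (τ := 3) (Or.inr (Or.inr ⟨rfl, e5⟩))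
    have := h23 5 1 5 (by norm_num; exact hd.trans h5)
    exact hk5 rfl ((Nat.prime_dvd_prime_iff_eq hpp (by norm_num)).1 this)

/-- The group `2A₄` embeds in `SL₂(𝔽₅)` and `SL₂(𝔽₇)`. Order `8` divides neither `4` nor `6`, and
order `10` divides neither `6` nor `8`. -/
theorem HasType.not_exists_orderOf_three {G : Type} [Group G] (hG : HasType G (polyType 3)) (x : G)
    : orderOf x ≠ 8 ∧ orderOf x ≠ 10 := by
  have : Fact (Nat.Prime 5) := ⟨by norm_num⟩
  have : Fact (Nat.Prime 7) := ⟨by norm_num⟩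
  constructor
  · intro hx
    obtain ⟨f, hf⟩ := hG.exists_injective (q := 5) (by norm_num) (τ := 1) (Or.inl ⟨rfl, rfl⟩)
    rw [← orderOf_injective f hf] at hx
    have := congPM_orderOf (p := 5) (by norm_num) (g := f x) (by rw [hx]; norm_num)
    rw [hx, congPM_iff] at this
    omega
  · intro hx
    obtain ⟨f, hf⟩ := hG.exists_injective (q := 7) (by norm_num) (τ := 1) (Or.inl ⟨rfl, rfl⟩)
    rw [← orderOf_injective f hf] at hx
    have := congPM_orderOf (p := 7) (by norm_num) (g := f x) (by rw [hx]; norm_num)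
    rw [hx, congPM_iff] at this
    omega

/-- The group generated by a polyhedral pair is polyhedral of the expected kind. -/
theorem IsPolyPair.isPolyhedral (hp : 3 < p) {k : ℕ} {s t : SL(2, ZMod p)}
    (h : IsPolyPair k s t) (hc : (Nat.card (Subgroup.closure {s, t})).Coprime p) :
    IsPolyhedral ((Subgroup.closure {s, t}).map (baseChange p)) k := by
  have h2 := two_ne_zero_closure hp
  have h2' := two_ne_zero_zmod hp
  have hss := eq_one_or_eq_neg_one_of_mem_map hp hc
  have hty := h.hasType (five_le hp)
  set H := Subgroup.closure {s, t} with hH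
  let S : H := ⟨s, Subgroup.subset_closure (by simp)⟩
  let T : H := ⟨t, Subgroup.subset_closure (by simp)⟩
  have hST : S * T ≠ T * S := fun h' => h.not_commute h2' (congrArg Subtype.val h')
  have hS4 : S ^ 4 ≠ 1 := fun h' => (h.pow_four_ne h2').1 (congrArg Subtype.val h')
  have hT4 : T ^ 4 ≠ 1 := fun h' => (h.pow_four_ne h2').2 (congrArg Subtype.val h')
  rcases isCyclic_or_dicyclic_or_polyhedral hp hc with hcyc | ⟨n, hn, a, b, hab, hcl⟩ | ⟨k', hP⟩
  · have hty : HasType H (.C (Nat.card H)) := ⟨(zmodCyclicMulEquiv hcyc).symm⟩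
    exact absurd (hty.mul_comm_of_pow_four (Or.inl ⟨_, rfl⟩) hS4 hT4) hST
  · have : NeZero n := ⟨by omega⟩
    have hty : HasType H (.twoD n) := by
      rw [← hcl]; exact hab.nonempty_mulEquiv
    exact absurd (hty.mul_comm_of_pow_four (Or.inr ⟨n, by omega, rfl⟩) hS4 hT4) hST
  -- For `k = 4, 5` the element `t` of order `2k` lies in a stabilizer of order `4`, `6` or `2k'`,
  -- so `k' = k`. For `k = 3` a larger `k'` would give an element of order `8` or `10` in `2A₄`.
  · suffices k' = k by rw [← this]; exact hP
    let E : H ≃* H.map (baseChange p) := H.equivMapOfInjective _ baseChange_injective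
    have hfin : Finite (H.map (baseChange p)) := Finite.of_equiv _ E.toEquiv
    have hT1 : ((E T : H.map (baseChange p)) : SL(2, AlgebraicClosure (ZMod p))) ≠ 1 := by
      intro h'
      apply (h.right_ne h2').1
      apply baseChange_injective
      rw [map_one]; exact h'
    have hTm1 : ((E T : H.map (baseChange p)) : SL(2, AlgebraicClosure (ZMod p))) ≠ -1 := by
      intro h'
      apply (h.right_ne h2').2
      apply baseChange_injective
      rw [baseChange_neg_one]; exact h'
    obtain ⟨x, hx⟩ := exists_mem_axes hss hT1 hTm1
    have hdvd : 2 * k ∣ Nat.card (MulAction.stabilizer (H.map (baseChange p)) x) := by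
      have h3 : E T ∈ MulAction.stabilizer (H.map (baseChange p)) x := hx
      have := Subgroup.orderOf_dvd_natCard _ h3
      rwa [MulEquiv.orderOf_eq, ← Subgroup.orderOf_coe, h.orderOf_right h2'] at this
    have hex : ∃ z : H, orderOf z = 2 * k' := by
      obtain ⟨y, hy⟩ := hP.exists_max
      have := isCyclic_stabilizer h2 y
      obtain ⟨g, hg⟩ := IsCyclic.exists_generator
        (α := MulAction.stabilizer (H.map (baseChange p)) y)
      refine ⟨E.symm g, ?_⟩
      rw [MulEquiv.orderOf_eq, Subgroup.orderOf_coe, orderOf_eq_card_of_forall_mem_zpowers hg, hy]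
    obtain ⟨z, hz⟩ := hex
    have hk' := hP.hk
    rcases h.hk with rfl | rfl | rfl
    · obtain ⟨h8, h10⟩ := hty.not_exists_orderOf_three z
      omega
    · rcases hP.card_stabilizer x with h3 | h3 | h3 <;> rw [h3] at hdvd <;> omega
    · rcases hP.card_stabilizer x with h3 | h3 | h3 <;> rw [h3] at hdvd <;> omega

theorem IsPolyhedral.card_eq_card {K : Type*} [Field K] {H H' : Subgroup SL(2, K)} {k : ℕ}
    (h : IsPolyhedral H k) (h' : IsPolyhedral H' k) : Nat.card H = Nat.card H' := by
  have h1 := h.card_eq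
  have h2 := h'.card_eq
  rcases h.hk with rfl | rfl | rfl <;> omega

/-- A standard pair inside `H` generates a polyhedral subgroup with the same `k`. The order depends
only on `k`, so this subgroup is all of `H`. -/
theorem IsPolyhedral.exists_closure_eq (hp : 3 < p) (hc : (Nat.card H).Coprime p) {k : ℕ}
    (hP : IsPolyhedral (H.map (baseChange p)) k) :
    ∃ s t, IsPolyPair k s t ∧ Subgroup.closure {s, t} = H := by
  obtain ⟨s, hs, t, ht, hst⟩ := hP.exists_isPolyPair hp hc
  have hle : Subgroup.closure {s, t} ≤ H := by
    rw [Subgroup.closure_le]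
    rintro _ (rfl | rfl)
    exacts [hs, ht]
  have hP' := hst.isPolyhedral hp (hc.coprime_dvd_left (Subgroup.card_dvd_of_le hle))
  refine ⟨s, t, hst, Subgroup.eq_of_le_of_card_ge hle (le_of_eq ?_)⟩
  rw [← card_map_baseChange, hP.card_eq_card hP', card_map_baseChange]

/-- Every subgroup of order prime to `p` has one of the five types. -/
theorem exists_hasType (hp : 3 < p) (hc : (Nat.card H).Coprime p) :
    HasType H (.C (Nat.card H)) ∨ (∃ n, 2 ≤ n ∧ HasType H (.twoD n)) ∨
      ∃ k, (k = 3 ∨ k = 4 ∨ k = 5) ∧ HasType H (polyType k) := by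
  rcases isCyclic_or_dicyclic_or_polyhedral hp hc with hcyc | ⟨n, hn, a, b, hab, hcl⟩ | ⟨k, hP⟩
  · left
    exact ⟨(zmodCyclicMulEquiv hcyc).symm⟩
  · right; left
    have : NeZero n := ⟨by omega⟩
    refine ⟨n, hn, ?_⟩
    rw [← hcl]; exact hab.nonempty_mulEquiv
  · right; right
    obtain ⟨s, t, hst, rfl⟩ := hP.exists_closure_eq hp hc
    exact ⟨k, hst.hk, hst.hasType (five_le hp)⟩

end Classification

/-! ### Congruence conditions and disjointness of the types. -/

section Listed

variable {p : ℕ} [Fact p.Prime]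

theorem CongPM.of_dvd {m n : ℕ} (hmn : m ∣ n) (h : CongPM p n) : CongPM p m := by
  rw [congPM_iff] at h ⊢
  exact h.imp hmn.trans hmn.trans

theorem CongPM.mul_two (hp : 3 < p) {n : ℕ} (hn : Odd n) (h : CongPM p n) :
    CongPM p (2 * n) := by
  obtain ⟨m, hm⟩ : Odd p := (Fact.out : p.Prime).odd_of_ne_two (by omega)
  rw [congPM_iff] at h ⊢
  have hc : Nat.Coprime 2 n := (Nat.coprime_two_left).2 hn
  exact h.imp (fun h => hc.mul_dvd_of_dvd_of_dvd ⟨m, by omega⟩ h)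
    (fun h => hc.mul_dvd_of_dvd_of_dvd ⟨m + 1, by omega⟩ h)

theorem Listed.cases {τ : SubgroupType} (h : Listed p τ) :
    (∃ n, 1 ≤ n ∧ τ = .C n) ∨ (∃ n, 2 ≤ n ∧ τ = .twoD n) ∨
      ∃ k, (k = 3 ∨ k = 4 ∨ k = 5) ∧ τ = polyType k := by
  cases τ with
  | C n => exact Or.inl ⟨n, h.1, rfl⟩
  | twoD n => exact Or.inr (Or.inl ⟨n, by have := h.1; omega, rfl⟩)
  | twoA4 => exact Or.inr (Or.inr ⟨3, by simp, rfl⟩)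
  | twoS4 => exact Or.inr (Or.inr ⟨4, by simp, rfl⟩)
  | twoA5 => exact Or.inr (Or.inr ⟨5, by simp, rfl⟩)

theorem listed_C (hp : 3 < p) {H : Subgroup SL(2, ZMod p)} (hc : (Nat.card H).Coprime p) {n : ℕ}
    (hn : 1 ≤ n) (h : HasType H (.C n)) : Listed p (.C n) := by
  obtain ⟨e⟩ := h
  have : NeZero n := ⟨by omega⟩
  refine ⟨hn, ?_⟩
  have h1 : orderOf (e.symm (Multiplicative.ofAdd 1)) = n := by
    rw [MulEquiv.orderOf_eq, orderOf_ofAdd_eq_addOrderOf, ZMod.addOrderOf_one]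
  have h2 := congPM_orderOf hp (g := (e.symm (Multiplicative.ofAdd 1) : SL(2, ZMod p)))
    (hc.coprime_dvd_left (Subgroup.orderOf_dvd_natCard H (Subtype.prop _)))
  rwa [Subgroup.orderOf_coe, h1] at h2

theorem listed_twoD (hp : 3 < p) {H : Subgroup SL(2, ZMod p)} (hc : (Nat.card H).Coprime p) {n : ℕ}
    (hn : 2 ≤ n) (h : HasType H (.twoD n)) : Listed p (.twoD n) := by
  obtain ⟨e⟩ := h
  have : NeZero n := ⟨by omega⟩
  obtain ⟨a, b, hab, -⟩ := exists_isDicyclicPair e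
  refine ⟨by omega, ?_⟩
  have h2 := congPM_orderOf hp (g := (a : SL(2, ZMod p)))
    (hc.coprime_dvd_left (Subgroup.orderOf_dvd_natCard H (Subtype.prop _)))
  rwa [Subgroup.orderOf_coe, hab.orderOf_eq] at h2

theorem congPM_of_hasType_polyType (hp : 3 < p) {H : Subgroup SL(2, ZMod p)}
    (hc : (Nat.card H).Coprime p) {k : ℕ} (hk : k = 3 ∨ k = 4 ∨ k = 5)
    (h : HasType H (polyType k)) : CongPM p (2 * k) := by
  have h2 := two_ne_zero_zmod hp
  obtain ⟨s, t, hst, rfl⟩ := exists_isPolyPair_of_hasType h2 hk h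
  have h3 := congPM_orderOf hp (g := t)
    (hc.coprime_dvd_left (Subgroup.orderOf_dvd_natCard _ (Subgroup.subset_closure (by simp))))
  rwa [hst.orderOf_right h2] at h3

theorem exists_listed (hp : 3 < p) {H : Subgroup SL(2, ZMod p)} (hc : (Nat.card H).Coprime p) :
    ∃ τ, Listed p τ ∧ HasType H τ := by
  rcases exists_hasType hp hc with h | ⟨n, hn, h⟩ | ⟨k, hk, h⟩
  · exact ⟨_, listed_C hp hc Nat.card_pos h, h⟩
  · exact ⟨_, listed_twoD hp hc hn h, h⟩
  · refine ⟨_, ?_, h⟩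
    have h1 := congPM_of_hasType_polyType hp hc hk h
    rcases hk with rfl | rfl | rfl
    · trivial
    · exact h1
    · exact CongPM.of_dvd (by norm_num) h1

theorem HasType.card_C {G : Type} [Group G] {n : ℕ} (h : HasType G (.C n)) : Nat.card G = n := by
  obtain ⟨e⟩ := h
  rw [Nat.card_congr e.toEquiv, Nat.card_congr Multiplicative.toAdd, Nat.card_zmod]

theorem HasType.card_twoD {G : Type} [Group G] {n : ℕ} (hn : n ≠ 0) (h : HasType G (.twoD n)) :
    Nat.card G = 4 * n := by
  obtain ⟨e⟩ := h
  have : NeZero n := ⟨hn⟩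
  rw [Nat.card_congr e.toEquiv, Nat.card_eq_fintype_card, QuaternionGroup.card]

theorem HasType.not_C_and_twoD {G : Type} [Group G] {m n : ℕ} (hn : 2 ≤ n) (h : HasType G (.C m))
    (h' : HasType G (.twoD n)) : False := by
  obtain ⟨e⟩ := h
  obtain ⟨e'⟩ := h'
  have h1 : ∀ x y : QuaternionGroup n, x * y = y * x := fun x y => by
    apply (e'.symm.trans e).injective
    rw [map_mul, map_mul, mul_comm]
  have h2 := h1 (.a 1) (.xa 0)
  rw [QuaternionGroup.a_mul_xa, QuaternionGroup.xa_mul_a, QuaternionGroup.xa.injEq] at h2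
  have h3 : ((2 : ℕ) : ZMod (2 * n)) = 0 := by push_cast; linear_combination -h2
  rw [ZMod.natCast_eq_zero_iff] at h3
  have := Nat.le_of_dvd (by norm_num) h3
  omega

theorem HasType.polyType_unique (hp : 3 < p) {H : Subgroup SL(2, ZMod p)}
    (hc : (Nat.card H).Coprime p) {k k' : ℕ} (hk : k = 3 ∨ k = 4 ∨ k = 5)
    (hk' : k' = 3 ∨ k' = 4 ∨ k' = 5) (h : HasType H (polyType k)) (h' : HasType H (polyType k')) :
    k = k' := by
  have h2 := two_ne_zero_zmod hp
  have key : ∀ {k : ℕ}, (k = 3 ∨ k = 4 ∨ k = 5) → HasType H (polyType k) →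
      Nat.card H * (6 - k) = 24 * k := by
    intro k hk h
    obtain ⟨s, t, hst, rfl⟩ := exists_isPolyPair_of_hasType h2 hk h
    rw [← card_map_baseChange]
    exact (hst.isPolyhedral hp hc).card_eq
  have e1 := key hk h
  have e2 := key hk' h'
  rcases hk with rfl | rfl | rfl <;> rcases hk' with rfl | rfl | rfl <;> omega

theorem HasType.not_polyType {K : Type} [Field K] (h2 : (2 : K) ≠ 0) {H : Subgroup SL(2, K)} {k : ℕ}
    (hk : k = 3 ∨ k = 4 ∨ k = 5) {τ : SubgroupType}
    (hτ : (∃ n, τ = .C n) ∨ ∃ n, n ≠ 0 ∧ τ = .twoD n) (h : HasType H τ) :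
    ¬ HasType H (polyType k) := by
  intro h'
  obtain ⟨s, t, hst, rfl⟩ := exists_isPolyPair_of_hasType h2 hk h'
  let S : Subgroup.closure {s, t} := ⟨s, Subgroup.subset_closure (by simp)⟩
  let T : Subgroup.closure {s, t} := ⟨t, Subgroup.subset_closure (by simp)⟩
  have := h.mul_comm_of_pow_four hτ (x := S) (y := T)
    (fun h' => (hst.pow_four_ne h2).1 (congrArg Subtype.val h'))
    (fun h' => (hst.pow_four_ne h2).2 (congrArg Subtype.val h'))
  exact hst.not_commute h2 (congrArg Subtype.val this)

theorem listed_unique (hp : 3 < p) {H : Subgroup SL(2, ZMod p)} (hc : (Nat.card H).Coprime p)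
    {τ τ' : SubgroupType} (h : Listed p τ) (h' : Listed p τ') (ht : HasType H τ)
    (ht' : HasType H τ') : τ = τ' := by
  have h2 := two_ne_zero_zmod hp
  rcases h.cases with ⟨n, hn, rfl⟩ | ⟨n, hn, rfl⟩ | ⟨k, hk, rfl⟩ <;>
    rcases h'.cases with ⟨m, hm, rfl⟩ | ⟨m, hm, rfl⟩ | ⟨k', hk', rfl⟩
  · rw [← ht.card_C, ← ht'.card_C]
  · exact (ht.not_C_and_twoD hm ht').elim
  · exact (ht.not_polyType h2 hk' (Or.inl ⟨n, rfl⟩) ht').elim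
  · exact (ht'.not_C_and_twoD hn ht).elim
  · have h3 := ht.card_twoD (by omega)
    have h4 := ht'.card_twoD (by omega)
    have : n = m := by omega
    rw [this]
  · exact (ht.not_polyType h2 hk' (Or.inr ⟨n, by omega, rfl⟩) ht').elim
  · exact (ht'.not_polyType h2 hk (Or.inl ⟨m, rfl⟩) ht).elim
  · exact (ht'.not_polyType h2 hk (Or.inr ⟨m, by omega, rfl⟩) ht).elim
  · rw [ht.polyType_unique hp hc hk hk' ht']

end Listed

/-! ### From `GL₂`-conjugacy to classes under `SL₂`. -/

section Counting

variable {C : Type*} [CommRing C]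

/-- The conjugate of a subgroup of `SL₂` by an element of `GL₂`. -/
def conjGL (g : GL (Fin 2) C) (H : Subgroup SL(2, C)) : Subgroup SL(2, C) :=
  H.map (glConj g).toMonoidHom

theorem glConj_one (h : SL(2, C)) : glConj 1 h = h := by
  rw [glConj_eq_iff]; simp

theorem conjGL_mul (g g' : GL (Fin 2) C) (H : Subgroup SL(2, C)) :
    conjGL (g * g') H = conjGL g (conjGL g' H) := by
  rw [conjGL, conjGL, conjGL, Subgroup.map_map]
  congr 1
  ext1 h
  exact glConj_mul g g' h

theorem conjGL_one (H : Subgroup SL(2, C)) : conjGL 1 H = H := by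
  ext h
  constructor
  · rintro ⟨x, hx, rfl⟩
    change glConj 1 x ∈ H
    rwa [glConj_one]
  · intro hh
    exact ⟨h, hh, glConj_one h⟩

theorem conjGL_inv_eq {g : GL (Fin 2) C} {H H' : Subgroup SL(2, C)} (h : conjGL g H = H') :
    conjGL g⁻¹ H' = H := by
  rw [← h, ← conjGL_mul, inv_mul_cancel, conjGL_one]

theorem conjGL_closure (g : GL (Fin 2) C) (s t : SL(2, C)) :
    conjGL g (Subgroup.closure {s, t}) = Subgroup.closure {glConj g s, glConj g t} := by
  rw [conjGL, MonoidHom.map_closure, Set.image_pair]; rfl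

theorem conjGL_zpowers (g : GL (Fin 2) C) (s : SL(2, C)) :
    conjGL g (Subgroup.zpowers s) = Subgroup.zpowers (glConj g s) := by
  rw [conjGL, MonoidHom.map_zpowers]; rfl

/-- A subgroup and its conjugate are isomorphic. -/
noncomputable def conjGLEquiv (g : GL (Fin 2) C) (H : Subgroup SL(2, C)) : H ≃* conjGL g H :=
  H.equivMapOfInjective _ (glConj g).injective

/-- Dividing `g` by a square root of its determinant does not change conjugation by `g`. -/
theorem exists_conjGL_eq_of_isSquare {K : Type*} [Field K] {g : GL (Fin 2) K}
    (hg : IsSquare (g : Matrix (Fin 2) (Fin 2) K).det) :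
    ∃ s : SL(2, K), ∀ H, conjGL g H = conjGL (s : GL (Fin 2) K) H := by
  obtain ⟨c, hc⟩ := hg
  have hdet : (g : Matrix (Fin 2) (Fin 2) K).det ≠ 0 := by
    rw [← Matrix.GeneralLinearGroup.val_det_apply]; exact Units.ne_zero _
  have hc0 : c ≠ 0 := by rintro rfl; simp at hc; exact hdet hc
  let s : SL(2, K) := ⟨c⁻¹ • (g : Matrix (Fin 2) (Fin 2) K), by
    rw [Matrix.det_smul, hc, Fintype.card_fin]; field_simp⟩
  refine ⟨s, fun H => ?_⟩
  have : ∀ h, glConj g h = glConj (s : GL (Fin 2) K) h := by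
    intro h
    rw [glConj_eq_iff]
    have h1 := (glConj_eq_iff (s : GL (Fin 2) K) h _).1 rfl
    have h2 : (((s : SL(2, K)) : GL (Fin 2) K) : Matrix (Fin 2) (Fin 2) K) =
      c⁻¹ • (g : Matrix (Fin 2) (Fin 2) K) := rfl
    rw [h2, smul_mul_assoc, mul_smul_comm] at h1
    exact (smul_right_injective _ (inv_ne_zero hc0)) h1
  rw [conjGL, conjGL]
  congr 1
  ext1 h
  exact this h

variable {p : ℕ} [Fact p.Prime]

theorem isSquare_mul_of_not_isSquare {a b : ZMod p} (ha : ¬ IsSquare a)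
    (hb : ¬ IsSquare b) : IsSquare (a * b) := by
  have hab : a * b ≠ 0 := mul_ne_zero (by rintro rfl; exact ha IsSquare.zero)
    (by rintro rfl; exact hb IsSquare.zero)
  rw [← quadraticChar_one_iff_isSquare hab, map_mul,
    (quadraticChar_neg_one_iff_not_isSquare).2 ha, (quadraticChar_neg_one_iff_not_isSquare).2 hb]
  norm_num

open scoped Pointwise in
theorem toConjAct_smul_eq (s : SL(2, ZMod p)) (H : Subgroup SL(2, ZMod p)) :
    ConjAct.toConjAct s • H = conjGL (s : GL (Fin 2) (ZMod p)) H := by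
  ext h
  constructor
  · rintro ⟨x, hx, rfl⟩
    exact ⟨x, hx, glConj_coe s x⟩
  · rintro ⟨x, hx, rfl⟩
    exact ⟨x, hx, (glConj_coe s x).symm⟩

theorem mk_eq_mk_iff (H H' : Subgroup SL(2, ZMod p)) :
    (Quotient.mk _ H : SL2SubgroupClass p) = Quotient.mk _ H' ↔
      ∃ s : SL(2, ZMod p), conjGL (s : GL (Fin 2) (ZMod p)) H' = H := by
  rw [Quotient.eq]
  constructor
  · rintro ⟨s, hs⟩
    exact ⟨ConjAct.ofConjAct s, by rw [← toConjAct_smul_eq]; exact hs⟩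
  · rintro ⟨s, hs⟩
    exact ⟨ConjAct.toConjAct s, by rw [← hs, ← toConjAct_smul_eq]⟩

/-- Given that all subgroups of this type are `GL₂`-conjugate, their `SL₂`-classes correspond to the
nonzero elements of `𝔽_p` modulo squares and modulo determinants of the normalizer, a group of order
at most two. -/
theorem numClasses_eq (hp : 3 < p) {τ : SubgroupType} {H₀ : Subgroup SL(2, ZMod p)}
    (hc : (Nat.card H₀).Coprime p) (h₀ : HasType H₀ τ)
    (htr : ∀ H : Subgroup SL(2, ZMod p), (Nat.card H).Coprime p → HasType H τ →
      ∃ g : GL (Fin 2) (ZMod p), conjGL g H₀ = H) :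
    ((∀ g : GL (Fin 2) (ZMod p), conjGL g H₀ = H₀ →
      IsSquare (g : Matrix (Fin 2) (Fin 2) (ZMod p)).det) → numClasses p τ = 2) ∧
    ((∃ g : GL (Fin 2) (ZMod p), conjGL g H₀ = H₀ ∧
      ¬ IsSquare (g : Matrix (Fin 2) (Fin 2) (ZMod p)).det) → numClasses p τ = 1) := by
  have hsq : ∀ g : GL (Fin 2) (ZMod p), IsSquare (g : Matrix (Fin 2) (Fin 2) (ZMod p)).det →
      ∀ H, (Quotient.mk _ (conjGL g H) : SL2SubgroupClass p) = Quotient.mk _ H := by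
    intro g hg H
    obtain ⟨s, hs⟩ := exists_conjGL_eq_of_isSquare hg
    exact (mk_eq_mk_iff _ _).2 ⟨s, (hs H).symm⟩
  have hmul : ∀ g g' : GL (Fin 2) (ZMod p),
      ¬ IsSquare (g : Matrix (Fin 2) (Fin 2) (ZMod p)).det →
      ¬ IsSquare (g' : Matrix (Fin 2) (Fin 2) (ZMod p)).det →
      IsSquare ((g * g'⁻¹ : GL (Fin 2) (ZMod p)) : Matrix (Fin 2) (Fin 2) (ZMod p)).det := by
    intro g g' hg hg'
    have h1 : (g : Matrix (Fin 2) (Fin 2) (ZMod p)).det =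
        ((g * g'⁻¹ : GL (Fin 2) (ZMod p)) : Matrix (Fin 2) (Fin 2) (ZMod p)).det *
          (g' : Matrix (Fin 2) (Fin 2) (ZMod p)).det := by
      rw [← Matrix.det_mul, ← Units.val_mul, inv_mul_cancel_right]
    by_contra hcon
    exact hg (h1 ▸ isSquare_mul_of_not_isSquare hcon hg')
  have hmem : ∀ g : GL (Fin 2) (ZMod p), (Quotient.mk _ (conjGL g H₀) : SL2SubgroupClass p) ∈
      {c : SL2SubgroupClass p | ∃ H : Subgroup SL(2, ZMod p),
        Quotient.mk _ H = c ∧ (Nat.card H).Coprime p ∧ HasType H τ} := fun g =>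
    ⟨_, rfl, by rwa [← Nat.card_congr (conjGLEquiv g H₀).toEquiv], h₀.congr (conjGLEquiv g H₀)⟩
  have hH₀ := hmem 1
  rw [conjGL_one] at hH₀
  constructor
  · intro hN
    obtain ⟨d, hd⟩ := FiniteField.exists_nonsquare (F := ZMod p) (by rw [ZMod.ringChar_zmod_n]; omega)
    have hd0 : d ≠ 0 := by rintro rfl; exact hd IsSquare.zero
    let D : GL (Fin 2) (ZMod p) := Matrix.GeneralLinearGroup.mkOfDetNeZero !![d, 0; 0, 1]
      (by simpa [Matrix.det_fin_two_of] using hd0)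
    have hD : ¬ IsSquare (D : Matrix (Fin 2) (Fin 2) (ZMod p)).det := by
      change ¬ IsSquare (!![d, 0; 0, 1] : Matrix (Fin 2) (Fin 2) (ZMod p)).det
      simpa [Matrix.det_fin_two_of] using hd
    have : {c : SL2SubgroupClass p | ∃ H : Subgroup SL(2, ZMod p),
        Quotient.mk _ H = c ∧ (Nat.card H).Coprime p ∧ HasType H τ} =
        {Quotient.mk _ H₀, Quotient.mk _ (conjGL D H₀)} := by
      ext c
      constructor
      · rintro ⟨H, rfl, hH, hHτ⟩
        obtain ⟨g, rfl⟩ := htr H hH hHτ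
        by_cases hg : IsSquare (g : Matrix (Fin 2) (Fin 2) (ZMod p)).det
        · left; exact hsq g hg _
        · right
          have := hsq _ (hmul g D hg hD) (conjGL D H₀)
          rwa [← conjGL_mul, inv_mul_cancel_right] at this
      · rintro (rfl | rfl)
        exacts [hH₀, hmem D]
    rw [numClasses, this, Set.ncard_pair]
    intro h
    rw [mk_eq_mk_iff] at h
    obtain ⟨s, hs⟩ := h
    rw [← conjGL_mul] at hs
    have := hN _ hs
    rw [Units.val_mul, Matrix.det_mul] at this
    apply hD
    have h1 : ((s : GL (Fin 2) (ZMod p)) : Matrix (Fin 2) (Fin 2) (ZMod p)).det = 1 := s.2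
    rwa [h1, one_mul] at this
  · rintro ⟨n, hn, hnd⟩
    have : {c : SL2SubgroupClass p | ∃ H : Subgroup SL(2, ZMod p),
        Quotient.mk _ H = c ∧ (Nat.card H).Coprime p ∧ HasType H τ} = {Quotient.mk _ H₀} := by
      ext c
      constructor
      · rintro ⟨H, rfl, hH, hHτ⟩
        obtain ⟨g, rfl⟩ := htr H hH hHτ
        by_cases hg : IsSquare (g : Matrix (Fin 2) (Fin 2) (ZMod p)).det
        · exact hsq g hg _
        · have := hsq _ (hmul g n hg hnd) (conjGL n H₀)
          rw [← conjGL_mul, inv_mul_cancel_right, hn] at this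
          exact this
      · rintro rfl
        exact hH₀
    rw [numClasses, this, Set.ncard_singleton]

end Counting

/-! ### Centralizers of noncommuting matrices. -/

section Centralizer

variable {K : Type*} [Field K]

/-- Matrices commute exactly when the vectors `(A 0 1, A 1 0, A 0 0 - A 1 1)` of their classes
modulo scalars have zero cross product. -/
theorem commute_fin_two_iff (A B : Matrix (Fin 2) (Fin 2) K) :
    A * B = B * A ↔ A 0 1 * B 1 0 = A 1 0 * B 0 1 ∧
      (A 0 0 - A 1 1) * B 0 1 = A 0 1 * (B 0 0 - B 1 1) ∧
      (A 0 0 - A 1 1) * B 1 0 = A 1 0 * (B 0 0 - B 1 1) := by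
  constructor
  · intro h
    have h00 := congrFun (congrFun h 0) 0
    have h01 := congrFun (congrFun h 0) 1
    have h10 := congrFun (congrFun h 1) 0
    simp only [Matrix.mul_apply, Fin.sum_univ_two] at h00 h01 h10
    refine ⟨?_, ?_, ?_⟩
    · linear_combination h00
    · linear_combination h01
    · linear_combination -h10
  · rintro ⟨h1, h2, h3⟩
    ext i j
    fin_cases i <;> fin_cases j <;> simp [Matrix.mul_apply, Fin.sum_univ_two]
    · linear_combination h1
    · linear_combination h2
    · linear_combination -h3
    · linear_combination -h1

/-- A matrix that commutes with two matrices which do not commute is scalar. -/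
theorem det_isSquare_of_commute {M A B : Matrix (Fin 2) (Fin 2) K} (hA : M * A = A * M)
    (hB : M * B = B * M) (hAB : A * B ≠ B * A) : IsSquare M.det := by
  rw [commute_fin_two_iff] at hA hB
  obtain ⟨a1, a2, a3⟩ := hA
  obtain ⟨b1, b2, b3⟩ := hB
  -- If the vector of `M` were nonzero, those of `A` and `B` would both be proportional to it, and
  -- `A`, `B` would commute.
  have key : ∀ c : K, (c = M 0 1 ∨ c = M 1 0 ∨ c = M 0 0 - M 1 1) → c = 0 := by
    intro c hc
    by_contra hc0
    apply hAB
    rw [commute_fin_two_iff]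
    refine ⟨mul_left_cancel₀ hc0 ?_, mul_left_cancel₀ hc0 ?_, mul_left_cancel₀ hc0 ?_⟩ <;>
      rcases hc with rfl | rfl | rfl
    · linear_combination A 0 1 * b1 - B 0 1 * a1
    · linear_combination A 1 0 * b1 - B 1 0 * a1
    · linear_combination A 0 1 * b3 - A 1 0 * b2 - (B 0 0 - B 1 1) * a1
    · linear_combination A 0 1 * b2 - B 0 1 * a2
    · linear_combination A 1 0 * b2 - B 0 1 * a3 + (B 0 0 - B 1 1) * a1
    · linear_combination (A 0 0 - A 1 1) * b2 - (B 0 0 - B 1 1) * a2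
    · linear_combination A 0 1 * b3 - B 1 0 * a2 - (B 0 0 - B 1 1) * a1
    · linear_combination A 1 0 * b3 - B 1 0 * a3
    · linear_combination (A 0 0 - A 1 1) * b3 - (B 0 0 - B 1 1) * a3
  have h1 := key _ (Or.inl rfl)
  have h3 := key _ (Or.inr (Or.inr rfl))
  refine ⟨M 0 0, ?_⟩
  rw [Matrix.det_fin_two, h1]
  linear_combination -M 0 0 * h3

end Centralizer

/-! ### Conjugacy and normalizers of polyhedral groups over `𝔽_p`. -/

section PolyPairConj

variable {K : Type*} [Field K] {k : ℕ} {s t : SL(2, K)}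

theorem neg_one_mem_of_isPolyPair (h : IsPolyPair k s t) : -1 ∈ Subgroup.closure {s, t} := by
  rw [← pow_three_of_trace h.trace_left]
  exact Subgroup.pow_mem _ (Subgroup.subset_closure (by simp)) 3

/-- A binary polyhedral group has a second pair of standard generators, in which the trace of
order `2k` is replaced by its conjugate. -/
theorem IsPolyPair.exists_conjugate (h : IsPolyPair k s t) {τ : K} (hτ : IsPolyTrace k τ) :
    ∃ s' ∈ Subgroup.closure {s, t}, ∃ t' ∈ Subgroup.closure {s, t},
      IsPolyPair k s' t' ∧ (t' : Matrix (Fin 2) (Fin 2) K).trace = τ := by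
  have hs : s ∈ Subgroup.closure {s, t} := Subgroup.subset_closure (by simp)
  have ht : t ∈ Subgroup.closure {s, t} := Subgroup.subset_closure (by simp)
  have hm1 := neg_one_mem_of_isPolyPair h
  by_cases he : (t : Matrix (Fin 2) (Fin 2) K).trace = τ
  · exact ⟨s, hs, t, ht, h, he⟩
  have key : k = 4 ∧ τ = -(t : Matrix (Fin 2) (Fin 2) K).trace ∨
      k = 5 ∧ τ = 1 - (t : Matrix (Fin 2) (Fin 2) K).trace := by
    rcases h.trace_right with ⟨rfl, h1⟩ | ⟨rfl, h1⟩ | ⟨rfl, h1⟩ <;>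
      rcases hτ with ⟨h0, h2⟩ | ⟨h0, h2⟩ | ⟨h0, h2⟩ <;> try omega
    · exact absurd (h1.trans h2.symm) he
    · left
      refine ⟨rfl, ?_⟩
      have : ((t : Matrix (Fin 2) (Fin 2) K).trace - τ) *
          ((t : Matrix (Fin 2) (Fin 2) K).trace + τ) = 0 := by linear_combination h1 - h2
      linear_combination (mul_eq_zero.1 this).resolve_left (sub_ne_zero.2 he)
    · right
      refine ⟨rfl, ?_⟩
      have : ((t : Matrix (Fin 2) (Fin 2) K).trace - τ) *
          ((t : Matrix (Fin 2) (Fin 2) K).trace + τ - 1) = 0 := by linear_combination h1 - h2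
      linear_combination (mul_eq_zero.1 this).resolve_left (sub_ne_zero.2 he)
  rcases key with ⟨rfl, h1⟩ | ⟨rfl, h1⟩
  · have htr : ((-t : SL(2, K)) : Matrix (Fin 2) (Fin 2) K).trace = τ := by
      rw [trace_neg_coe, h1]
    refine ⟨s, hs, -t, ?_, ⟨h.trace_left, by rw [htr]; exact hτ, ?_⟩, htr⟩
    · rw [← neg_one_mul]; exact Subgroup.mul_mem _ hm1 ht
    · rw [mul_neg, trace_neg_coe, h.trace_mul, neg_zero]
  · set c := (t : Matrix (Fin 2) (Fin 2) K).trace with hc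
    have hc5 : c ^ 2 = c + 1 := by
      rcases h.trace_right with ⟨h0, -⟩ | ⟨h0, -⟩ | ⟨-, h0⟩
      · omega
      · omega
      · exact h0
    have htp := tracePair_of_traces h.trace_left hc.symm h.trace_mul
    -- With `t' = -t²` of trace `1 - c` and `s' = u t'⁻¹`, the product `s' t' = u` has trace zero,
    -- and `tr s' = tr(u t²) = (c - 1) c = 1`.
    let u : SL(2, K) := s * s * t * s * s
    have hu : (u : Matrix (Fin 2) (Fin 2) K).trace = 0 :=
      htp.trace_word h.trace_left hc.symm h.trace_mul
    have hut : ((u * t : SL(2, K)) : Matrix (Fin 2) (Fin 2) K).trace = c - 1 :=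
      htp.trace_word_mul h.trace_left hc.symm h.trace_mul hc5
    have hmu : u ∈ Subgroup.closure {s, t} :=
      mul_mem (mul_mem (mul_mem (mul_mem hs hs) ht) hs) hs
    have ht2 : ((t ^ 2 : SL(2, K)) : Matrix (Fin 2) (Fin 2) K).trace = c ^ 2 - 2 := by
      have := trace_mul_pow_two 1 t
      rw [one_mul, one_mul, Matrix.SpecialLinearGroup.coe_one, Matrix.trace_one, ← hc] at this
      rw [this]; simp; ring
    have htr : ((-t ^ 2 : SL(2, K)) : Matrix (Fin 2) (Fin 2) K).trace = τ := by
      rw [trace_neg_coe, ht2, h1]; linear_combination -hc5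
    have hmt : -t ^ 2 ∈ Subgroup.closure {s, t} := by
      rw [← neg_one_mul]; exact mul_mem hm1 (pow_mem ht 2)
    refine ⟨u * (-t ^ 2)⁻¹, mul_mem hmu (inv_mem hmt), -t ^ 2, hmt, ⟨?_, ?_, ?_⟩, htr⟩
    · rw [trace_mul_inv, hu, zero_mul, mul_neg, trace_neg_coe, trace_mul_pow_two, hut, hu, ← hc]
      linear_combination hc5
    · rw [htr]; exact hτ
    · rw [inv_mul_cancel_right]; exact hu

variable {p : ℕ} [Fact p.Prime]

/-- Binary polyhedral groups of the same kind are conjugate under `GL₂`. -/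
theorem IsPolyPair.exists_conjGL_eq (hp : 3 < p) {k : ℕ} {s t s' t' : SL(2, ZMod p)}
    (h : IsPolyPair k s t) (h' : IsPolyPair k s' t')
    (hc : (Nat.card (Subgroup.closure {s, t})).Coprime p) :
    ∃ g : GL (Fin 2) (ZMod p),
      conjGL g (Subgroup.closure {s, t}) = Subgroup.closure {s', t'} := by
  have h2 := two_ne_zero_zmod hp
  obtain ⟨s₁, hs₁, t₁, ht₁, h₁, htr⟩ := h.exists_conjugate h'.trace_right
  have hle : Subgroup.closure {s₁, t₁} ≤ Subgroup.closure {s, t} := by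
    rw [Subgroup.closure_le]
    rintro _ (rfl | rfl)
    exacts [hs₁, ht₁]
  have hP := h.isPolyhedral hp hc
  have hP₁ := h₁.isPolyhedral hp (hc.coprime_dvd_left (Subgroup.card_dvd_of_le hle))
  have heq := Subgroup.eq_of_le_of_card_ge hle (le_of_eq (by
    rw [← card_map_baseChange, hP.card_eq_card hP₁, card_map_baseChange]))
  obtain ⟨g, hg, hg'⟩ := (tracePair_of_traces h₁.trace_left htr h₁.trace_mul).exists_conj
    (tracePair_of_traces h'.trace_left rfl h'.trace_mul) (h'.trace_right.sq_ne_three h2)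
  refine ⟨g, ?_⟩
  rw [← heq, conjGL_closure, (glConj_eq_iff g s₁ s').2 hg, (glConj_eq_iff g t₁ t').2 hg']

/-- The commutator `s t - t s` normalizes the group generated by `s` and `t`. -/
theorem IsPolyPair.exists_inverter (h2 : (2 : K) ≠ 0) (h : IsPolyPair k s t) :
    ∃ n : GL (Fin 2) K, glConj n s = s⁻¹ ∧ glConj n t = t⁻¹ ∧
      (n : Matrix (Fin 2) (Fin 2) K).det = 3 - (t : Matrix (Fin 2) (Fin 2) K).trace ^ 2 := by
  have htp := tracePair_of_traces h.trace_left rfl h.trace_mul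
  have hκ := h.trace_right.sq_ne_three h2
  set S := (s : Matrix (Fin 2) (Fin 2) K) with hS
  set T := (t : Matrix (Fin 2) (Fin 2) K) with hT
  set c := T.trace with hc
  have htr : (S * T - T * S).trace = 0 := by
    rw [Matrix.trace_sub, Matrix.trace_mul_comm, sub_self]
  -- A traceless matrix squares to minus its determinant, and the square of the commutator is the
  -- Fricke value `c² - 3`.
  have hdet : (S * T - T * S).det = 3 - c ^ 2 := by
    have h1 := Matrix.mul_self_fin_two (S * T - T * S)
    rw [htr, zero_smul, zero_sub, htp.comm_mul_comm, ← neg_smul] at h1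
    have h3 := congrFun (congrFun h1 0) 0
    simp at h3
    linear_combination h3
  have inv_coe : ∀ g : SL(2, K), ((g⁻¹ : SL(2, K)) : Matrix (Fin 2) (Fin 2) K) =
      (g : Matrix (Fin 2) (Fin 2) K).trace • 1 - (g : Matrix (Fin 2) (Fin 2) K) := by
    intro g
    rw [Matrix.SpecialLinearGroup.coe_inv, Matrix.adjugate_fin_two]
    ext i j
    fin_cases i <;> fin_cases j <;> simp [Matrix.trace_fin_two]
  refine ⟨Matrix.GeneralLinearGroup.mkOfDetNeZero (S * T - T * S) ?_, ?_, ?_, hdet⟩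
  · rw [hdet]
    intro h0; apply hκ; linear_combination -h0
  · rw [glConj_eq_iff, inv_coe, h.trace_left]
    change (S * T - T * S) * S = ((1 : K) • 1 - S) * (S * T - T * S)
    have e := htp.sq_left
    rw [one_smul] at e ⊢
    rw [sub_mul, sub_mul, one_mul, mul_sub, mul_assoc T, e, ← mul_assoc S S T, e]
    simp only [mul_sub, sub_mul, mul_one, one_mul, mul_assoc]
    abel
  · rw [glConj_eq_iff, inv_coe]
    change (S * T - T * S) * T = (c • 1 - T) * (S * T - T * S)
    have e := htp.sq_right
    rw [sub_mul, sub_mul, smul_mul_assoc, one_mul, mul_sub, mul_assoc, mul_assoc, e,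
      ← mul_assoc T T S, e]
    simp only [mul_sub, sub_mul, mul_smul_comm, smul_mul_assoc, mul_one, one_mul, smul_sub]
    abel

theorem IsPolyPair.conjGL_inverter (g : GL (Fin 2) K) (hs : glConj g s = s⁻¹)
    (ht : glConj g t = t⁻¹) : conjGL g (Subgroup.closure {s, t}) = Subgroup.closure {s, t} := by
  rw [conjGL_closure, hs, ht]
  apply le_antisymm
  · rw [Subgroup.closure_le]
    rintro _ (rfl | rfl)
    · exact inv_mem (Subgroup.subset_closure (by simp))
    · exact inv_mem (Subgroup.subset_closure (by simp))
  · rw [Subgroup.closure_le]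
    rintro _ (rfl | rfl)
    · exact (Subgroup.inv_mem_iff _).1 (Subgroup.subset_closure (by simp))
    · exact (Subgroup.inv_mem_iff _).1 (Subgroup.subset_closure (by simp))

/-- The extension of scalars of an element of `GL₂(𝔽_p)`. -/
noncomputable def baseChangeGL (p : ℕ) [Fact p.Prime] :
    GL (Fin 2) (ZMod p) →* GL (Fin 2) (AlgebraicClosure (ZMod p)) :=
  Matrix.GeneralLinearGroup.map (algebraMap (ZMod p) (AlgebraicClosure (ZMod p)))

theorem glConj_baseChangeGL (g : GL (Fin 2) (ZMod p)) (h : SL(2, ZMod p)) :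
    glConj (baseChangeGL p g) (baseChange p h) = baseChange p (glConj g h) := by
  rw [glConj_eq_iff]
  have h1 := (glConj_eq_iff g h _).1 rfl
  have := congrArg (algebraMap (ZMod p) (AlgebraicClosure (ZMod p))).mapMatrix h1
  rw [map_mul, map_mul] at this
  exact this

/-- Multiplying `g` by elements of `H`, of determinant one, and if necessary by the inverter `n`,
gives a matrix that commutes with `s` and `t`. It is scalar, so its determinant is a square. The
inverter is needed only for `k = 3`, where its determinant is `3 - 1 = 2`. -/
theorem IsPolyPair.isSquare_det_of_normalizes (hp : 3 < p) {k : ℕ} {s t : SL(2, ZMod p)}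
    (h : IsPolyPair k s t) (hc : (Nat.card (Subgroup.closure {s, t})).Coprime p)
    {g : GL (Fin 2) (ZMod p)} (hg : conjGL g (Subgroup.closure {s, t}) = Subgroup.closure {s, t}) :
    IsSquare (g : Matrix (Fin 2) (Fin 2) (ZMod p)).det ∨
      k = 3 ∧ IsSquare (2 * (g : Matrix (Fin 2) (Fin 2) (ZMod p)).det) := by
  have h2 := two_ne_zero_zmod hp
  have h2' := two_ne_zero_closure hp
  have hss := eq_one_or_eq_neg_one_of_mem_map hp hc
  have hP := h.isPolyhedral hp hc
  obtain ⟨n, hns, hnt, hdet⟩ := h.exists_inverter h2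
  have hn := IsPolyPair.conjGL_inverter n hns hnt
  set H := Subgroup.closure {s, t} with hH
  have hfin : Finite (H.map (baseChange p)) :=
    Finite.of_equiv _ (H.equivMapOfInjective _ baseChange_injective).toEquiv
  have hnorm : ∀ g : GL (Fin 2) (ZMod p), conjGL g H = H →
      ∀ h ∈ H.map (baseChange p), glConj (baseChangeGL p g) h ∈ H.map (baseChange p) := by
    rintro g hg _ ⟨h, hh, rfl⟩
    rw [glConj_baseChangeGL]
    exact ⟨_, by rw [← hg]; exact ⟨h, hh, rfl⟩, rfl⟩
  let S : H.map (baseChange p) := ⟨baseChange p s, s, Subgroup.subset_closure (by simp), rfl⟩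
  let T : H.map (baseChange p) := ⟨baseChange p t, t, Subgroup.subset_closure (by simp), rfl⟩
  have hfix : ∀ g : GL (Fin 2) (ZMod p), glConj (baseChangeGL p g) S = S →
      glConj (baseChangeGL p g) T = T → IsSquare (g : Matrix (Fin 2) (Fin 2) (ZMod p)).det := by
    intro g hgS hgT
    have e1 : glConj g s = s := baseChange_injective (by rw [← glConj_baseChangeGL]; exact hgS)
    have e2 : glConj g t = t := baseChange_injective (by rw [← glConj_baseChangeGL]; exact hgT)
    refine det_isSquare_of_commute ((glConj_eq_iff _ _ _).1 e1) ((glConj_eq_iff _ _ _).1 e2) ?_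
    intro hcomm
    exact h.not_commute h2 (Subtype.ext hcomm)
  have htoGL : ∀ x : SL(2, ZMod p), ((baseChange p x : SL(2, AlgebraicClosure (ZMod p))) :
      GL (Fin 2) (AlgebraicClosure (ZMod p))) = baseChangeGL p (x : GL (Fin 2) (ZMod p)) := by
    intro x; ext; rfl
  have hdet1 : ∀ x : SL(2, ZMod p),
      ((x : GL (Fin 2) (ZMod p)) : Matrix (Fin 2) (Fin 2) (ZMod p)).det = 1 := fun x => x.2
  obtain ⟨⟨_, x, hx, rfl⟩, ⟨_, y, hy, rfl⟩, ⟨h1, h3⟩ | ⟨hk, h1, h3⟩⟩ :=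
    hP.exists_fix_of_normalizes h2' hss (s := S) (t := T)
      (by rw [trace_baseChange, h.trace_left, map_one])
      (by
        rw [trace_baseChange]
        rcases h.trace_right with ⟨hk, h0⟩ | ⟨hk, h0⟩ | ⟨hk, h0⟩
        · exact Or.inl ⟨hk, by rw [h0, map_one]⟩
        · exact Or.inr (Or.inl ⟨hk, by rw [← map_pow, h0, map_ofNat]⟩)
        · exact Or.inr (Or.inr ⟨hk, by rw [← map_pow, h0, map_add, map_one]⟩))
      (by rw [Subgroup.coe_mul, ← map_mul, trace_baseChange, h.trace_mul, map_zero])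
      (hnorm g hg) (hnorm n hn)
      (by
        change glConj (baseChangeGL p n) (baseChange p t) = (baseChange p t)⁻¹
        rw [glConj_baseChangeGL, hnt, map_inv])
  · left
    rw [htoGL, ← map_mul] at h1 h3
    have := hfix _ h1 h3
    rwa [Units.val_mul, Matrix.det_mul, hdet1, one_mul] at this
  · right
    refine ⟨hk, ?_⟩
    rw [htoGL, htoGL, ← map_mul, ← map_mul, ← map_mul] at h1 h3
    have := hfix _ h1 h3
    rw [Units.val_mul, Units.val_mul, Units.val_mul, Matrix.det_mul, Matrix.det_mul,
      Matrix.det_mul, hdet1, hdet1, one_mul, mul_one, hdet] at this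
    have ht : (t : Matrix (Fin 2) (Fin 2) (ZMod p)).trace = 1 := by
      rcases h.trace_right with ⟨-, h0⟩ | ⟨h0, -⟩ | ⟨h0, -⟩
      · exact h0
      · omega
      · omega
    rw [ht] at this
    convert this using 2
    norm_num

end PolyPairConj

/-! ### Numbers of classes of `2A₄`, `2S₄`, `2A₅`. -/

section PolyhedralCount

variable {p : ℕ} [Fact p.Prime]

/-- Square roots of `2` are exactly the traces of elements of order `8`. -/
theorem isSquare_two_iff (hp : 3 < p) : IsSquare (2 : ZMod p) ↔ CongPM p 8 := by
  have h2 := two_ne_zero_zmod hp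
  constructor
  · rintro ⟨c, hc⟩
    obtain ⟨s, t, hst, -⟩ := IsPolyTrace.exists_isPolyPair hp (k := 4) (τ := c)
      (Or.inr (Or.inl ⟨rfl, by rw [pow_two, hc]⟩))
    have h8 := hst.orderOf_right h2
    have hodd : Odd p := (Fact.out : p.Prime).odd_of_ne_two (by omega)
    have := congPM_orderOf hp (g := t) (by
      rw [h8]
      exact Nat.Coprime.pow_left 3 (Nat.coprime_two_left.2 hodd))
    rwa [h8] at this
  · intro h
    obtain ⟨g, hg⟩ := exists_orderOf_eq hp (by norm_num) h
    have h4 := pow_half_eq_neg_one h2 (n := 4) (by norm_num) hg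
    rw [← pow_four_iff h2] at h4
    exact ⟨_, by rw [← pow_two, h4]⟩

theorem numClasses_polyType (hp : 3 < p) {k : ℕ} (hk5 : k = 5 → p ≠ 5) {τ : ZMod p}
    (hτ : IsPolyTrace k τ) :
    ((k = 3 → IsSquare (2 : ZMod p)) → numClasses p (polyType k) = 2) ∧
      (k = 3 → ¬ IsSquare (2 : ZMod p) → numClasses p (polyType k) = 1) := by
  have h2 := two_ne_zero_zmod hp
  obtain ⟨s, t, hst, ht⟩ := hτ.exists_isPolyPair hp
  have hty := hst.hasType (five_le hp)
  have hc := hty.card_coprime hp hst.hk hk5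
  obtain ⟨c2, c1⟩ := numClasses_eq hp hc hty (fun H _ hH => by
    obtain ⟨s', t', hst', rfl⟩ := exists_isPolyPair_of_hasType h2 hst.hk hH
    exact hst.exists_conjGL_eq hp hst' hc)
  constructor
  · intro hk
    refine c2 fun g hg => ?_
    rcases hst.isSquare_det_of_normalizes hp hc hg with h | ⟨hk3, h⟩
    · exact h
    · have := (hk hk3).div h
      rwa [div_mul_cancel_left₀ h2, isSquare_inv] at this
  · intro hk hns
    obtain ⟨n, hns', hnt, hdet⟩ := hst.exists_inverter h2
    refine c1 ⟨n, IsPolyPair.conjGL_inverter n hns' hnt, ?_⟩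
    have : τ = 1 := by
      rcases hτ with ⟨-, h⟩ | ⟨h, -⟩ | ⟨h, -⟩
      · exact h
      · omega
      · omega
    rw [hdet, ht, this]
    norm_num
    exact hns

theorem numClasses_twoA4_eq_two (hp : 3 < p) (h : CongPM p 8) : numClasses p .twoA4 = 2 :=
  (numClasses_polyType hp (k := 3) (by norm_num) (τ := 1) (Or.inl ⟨rfl, rfl⟩)).1
    fun _ => (isSquare_two_iff hp).2 h

theorem numClasses_twoA4_eq_one (hp : 3 < p) (h : ¬ CongPM p 8) : numClasses p .twoA4 = 1 :=
  (numClasses_polyType hp (k := 3) (by norm_num) (τ := 1) (Or.inl ⟨rfl, rfl⟩)).2 rfl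
    fun h2 => h ((isSquare_two_iff hp).1 h2)

theorem numClasses_twoS4_eq_two (hp : 3 < p) (h : CongPM p 8) : numClasses p .twoS4 = 2 := by
  obtain ⟨c, hc⟩ := (isSquare_two_iff hp).2 h
  exact (numClasses_polyType hp (k := 4) (by norm_num) (τ := c)
    (Or.inr (Or.inl ⟨rfl, by rw [pow_two, hc]⟩))).1 (by norm_num)

theorem numClasses_twoA5_eq_two (hp : 3 < p) (h : CongPM p 5) : numClasses p .twoA5 = 2 := by
  have h2 := two_ne_zero_zmod hp
  have hp5 : p ≠ 5 := by
    rintro rfl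
    rw [congPM_iff] at h
    omega
  obtain ⟨g, hg⟩ := exists_orderOf_eq hp (by norm_num) (h.mul_two hp (by decide : Odd 5))
  have h5 := pow_half_eq_neg_one h2 (by norm_num) hg
  have hg1 : g ≠ 1 := by rintro rfl; rw [orderOf_one] at hg; omega
  have hgm1 : g ≠ -1 := by
    rintro rfl
    have := Nat.le_of_dvd (by norm_num)
      (orderOf_dvd_of_pow_eq_one (x := (-1 : SL(2, ZMod p))) (n := 2) (by simp))
    omega
  exact (numClasses_polyType hp (k := 5) (fun _ => hp5) (Or.inr (Or.inr ⟨rfl,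
    trace_of_pow_five hg1 hgm1 h5⟩))).1 (by norm_num)

theorem numClasses_eq_zero {τ : SubgroupType} (h : ∀ H : Subgroup SL(2, ZMod p),
    (Nat.card H).Coprime p → ¬ HasType H τ) : numClasses p τ = 0 := by
  refine (congrArg Set.ncard (Set.eq_empty_iff_forall_notMem.2 ?_)).trans (Set.ncard_empty _)
  rintro c ⟨H, -, hc, hH⟩
  exact h H hc hH

theorem numClasses_twoS4_eq_zero (hp : 3 < p) (h : ¬ CongPM p 8) : numClasses p .twoS4 = 0 :=
  numClasses_eq_zero fun _ hc hH => h (congPM_of_hasType_polyType hp hc (k := 4) (by norm_num) hH)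

theorem numClasses_twoA5_eq_zero (hp : 3 < p) (h : ¬ CongPM p 5) : numClasses p .twoA5 = 0 :=
  numClasses_eq_zero fun _ hc hH => h (CongPM.of_dvd (by norm_num)
    (congPM_of_hasType_polyType hp hc (k := 5) (by norm_num) hH))

end PolyhedralCount

/-! ### Numbers of classes of cyclic groups. -/

section CyclicCount

variable {p : ℕ} [Fact p.Prime]

theorem hasType_C_of_isCyclic {G : Type} [Group G] [IsCyclic G] {n : ℕ} (h : Nat.card G = n) :
    HasType G (.C n) := by
  subst h
  exact ⟨(zmodCyclicMulEquiv inferInstance).symm⟩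

theorem HasType.exists_zpowers_eq {G : Type} [Group G] {H : Subgroup G} {n : ℕ}
    (h : HasType H (.C n)) : ∃ g : G, orderOf g = n ∧ Subgroup.zpowers g = H := by
  have hcard := h.card_C
  obtain ⟨e⟩ := h
  have : IsCyclic H := isCyclic_of_surjective e.symm e.symm.surjective
  obtain ⟨g, hg⟩ := IsCyclic.exists_generator (α := H)
  refine ⟨g, ?_, ?_⟩
  · rw [Subgroup.orderOf_coe, orderOf_eq_card_of_forall_mem_zpowers hg, hcard]
  · apply le_antisymm
    · rw [Subgroup.zpowers_le]; exact g.2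
    · intro x hx
      obtain ⟨i, hi⟩ := hg ⟨x, hx⟩
      exact ⟨i, by simpa using congrArg Subtype.val hi⟩

theorem zpowers_pow_eq {G : Type*} [Group G] {g : G} {i : ℕ} (h : i.Coprime (orderOf g)) :
    Subgroup.zpowers (g ^ i) = Subgroup.zpowers g := by
  apply le_antisymm
  · rw [Subgroup.zpowers_le]
    exact Subgroup.pow_mem _ (Subgroup.mem_zpowers g) i
  · rw [Subgroup.zpowers_le]
    obtain ⟨m, hm⟩ := exists_pow_eq_self_of_coprime h
    have := Subgroup.pow_mem _ (Subgroup.mem_zpowers (g ^ i)) m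
    rwa [hm] at this

/-- The norm form of a quadratic algebra represents all elements of a finite field. -/
theorem exists_norm_form_eq (hp : 3 < p) {τ : ZMod p} (hτ : τ ^ 2 ≠ 4) (d : ZMod p) :
    ∃ a b : ZMod p, a ^ 2 + τ * a * b + b ^ 2 = d := by
  open Polynomial in
  have h2 := two_ne_zero_zmod hp
  have h4 : (4 : ZMod p) ≠ 0 := by
    have := mul_ne_zero h2 h2
    norm_num at this
    exact this
  have hc : 1 - (τ / 2) ^ 2 ≠ 0 := by
    intro h0
    apply hτ
    field_simp at h0
    linear_combination -h0
  have hodd : Fintype.card (ZMod p) % 2 = 1 := by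
    rw [ZMod.card]
    exact Nat.odd_iff.1 ((Fact.out : p.Prime).odd_of_ne_two (by omega))
  obtain ⟨e, b, heb⟩ := FiniteField.exists_root_sum_quadratic
    (f := (X ^ 2 : (ZMod p)[X])) (g := C (1 - (τ / 2) ^ 2) * X ^ 2 + C 0 * X + C (-d))
    (degree_X_pow 2) (degree_quadratic hc) hodd
  refine ⟨e - τ / 2 * b, b, ?_⟩
  simp at heb
  field_simp at heb ⊢
  linear_combination heb

/-- A nonscalar element of `SL₂(𝔽_p)` commutes with an element of nonsquare determinant. -/
theorem exists_commute_of_not_isSquare (hp : 3 < p) {g : SL(2, ZMod p)}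
    (hg : (g : Matrix (Fin 2) (Fin 2) (ZMod p)).trace ^ 2 ≠ 4) {d : ZMod p} (hd : d ≠ 0) :
    ∃ P : GL (Fin 2) (ZMod p), glConj P g = g ∧
      (P : Matrix (Fin 2) (Fin 2) (ZMod p)).det = d := by
  obtain ⟨a, b, hab⟩ := exists_norm_form_eq hp hg d
  set M := (g : Matrix (Fin 2) (Fin 2) (ZMod p)) with hM
  have hdetM : M.det = 1 := g.2
  have hdet : (a • (1 : Matrix (Fin 2) (Fin 2) (ZMod p)) + b • M).det = d := by
    rw [← hab]
    rw [Matrix.det_fin_two] at hdetM ⊢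
    simp [Matrix.trace_fin_two]
    linear_combination b ^ 2 * hdetM
  refine ⟨Matrix.GeneralLinearGroup.mkOfDetNeZero _ (hdet ▸ hd), ?_, hdet⟩
  rw [glConj_eq_iff]
  change (a • (1 : Matrix (Fin 2) (Fin 2) (ZMod p)) + b • M) * M =
    M * (a • (1 : Matrix (Fin 2) (Fin 2) (ZMod p)) + b • M)
  simp [add_mul, mul_add]

/-- Two generators of order `n ≥ 3` have the same trace after passing to a power, so the subgroups
are `GL₂`-conjugate. The determinants `a² + τ a b + b²` of `a + b g` cover all of `𝔽_p`, so the
class does not split. For `n ≤ 2` the subgroup is central. -/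
theorem numClasses_C (hp : 3 < p) {n : ℕ} (hn : 1 ≤ n) (h : CongPM p n) :
    numClasses p (.C n) = 1 := by
  have h2 := two_ne_zero_zmod hp
  obtain ⟨d, hd⟩ := FiniteField.exists_nonsquare (F := ZMod p) (by
    rw [ZMod.ringChar_zmod_n]; omega)
  have hd0 : d ≠ 0 := by rintro rfl; exact hd IsSquare.zero
  suffices ∃ g : SL(2, ZMod p), orderOf g = n ∧
      (∀ h : SL(2, ZMod p), orderOf h = n → ∃ P : GL (Fin 2) (ZMod p), ∃ i : ℕ, i.Coprime n ∧
        glConj P (g ^ i) = h) ∧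
      ∃ P : GL (Fin 2) (ZMod p), glConj P g = g ∧
        (P : Matrix (Fin 2) (Fin 2) (ZMod p)).det = d by
    obtain ⟨g, hg, htr, P, hP, hdet⟩ := this
    have hcard : Nat.card (Subgroup.zpowers g) = n := by rw [Nat.card_zpowers, hg]
    refine (numClasses_eq hp (H₀ := Subgroup.zpowers g) (by rw [hcard]; exact h.coprime)
      (hasType_C_of_isCyclic hcard) (fun H _ hH => ?_)).2
      ⟨P, by rw [conjGL_zpowers, hP], by rwa [hdet]⟩
    obtain ⟨x, hx, rfl⟩ := hH.exists_zpowers_eq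
    obtain ⟨Q, i, hi, hQ⟩ := htr x hx
    refine ⟨Q, ?_⟩
    rw [← zpowers_pow_eq (hg ▸ hi), conjGL_zpowers, hQ]
  by_cases hn3 : 3 ≤ n
  · obtain ⟨g, hg⟩ := exists_orderOf_eq hp hn3 h
    have htr : ∀ {g : SL(2, ZMod p)}, orderOf g = n →
        (g : Matrix (Fin 2) (Fin 2) (ZMod p)).trace ^ 2 ≠ 4 :=
      fun hg => trace_sq_ne_four p h2 hn3 h.coprime hg
    refine ⟨g, hg, fun x hx => ?_, exists_commute_of_not_isSquare hp (htr hg) hd0⟩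
    obtain ⟨i, hi, hix⟩ := exists_pow_trace_eq hp hn3 h.coprime hg hx
    obtain ⟨P, hP⟩ := exists_glConj_eq_of_trace_eq (g := g ^ i) (h := x)
      (by rw [hix]; exact htr hx) hix.symm
    exact ⟨P, i, hi, hP⟩
  · let D : GL (Fin 2) (ZMod p) := Matrix.GeneralLinearGroup.mkOfDetNeZero !![d, 0; 0, 1]
      (by simpa [Matrix.det_fin_two_of] using hd0)
    have hD : (D : Matrix (Fin 2) (Fin 2) (ZMod p)).det = d := by
      change (!![d, 0; 0, 1] : Matrix (Fin 2) (Fin 2) (ZMod p)).det = d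
      simp [Matrix.det_fin_two_of]
    have hn' : n = 1 ∨ n = 2 := by omega
    rcases hn' with rfl | rfl
    · refine ⟨1, orderOf_one, fun x hx => ⟨1, 1, by norm_num, ?_⟩, D, map_one _, hD⟩
      rw [orderOf_eq_one_iff.1 hx, one_pow, map_one]
    · have horder : ∀ x : SL(2, ZMod p), orderOf x = 2 → x = -1 := by
        intro x hx
        have h1 := pow_orderOf_eq_one x
        rw [hx, pow_two] at h1
        refine (eq_one_or_eq_neg_one_of_sq h2 h1).resolve_left ?_
        rintro rfl
        rw [orderOf_one] at hx; omega
      have hm : glConj D (-1) = -1 := by rw [glConj_eq_iff]; simp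
      refine ⟨-1, ?_, fun x hx => ⟨1, 1, by norm_num, ?_⟩, D, hm, hD⟩
      · exact orderOf_eq_prime (by simp) (neg_one_ne_one h2)
      · rw [horder x hx, pow_one, glConj_one]

end CyclicCount

/-! ### Generators and normalizing elements of binary dihedral groups. -/

section DicyclicCount

theorem closure_mul_eq {G : Type*} [Group G] (a b : G) :
    Subgroup.closure {a, a * b} = Subgroup.closure {a, b} := by
  have h1 : a ∈ Subgroup.closure {a, a * b} := Subgroup.subset_closure (by simp)
  have h3 : a * b ∈ Subgroup.closure {a, a * b} := Subgroup.subset_closure (by simp)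
  have h5 : a ∈ Subgroup.closure {a, b} := Subgroup.subset_closure (by simp)
  have h6 : b ∈ Subgroup.closure {a, b} := Subgroup.subset_closure (by simp)
  apply le_antisymm <;> rw [Subgroup.closure_le] <;> rintro x (hx | hx) <;> rw [hx]
  · exact h5
  · exact mul_mem h5 h6
  · exact h1
  · simpa using mul_mem (inv_mem h1) h3

namespace IsDicyclicPair

section Group

variable {G : Type*} [Group G] {n : ℕ} {a b : G}

theorem mul_mul (h : IsDicyclicPair n a b) : a * b * a = b := by
  have h1 := h.conj
  rw [mul_inv_eq_iff_eq_mul, eq_inv_mul_iff_mul_eq] at h1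
  rw [mul_assoc, h1]

theorem pow_mul_mul_self (h : IsDicyclicPair n a b) (i : ℕ) :
    (a ^ i * b) * (a ^ i * b) = b * b := by
  have h1 := h.zpow_mul i
  rw [zpow_natCast, zpow_neg, zpow_natCast] at h1
  nth_rewrite 1 [h1]
  rw [mul_assoc, inv_mul_cancel_left]

theorem exists_eq_of_mem [NeZero n] (h : IsDicyclicPair n a b) {x : G}
    (hx : x ∈ Subgroup.closure {a, b}) : ∃ i : ℕ, x = a ^ i ∨ x = a ^ i * b := by
  obtain ⟨f, hfa, hfx⟩ := h.exists_hom
  have hle : Subgroup.closure {a, b} ≤ f.range := by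
    rw [Subgroup.closure_le]
    rintro _ (rfl | rfl)
    · exact ⟨.a (1 : ℤ), by rw [hfa, zpow_one]⟩
    · exact ⟨.xa (0 : ℤ), by rw [hfx, zpow_zero, mul_one]⟩
  have hfin : IsOfFinOrder a := by
    rw [← orderOf_pos_iff, h.orderOf_eq]
    have := NeZero.pos n
    omega
  have hnat : ∀ i : ℤ, ∃ j : ℕ, a ^ i = a ^ j := fun i => by
    obtain ⟨j, hj⟩ := hfin.mem_powers_iff_mem_zpowers.2 ⟨i, rfl⟩
    exact ⟨j, hj.symm⟩
  obtain ⟨(i | i), rfl⟩ := hle hx <;> obtain ⟨i, rfl⟩ := ZMod.intCast_surjective i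
  · obtain ⟨j, hj⟩ := hnat i
    exact ⟨j, Or.inl (by rw [hfa, hj])⟩
  · obtain ⟨j, hj⟩ := hnat (-i)
    refine ⟨j, Or.inr ?_⟩
    rw [hfx, ← hj, h.zpow_mul, neg_neg]

theorem closure_pow_eq (h : IsDicyclicPair n a b) {i : ℕ} (hi : i.Coprime (2 * n)) :
    Subgroup.closure {a ^ i, b} = Subgroup.closure {a, b} := by
  have hz := zpowers_pow_eq (g := a) (i := i) (by rwa [h.orderOf_eq])
  have h1 : a ∈ Subgroup.zpowers (a ^ i) := hz ▸ Subgroup.mem_zpowers a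
  have h3 : a ∈ Subgroup.closure {a ^ i, b} :=
    (Subgroup.zpowers_le.2 (Subgroup.subset_closure (by simp))) h1
  apply le_antisymm <;> rw [Subgroup.closure_le] <;> rintro _ (rfl | rfl)
  · exact pow_mem (Subgroup.subset_closure (by simp)) i
  · exact Subgroup.subset_closure (by simp)
  · exact h3
  · exact Subgroup.subset_closure (by simp)

end Group

variable {K : Type*} [Field K] {n : ℕ} {a b : SL(2, K)}

theorem mul_self_eq (h2 : (2 : K) ≠ 0) [NeZero n] (h : IsDicyclicPair n a b) : b * b = -1 := by
  rw [h.mul_self, pow_half_eq_neg_one h2 (NeZero.pos n) h.orderOf_eq]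

theorem trace_right (h2 : (2 : K) ≠ 0) [NeZero n] (h : IsDicyclicPair n a b) :
    (b : Matrix (Fin 2) (Fin 2) K).trace = 0 := by
  rw [trace_eq_zero_iff h2, pow_two, h.mul_self_eq h2]

theorem trace_pow_mul (h2 : (2 : K) ≠ 0) [NeZero n] (h : IsDicyclicPair n a b) (i : ℕ) :
    ((a ^ i * b : SL(2, K)) : Matrix (Fin 2) (Fin 2) K).trace = 0 := by
  rw [trace_eq_zero_iff h2, pow_two, h.pow_mul_mul_self, h.mul_self_eq h2]

end IsDicyclicPair

variable {K : Type*} [Field K]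

/-- Trace zero gives `b² = (a b)² = -1`, hence `a b a = b`. The Fricke polynomial is `tr(a)² - 4 ≠
0`, so `a` and `b` do not commute and `b` is not a power of `a`. -/
theorem isDicyclicPair_of_traces (h2 : (2 : K) ≠ 0) {n : ℕ} [NeZero n] {a b : SL(2, K)}
    (ha : orderOf a = 2 * n) (ha4 : (a : Matrix (Fin 2) (Fin 2) K).trace ^ 2 ≠ 4)
    (hb : (b : Matrix (Fin 2) (Fin 2) K).trace = 0)
    (hab : ((a * b : SL(2, K)) : Matrix (Fin 2) (Fin 2) K).trace = 0) : IsDicyclicPair n a b := by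
  have hnc : a * b ≠ b * a := by
    have htp := Matrix.SpecialLinearGroup.tracePair a b
    rw [← Matrix.SpecialLinearGroup.coe_mul, hab, hb] at htp
    refine htp.not_commute ?_
    intro h0
    apply ha4
    linear_combination h0
  rw [trace_eq_zero_iff h2, pow_two] at hb hab
  refine ⟨ha, ?_, ?_, ?_⟩
  · have h3 : a * b * a = b := by
      have h4 : a * b * a * b = b * b := by rw [hb, ← hab]; group
      exact mul_right_cancel h4
    rw [mul_inv_eq_iff_eq_mul, eq_inv_mul_iff_mul_eq, ← mul_assoc, h3]
  · rw [hb, pow_half_eq_neg_one h2 (NeZero.pos n) ha]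
  · rintro ⟨i, rfl⟩
    exact hnc ((Commute.refl a).zpow_right i)

/-- A power of `g` with the same trace as `g` is `g` or its inverse. -/
theorem pow_eq_or_eq_inv_of_trace_eq (h2 : (2 : K) ≠ 0) {g : SL(2, K)} {i : ℕ}
    (hg : (g : Matrix (Fin 2) (Fin 2) K).trace ^ 2 ≠ 4)
    (h : ((g ^ i : SL(2, K)) : Matrix (Fin 2) (Fin 2) K).trace =
      (g : Matrix (Fin 2) (Fin 2) K).trace) : g ^ i = g ∨ g ^ i = g⁻¹ := by
  have hlin : ∃ x y : K, ((g ^ i : SL(2, K)) : Matrix (Fin 2) (Fin 2) K) =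
      x • 1 + y • (g : Matrix (Fin 2) (Fin 2) K) := by
    have h1 := Matrix.mul_self_fin_two (g : Matrix (Fin 2) (Fin 2) K)
    rw [g.2, one_smul] at h1
    clear h
    induction i with
    | zero => exact ⟨1, 0, by simp⟩
    | succ i ih =>
      obtain ⟨x, y, hxy⟩ := ih
      refine ⟨-y, x + y * (g : Matrix (Fin 2) (Fin 2) K).trace, ?_⟩
      rw [pow_succ, Matrix.SpecialLinearGroup.coe_mul, hxy, add_mul, smul_mul_assoc,
        smul_mul_assoc, h1, one_mul]
      module
  obtain ⟨x, y, hxy⟩ := hlin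
  have hdet := (g ^ i).2
  have hdetg := g.2
  rw [hxy] at h hdet
  rw [Matrix.det_fin_two] at hdet hdetg
  simp [Matrix.trace_fin_two] at h hdet
  set M := (g : Matrix (Fin 2) (Fin 2) K) with hM
  set t := M 0 0 + M 1 1 with ht
  have htr : M.trace = t := Matrix.trace_fin_two M
  rw [htr] at hg
  have e1 : 2 * x = t * (1 - y) := by linear_combination h
  have e2 : x ^ 2 + x * y * t + y ^ 2 = 1 := by
    rw [ht]; linear_combination hdet - y ^ 2 * hdetg
  -- Write `gⁱ = x + y g`. Equal traces and determinant one force `y = ±1`, which gives `g` or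
  -- `tr(g) - g = g⁻¹`.
  have e3 : (1 - y) * (1 + y) = 0 := by
    have : (t ^ 2 - 4) * ((1 - y) * (1 + y)) = 0 := by
      linear_combination 4 * e2 - (2 * x + t * (1 - y) + 2 * y * t) * e1
    exact (mul_eq_zero.1 this).resolve_left (sub_ne_zero.2 hg)
  rcases mul_eq_zero.1 e3 with hy | hy
  · left
    have hy' : y = 1 := by linear_combination -hy
    have hx : x = 0 := by
      rw [hy', sub_self, mul_zero] at e1
      exact (mul_eq_zero.1 e1).resolve_left h2
    apply Subtype.ext
    rw [hxy, hx, hy', zero_smul, one_smul, zero_add]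
  · right
    have hy' : y = -1 := by linear_combination hy
    have hx : x = t := mul_left_cancel₀ h2 (by rw [e1, hy']; ring)
    apply Subtype.ext
    rw [hxy, hx, hy', Matrix.SpecialLinearGroup.coe_inv, Matrix.adjugate_fin_two]
    ext i j
    fin_cases i <;> fin_cases j <;> simp [ht, hM]

namespace IsDicyclicPair

variable {n : ℕ} {a b : SL(2, K)}

/-- The element `1 + a` normalizes the binary dihedral group with standard generators `a`, `b`. -/
theorem exists_shift (h : IsDicyclicPair n a b)
    (ha : (a : Matrix (Fin 2) (Fin 2) K).trace ^ 2 ≠ 4) :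
    ∃ u : GL (Fin 2) K, glConj u a = a ∧ glConj u b = a * b ∧
      (u : Matrix (Fin 2) (Fin 2) K).det = 2 + (a : Matrix (Fin 2) (Fin 2) K).trace := by
  have hdet : (1 + (a : Matrix (Fin 2) (Fin 2) K)).det =
      2 + (a : Matrix (Fin 2) (Fin 2) K).trace := by
    have := a.2
    rw [Matrix.det_fin_two] at this ⊢
    simp [Matrix.trace_fin_two]
    linear_combination this
  refine ⟨Matrix.GeneralLinearGroup.mkOfDetNeZero (1 + (a : Matrix (Fin 2) (Fin 2) K)) ?_, ?_, ?_,
    hdet⟩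
  · rw [hdet]
    intro h0
    apply ha
    linear_combination ((a : Matrix (Fin 2) (Fin 2) K).trace - 2) * h0
  · rw [glConj_eq_iff]
    change (1 + (a : Matrix (Fin 2) (Fin 2) K)) * a = a * (1 + (a : Matrix (Fin 2) (Fin 2) K))
    rw [add_mul, mul_add, one_mul, mul_one]
  · rw [glConj_eq_iff]
    change (1 + (a : Matrix (Fin 2) (Fin 2) K)) * b =
      ((a * b : SL(2, K)) : Matrix (Fin 2) (Fin 2) K) * (1 + (a : Matrix (Fin 2) (Fin 2) K))
    rw [add_mul, mul_add, one_mul, mul_one, ← Matrix.SpecialLinearGroup.coe_mul,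
      ← Matrix.SpecialLinearGroup.coe_mul, h.mul_mul, add_comm]

/-- If `a` has order `4`, then `a + b` exchanges `a` and `b`. -/
theorem exists_swap (h2 : (2 : K) ≠ 0) (h : IsDicyclicPair 2 a b) :
    ∃ v : GL (Fin 2) K, glConj v a = b ∧ glConj v b = a ∧
      (v : Matrix (Fin 2) (Fin 2) K).det = 2 := by
  have ha2 : a * a = -1 := by rw [← pow_two]; exact pow_half_eq_neg_one h2 two_pos h.orderOf_eq
  have hb2 : b * b = -1 := h.mul_self_eq h2
  have hab : ((a * b : SL(2, K)) : Matrix (Fin 2) (Fin 2) K).trace = 0 := by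
    simpa using h.trace_pow_mul h2 1
  have hat : (a : Matrix (Fin 2) (Fin 2) K).trace = 0 := by
    rw [trace_eq_zero_iff h2, pow_two, ha2]
  have hbt := h.trace_right h2
  have hmab : (a : Matrix (Fin 2) (Fin 2) K) * a = b * b := by
    rw [← Matrix.SpecialLinearGroup.coe_mul, ← Matrix.SpecialLinearGroup.coe_mul, ha2, hb2]
  have hdet : ((a : Matrix (Fin 2) (Fin 2) K) + b).det = 2 := by
    have h1 := a.2
    have h3 := b.2
    rw [Matrix.det_fin_two] at h1 h3 ⊢
    simp [Matrix.trace_fin_two, Matrix.mul_apply, Fin.sum_univ_two] at hab hat hbt ⊢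
    linear_combination h1 + h3 - hab + (b 0 0 + b 1 1) * hat
  refine ⟨Matrix.GeneralLinearGroup.mkOfDetNeZero ((a : Matrix (Fin 2) (Fin 2) K) + b) ?_, ?_, ?_,
    hdet⟩
  · rw [hdet]; exact h2
  · rw [glConj_eq_iff]
    change ((a : Matrix (Fin 2) (Fin 2) K) + b) * a = b * ((a : Matrix (Fin 2) (Fin 2) K) + b)
    rw [add_mul, mul_add, hmab, add_comm]
  · rw [glConj_eq_iff]
    change ((a : Matrix (Fin 2) (Fin 2) K) + b) * b = a * ((a : Matrix (Fin 2) (Fin 2) K) + b)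
    rw [add_mul, mul_add, hmab, add_comm]

end IsDicyclicPair

/-! ### Determinants of the normalizer of a binary dihedral group. -/

section NormalizerSquare

variable {n : ℕ} {a b : SL(2, K)}

theorem glConj_mem_of_conjGL_eq {g : GL (Fin 2) K} {H : Subgroup SL(2, K)} (hg : conjGL g H = H)
    {x : SL(2, K)} (hx : x ∈ H) : glConj g x ∈ H := by
  rw [← hg]
  exact ⟨x, hx, rfl⟩

theorem glConj_pow_eq {g : GL (Fin 2) K} {x y : SL(2, K)} (hx : glConj g x = x)
    (hy : glConj g y = x * y) (i : ℕ) : glConj (g ^ i) x = x ∧ glConj (g ^ i) y = x ^ i * y := by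
  induction i with
  | zero => simp [glConj_one]
  | succ i ih =>
    refine ⟨by rw [pow_succ', glConj_mul, ih.1, hx], ?_⟩
    rw [pow_succ', glConj_mul, ih.2, map_mul, map_pow, hx, hy, pow_succ, mul_assoc]

theorem conjGL_toGL_of_mem {H : Subgroup SL(2, K)} {x : SL(2, K)} (hx : x ∈ H) :
    conjGL (x : GL (Fin 2) K) H = H := by
  have h1 : ∀ x ∈ H, conjGL (x : GL (Fin 2) K) H ≤ H := by
    rintro x hx _ ⟨y, hy, rfl⟩
    change glConj (x : GL (Fin 2) K) y ∈ H
    rw [glConj_coe]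
    exact mul_mem (mul_mem hx hy) (inv_mem hx)
  apply le_antisymm (h1 x hx)
  intro y hy
  have h3 := h1 _ (inv_mem hx) ⟨y, hy, rfl⟩
  refine ⟨_, h3, ?_⟩
  change glConj (x : GL (Fin 2) K) (glConj ((x⁻¹ : SL(2, K)) : GL (Fin 2) K) y) = y
  rw [glConj_coe, glConj_coe]
  group

theorem isSquare_det_of_isSquare_det_mul {w g : GL (Fin 2) K}
    (hw : IsSquare (w : Matrix (Fin 2) (Fin 2) K).det)
    (h : IsSquare ((w * g : GL (Fin 2) K) : Matrix (Fin 2) (Fin 2) K).det) :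
    IsSquare (g : Matrix (Fin 2) (Fin 2) K).det := by
  have hw0 : (w : Matrix (Fin 2) (Fin 2) K).det ≠ 0 :=
    (Matrix.isUnit_iff_isUnit_det _).1 w.isUnit |>.ne_zero
  have := h.div hw
  rwa [Units.val_mul, Matrix.det_mul, mul_div_cancel_left₀ _ hw0] at this

namespace IsDicyclicPair

theorem not_commute (h2 : (2 : K) ≠ 0) [NeZero n] (h : IsDicyclicPair n a b)
    (ha : (a : Matrix (Fin 2) (Fin 2) K).trace ^ 2 ≠ 4) : a * b ≠ b * a := by
  intro hc
  have h1 := h.mul_mul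
  rw [hc, mul_assoc, mul_eq_left, ← pow_two] at h1
  rcases eq_one_or_eq_neg_one_of_sq h2 ((pow_two a).symm.trans h1) with rfl | rfl
  · apply ha; simp; norm_num
  · apply ha; rw [trace_neg_coe]; simp; norm_num

/-- If `2 + tr a` is a square, so is the determinant of every element that normalizes the binary
dihedral group with standard generators `a`, `b`. -/
theorem isSquare_det_of_normalizes (h2 : (2 : K) ≠ 0) (hn : 2 ≤ n) (h : IsDicyclicPair n a b)
    (ha : (a : Matrix (Fin 2) (Fin 2) K).trace ^ 2 ≠ 4)
    (hsq : IsSquare (2 + (a : Matrix (Fin 2) (Fin 2) K).trace)) {g : GL (Fin 2) K}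
    (hg : conjGL g (Subgroup.closure {a, b}) = Subgroup.closure {a, b}) :
    IsSquare (g : Matrix (Fin 2) (Fin 2) K).det := by
  have : NeZero n := ⟨by omega⟩
  obtain ⟨u, hua, hub, hudet⟩ := h.exists_shift ha
  set H := Subgroup.closure {a, b} with hH
  have haH : a ∈ H := Subgroup.subset_closure (by simp)
  have hbH : b ∈ H := Subgroup.subset_closure (by simp)
  have hu : conjGL u H = H := by
    rw [hH, conjGL_closure, hua, hub, closure_mul_eq]
  have hupow : ∀ i : ℕ, conjGL (u ^ i) H = H := fun i => by
    induction i with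
    | zero => rw [pow_zero, conjGL_one]
    | succ i ih => rw [pow_succ, conjGL_mul, hu, ih]
  have husq : ∀ i : ℕ, IsSquare ((u ^ i : GL (Fin 2) K) : Matrix (Fin 2) (Fin 2) K).det :=
    fun i => by
      rw [Units.val_pow_eq_pow_val, Matrix.det_pow, hudet]
      exact hsq.pow i
  -- Such a `g` sends `b` to some `aⁱ b`, as does `uⁱ`. The quotient centralizes `a` and `b`, so it
  -- is scalar.
  have hfix : ∀ g : GL (Fin 2) K, conjGL g H = H → glConj g a = a →
      IsSquare (g : Matrix (Fin 2) (Fin 2) K).det := by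
    intro g hg hga
    obtain ⟨i, hi | hi⟩ := h.exists_eq_of_mem (glConj_mem_of_conjGL_eq hg hbH)
    · exfalso
      apply h.not_commute h2 ha
      apply (glConj g).injective
      rw [map_mul, map_mul, hga, hi, (Commute.refl a).pow_right i]
    · obtain ⟨h1, h3⟩ := glConj_pow_eq hua hub i
      rw [← mul_inv_cancel_left (u ^ i) g, Units.val_mul, Matrix.det_mul]
      refine (husq i).mul ?_
      have e1 : glConj ((u ^ i)⁻¹ * g) a = a := by
        rw [glConj_mul, hga]
        nth_rewrite 1 [← h1]
        rw [← glConj_mul, inv_mul_cancel, glConj_one]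
      have e2 : glConj ((u ^ i)⁻¹ * g) b = b := by
        rw [glConj_mul, hi, ← h3, ← glConj_mul, inv_mul_cancel, glConj_one]
      refine det_isSquare_of_commute ((glConj_eq_iff _ _ _).1 e1) ((glConj_eq_iff _ _ _).1 e2) ?_
      intro hc
      exact h.not_commute h2 ha (Subtype.ext hc)
  have hpow : ∀ g : GL (Fin 2) K, conjGL g H = H → ∀ i : ℕ, glConj g a = a ^ i →
      IsSquare (g : Matrix (Fin 2) (Fin 2) K).det := by
    intro g hg i hi
    rcases pow_eq_or_eq_inv_of_trace_eq h2 ha (by rw [← hi, trace_glConj]) with h1 | h1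
    · exact hfix g hg (hi.trans h1)
    · refine isSquare_det_of_isSquare_det_mul (w := (b : GL (Fin 2) K)) ?_ (hfix _ ?_ ?_)
      · change IsSquare (b : Matrix (Fin 2) (Fin 2) K).det
        rw [b.2]; exact IsSquare.one
      · rw [conjGL_mul, hg, conjGL_toGL_of_mem hbH]
      · rw [glConj_mul, hi, h1, glConj_coe, ← conj_inv, h.conj, inv_inv]
  obtain ⟨i, hi | hi⟩ := h.exists_eq_of_mem (glConj_mem_of_conjGL_eq hg haH)
  · exact hpow g hg i hi
  -- If `a` goes to some `aⁱ b`, of square `-1`, then `a` has order four and `n = 2`. The swap `v`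
  -- reduces to the previous cases, and its determinant `2 = 2 + tr a` is a square.
  · have ha2 : a * a = -1 := by
      apply (glConj g).injective
      have hm : glConj g (-1) = -1 := by rw [glConj_eq_iff]; simp
      rw [map_mul, hm, hi, h.pow_mul_mul_self, h.mul_self_eq h2]
    have hn2 : n = 2 := by
      have h1 : a ^ 4 = 1 := by
        rw [show 4 = 2 * 2 from rfl, pow_mul, pow_two a, ha2]; simp
      have h3 := orderOf_dvd_of_pow_eq_one h1
      rw [h.orderOf_eq] at h3
      have := Nat.le_of_dvd (by norm_num) h3
      omega
    subst hn2
    have hat : (a : Matrix (Fin 2) (Fin 2) K).trace = 0 := by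
      rw [trace_eq_zero_iff h2, pow_two, ha2]
    obtain ⟨v, hva, hvb, hvdet⟩ := h.exists_swap h2
    have hv : conjGL v H = H := by
      rw [hH, conjGL_closure, hva, hvb, Set.pair_comm]
    obtain ⟨h1, h3⟩ := glConj_pow_eq hua hub i
    rw [← mul_inv_cancel_left (u ^ i) g, Units.val_mul, Matrix.det_mul]
    refine (husq i).mul (isSquare_det_of_isSquare_det_mul (w := v) ?_ (hfix _ ?_ ?_))
    · rw [hvdet]
      rwa [hat, add_zero] at hsq
    · rw [conjGL_mul, conjGL_mul, hg, conjGL_inv_eq (hupow i), hv]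
    · rw [glConj_mul, glConj_mul, hi, ← h3, ← glConj_mul (u ^ i)⁻¹, inv_mul_cancel, glConj_one, hvb]

end IsDicyclicPair

end NormalizerSquare

/-! ### Numbers of classes of binary dihedral groups. -/

section Count

variable {p : ℕ} [Fact p.Prime]

theorem exists_isDicyclicPair_trace_eq (hp : 3 < p) {n : ℕ} (hn : 2 ≤ n)
    (hnp : (2 * n).Coprime p) {g : SL(2, ZMod p)} (hg : orderOf g = 2 * n) :
    ∃ a b : SL(2, ZMod p), IsDicyclicPair n a b ∧
      (a : Matrix (Fin 2) (Fin 2) (ZMod p)).trace =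
        (g : Matrix (Fin 2) (Fin 2) (ZMod p)).trace := by
  have h2 := two_ne_zero_zmod hp
  have : NeZero n := ⟨by omega⟩
  have hg4 := trace_sq_ne_four p h2 (by omega) hnp hg
  obtain ⟨a, b, ha, hb, hab⟩ := exists_pair_with_traces h2 hg4 0 0
  obtain ⟨P, hP⟩ := exists_glConj_eq_of_trace_eq hg4 ha
  refine ⟨a, b, isDicyclicPair_of_traces h2 ?_ (by rwa [ha]) hb hab, ha⟩
  rw [← hP, ← hg]
  exact MulEquiv.orderOf_eq (glConj P) g

theorem IsDicyclicPair.exists_conjGL_eq (hp : 3 < p) {n : ℕ} (hn : 2 ≤ n)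
    (hnp : (2 * n).Coprime p) {a b a' b' : SL(2, ZMod p)} (h : IsDicyclicPair n a b)
    (h' : IsDicyclicPair n a' b') : ∃ g : GL (Fin 2) (ZMod p),
      conjGL g (Subgroup.closure {a, b}) = Subgroup.closure {a', b'} := by
  have h2 := two_ne_zero_zmod hp
  have : NeZero n := ⟨by omega⟩
  obtain ⟨i, hi, htr⟩ := exists_pow_trace_eq hp (by omega) hnp h.orderOf_eq h'.orderOf_eq
  have h4 := trace_sq_ne_four p h2 (by omega) hnp h'.orderOf_eq
  have t1 := Matrix.SpecialLinearGroup.tracePair (a ^ i) b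
  have t2 := Matrix.SpecialLinearGroup.tracePair a' b'
  rw [← Matrix.SpecialLinearGroup.coe_mul, htr, h.trace_pow_mul h2, h.trace_right h2] at t1
  have hm := h'.trace_pow_mul h2 1
  rw [pow_one] at hm
  rw [← Matrix.SpecialLinearGroup.coe_mul, hm, h'.trace_right h2] at t2
  obtain ⟨g, hg, hg'⟩ := t1.exists_conj t2 (by
    intro h0; apply h4; linear_combination h0)
  refine ⟨g, ?_⟩
  rw [← h.closure_pow_eq hi, conjGL_closure, (glConj_eq_iff _ _ _).2 hg,
    (glConj_eq_iff _ _ _).2 hg']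

theorem HasType.exists_closure_eq_of_twoD {G : Type} [Group G] {H : Subgroup G} {n : ℕ} [NeZero n]
    (h : HasType H (.twoD n)) :
    ∃ a b : G, IsDicyclicPair n a b ∧ Subgroup.closure {a, b} = H := by
  obtain ⟨e⟩ := h
  obtain ⟨a, b, hab, htop⟩ := exists_isDicyclicPair e
  refine ⟨a, b, ⟨?_, ?_, ?_, ?_⟩, ?_⟩
  · rw [Subgroup.orderOf_coe, hab.orderOf_eq]
  · exact congrArg Subtype.val hab.conj
  · exact congrArg Subtype.val hab.mul_self
  · rintro ⟨i, hi⟩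
    exact hab.notMem ⟨i, Subtype.ext hi⟩
  · have := congrArg (Subgroup.map H.subtype) htop
    rwa [MonoidHom.map_closure, Set.image_pair, ← MonoidHom.range_eq_map, Subgroup.range_subtype]
      at this

theorem numClasses_twoD (hp : 3 < p) {n : ℕ} (hn : 2 ≤ n) (hnp : (2 * n).Coprime p)
    {g : SL(2, ZMod p)} (hg : orderOf g = 2 * n) :
    (IsSquare (2 + (g : Matrix (Fin 2) (Fin 2) (ZMod p)).trace) → numClasses p (.twoD n) = 2) ∧
    (¬ IsSquare (2 + (g : Matrix (Fin 2) (Fin 2) (ZMod p)).trace) →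
      numClasses p (.twoD n) = 1) := by
  have h2 := two_ne_zero_zmod hp
  have : NeZero n := ⟨by omega⟩
  obtain ⟨a, b, hab, htr⟩ := exists_isDicyclicPair_trace_eq hp hn hnp hg
  have h4 := trace_sq_ne_four p h2 (by omega) hnp hab.orderOf_eq
  have hty : HasType (Subgroup.closure {a, b}) (.twoD n) := hab.nonempty_mulEquiv
  have hc : (Nat.card (Subgroup.closure {a, b})).Coprime p := by
    rw [hty.card_twoD (by omega), show 4 * n = 2 * (2 * n) by ring]
    exact Nat.Coprime.mul_left (hnp.coprime_dvd_left (dvd_mul_right 2 n)) hnp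
  obtain ⟨c2, c1⟩ := numClasses_eq hp hc hty (fun H _ hH => by
    obtain ⟨a', b', hab', rfl⟩ := hH.exists_closure_eq_of_twoD
    exact hab.exists_conjGL_eq hp hn hnp hab')
  rw [← htr]
  refine ⟨fun hsq => c2 fun g hg => hab.isSquare_det_of_normalizes h2 hn h4 hsq hg,
    fun hns => c1 ?_⟩
  obtain ⟨u, hua, hub, hudet⟩ := hab.exists_shift h4
  refine ⟨u, ?_, by rwa [hudet]⟩
  rw [conjGL_closure, hua, hub, closure_mul_eq]

/-- The square of an element `c` of order `4n` can serve as rotation, and `2 + tr(c²) = tr(c)²`. -/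
theorem numClasses_twoD_eq_two (hp : 3 < p) {n : ℕ} (hn : 2 ≤ n) (h : CongPM p (4 * n)) :
    numClasses p (.twoD n) = 2 := by
  obtain ⟨c, hc⟩ := exists_orderOf_eq hp (by omega) h
  have hc2 : orderOf (c ^ 2) = 2 * n := by
    rw [orderOf_pow' c two_ne_zero, hc, Nat.gcd_eq_right (by omega)]
    omega
  refine (numClasses_twoD hp hn (CongPM.of_dvd ⟨2, by ring⟩ h).coprime hc2).1 ?_
  have := trace_mul_pow_two 1 c
  rw [one_mul, one_mul, Matrix.SpecialLinearGroup.coe_one, Matrix.trace_one] at this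
  rw [this]
  refine ⟨(c : Matrix (Fin 2) (Fin 2) (ZMod p)).trace, ?_⟩
  simp

theorem numClasses_twoD_eq_one (hp : 3 < p) {n : ℕ} (hn : 2 ≤ n) (h : CongPM p (2 * n))
    (h' : ¬ CongPM p (4 * n)) : numClasses p (.twoD n) = 1 := by
  have h2 := two_ne_zero_zmod hp
  obtain ⟨a, ha⟩ := exists_orderOf_eq hp (by omega) h
  have hnp := h.coprime
  have h4 := trace_sq_ne_four p h2 (by omega) hnp ha
  refine (numClasses_twoD hp hn hnp ha).2 ?_
  rintro ⟨r, hr⟩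
  apply h'
  set M := (a : Matrix (Fin 2) (Fin 2) (ZMod p)) with hM
  have hr0 : r ≠ 0 := by
    rintro rfl
    apply h4
    linear_combination (M.trace - 2) * hr
  have hdetM : M.det = 1 := a.2
  have hdet : (r⁻¹ • (1 + M)).det = 1 := by
    rw [Matrix.det_smul, Fintype.card_fin, inv_pow, inv_mul_eq_iff_eq_mul₀ (pow_ne_zero 2 hr0),
      mul_one, pow_two, ← hr]
    rw [Matrix.det_fin_two] at hdetM ⊢
    simp [Matrix.trace_fin_two]
    linear_combination hdetM
  -- Since `(1 + a)² = (2 + tr a) a = r² a`, this is a square root of `a`. Its order is `4n` because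
  -- `a` has even order, which contradicts the failing congruence.
  let c : SL(2, ZMod p) := ⟨r⁻¹ • (1 + M), hdet⟩
  have hc2 : c ^ 2 = a := by
    apply Subtype.ext
    rw [pow_two, Matrix.SpecialLinearGroup.coe_mul]
    change (r⁻¹ • (1 + M)) * (r⁻¹ • (1 + M)) = M
    have h1 := Matrix.mul_self_fin_two M
    rw [hdetM, one_smul] at h1
    have h3 : (1 + M) * (1 + M) = (r * r) • M := by
      rw [← hr, add_mul, mul_add, mul_add, h1]
      simp only [one_mul, mul_one]
      module
    rw [smul_mul_smul_comm, h3, smul_smul]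
    rw [show r⁻¹ * r⁻¹ * (r * r) = 1 by field_simp, one_smul]
  have hord : orderOf c = 4 * n := by
    have h1 := orderOf_pow' c two_ne_zero
    rw [hc2, ha] at h1
    rcases (Nat.dvd_prime Nat.prime_two).1 (Nat.gcd_dvd_right (orderOf c) 2) with h3 | h3
    · rw [h3, Nat.div_one] at h1
      rw [← h1, Nat.gcd_eq_right (by omega)] at h3
      omega
    · rw [h3] at h1
      have := Nat.gcd_dvd_left (orderOf c) 2
      rw [h3] at this
      omega
  rw [← hord]
  refine congPM_orderOf hp ?_
  rw [hord, show 4 * n = 2 * (2 * n) by ring]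
  exact Nat.Coprime.mul_left (hnp.coprime_dvd_left (dvd_mul_right 2 n)) hnp

end Count

end DicyclicCount

/-! ### The isomorphism of `2A₅` with `SL₂(𝔽₅)`. -/

theorem eq_top_of_transvections_mem {K : Type*} [Field K] {H : Subgroup SL(2, K)}
    (hU : ∀ (x : K) (u : SL(2, K)), (u : Matrix (Fin 2) (Fin 2) K) = !![1, x; 0, 1] → u ∈ H)
    (hL : ∀ (x : K) (u : SL(2, K)), (u : Matrix (Fin 2) (Fin 2) K) = !![1, 0; x, 1] → u ∈ H) :
    H = ⊤ := by
  have key : ∀ g : SL(2, K), (g : Matrix (Fin 2) (Fin 2) K) 1 0 ≠ 0 → g ∈ H := by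
    intro g hg
    have hdet := g.2
    rw [Matrix.det_fin_two] at hdet
    set M := (g : Matrix (Fin 2) (Fin 2) K) with hM
    let u : SL(2, K) := ⟨!![1, (M 0 0 - 1) / M 1 0; 0, 1], by simp⟩
    let l : SL(2, K) := ⟨!![1, 0; M 1 0, 1], by simp⟩
    let v : SL(2, K) := ⟨!![1, (M 1 1 - 1) / M 1 0; 0, 1], by simp⟩
    have : u * l * v = g := by
      apply Subtype.ext
      change !![1, (M 0 0 - 1) / M 1 0; 0, 1] * !![1, 0; M 1 0, 1] *
        !![1, (M 1 1 - 1) / M 1 0; 0, 1] = M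
      ext i j
      fin_cases i <;> fin_cases j <;> simp <;> field_simp
      · ring
      · linear_combination hdet
      · ring
    rw [← this]
    exact mul_mem (mul_mem (hU _ u rfl) (hL _ l rfl)) (hU _ v rfl)
  rw [eq_top_iff]
  intro g _
  by_cases hg : (g : Matrix (Fin 2) (Fin 2) K) 1 0 = 0
  · let l : SL(2, K) := ⟨!![1, 0; 1, 1], by simp⟩
    have h1 : l * g ∈ H := by
      apply key
      intro h0
      have hdet := g.2
      rw [Matrix.det_fin_two] at hdet
      rw [Matrix.SpecialLinearGroup.coe_mul, Matrix.mul_apply, Fin.sum_univ_two, hg] at h0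
      simp [l] at h0
      rw [h0, hg] at hdet
      simp at hdet
    have := mul_mem (inv_mem (hL 1 l rfl)) h1
    rwa [inv_mul_cancel_left] at this
  · exact key g hg

/-- The comparison with quaternions needs only `p ≥ 5`. Modulo `5` the golden relation has the
double root `3 = -2`, so `t` is minus a transvection, and `s`, `t` generate everything. -/
theorem nonempty_binaryIcosahedral_mulEquiv : Nonempty (BinaryIcosahedral ≃* SL(2, ZMod 5)) := by
  let s : SL(2, ZMod 5) := ⟨!![0, -1; 1, 1], by decide⟩
  let t : SL(2, ZMod 5) := ⟨!![-1, 1; 0, -1], by decide⟩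
  have hs1 : (s : Matrix (Fin 2) (Fin 2) (ZMod 5)).trace = 1 := by decide
  have ht3 : (t : Matrix (Fin 2) (Fin 2) (ZMod 5)).trace ^ 2 =
      (t : Matrix (Fin 2) (Fin 2) (ZMod 5)).trace + 1 := by decide
  have hst0 : ((s * t : SL(2, ZMod 5)) : Matrix (Fin 2) (Fin 2) (ZMod 5)).trace = 0 := by decide
  -- The even power `t⁴` removes the sign and is the upper transvection with entry `-4 = 1`.
  have hU : ∀ x : ZMod 5, (!![1, x; 0, 1] : Matrix (Fin 2) (Fin 2) (ZMod 5)) =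
      (t ^ (4 * x.val) : SL(2, ZMod 5)) := by decide
  have hL : ∀ x : ZMod 5, (!![1, 0; x, 1] : Matrix (Fin 2) (Fin 2) (ZMod 5)) =
      ((s * t * s⁻¹) ^ (6 * x.val) : SL(2, ZMod 5)) := by decide
  have : Fact (Nat.Prime 5) := ⟨by norm_num⟩
  have hst : IsPolyPair 5 s t := ⟨hs1, Or.inr (Or.inr ⟨rfl, ht3⟩), hst0⟩
  have hs : s ∈ Subgroup.closure {s, t} := Subgroup.subset_closure (by simp)
  have ht : t ∈ Subgroup.closure {s, t} := Subgroup.subset_closure (by simp)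
  have htop : Subgroup.closure {s, t} = ⊤ := by
    apply eq_top_of_transvections_mem
    · intro x u hu
      rw [Subtype.ext (hu.trans (hU x))]
      exact pow_mem ht _
    · intro x u hu
      rw [Subtype.ext (hu.trans (hL x))]
      exact pow_mem (mul_mem (mul_mem hs ht) (inv_mem hs)) _
  obtain ⟨e⟩ : HasType (Subgroup.closure {s, t}) .twoA5 := hst.hasType le_rfl
  rw [htop] at e
  exact ⟨e.symm.trans Subgroup.topEquiv⟩

theorem proposition3p8 (p : ℕ) [Fact p.Prime] (hp : 3 < p) :
    -- every subgroup of order prime to `p` has exactly one of the listed types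
    (∀ H : Subgroup SL(2, ZMod p), (Nat.card H).Coprime p →
      ∃! τ : SubgroupType, Listed p τ ∧ HasType H τ) ∧
    -- the number of conjugacy classes of each type
    (∀ n : ℕ, 1 ≤ n → CongPM p n → numClasses p (.C n) = 1) ∧
    (∀ n : ℕ, 2 < 2 * n → CongPM p (4 * n) → numClasses p (.twoD n) = 2) ∧
    (∀ n : ℕ, 2 < 2 * n → CongPM p (2 * n) → ¬ CongPM p (4 * n) →
      numClasses p (.twoD n) = 1) ∧
    (CongPM p 8 → numClasses p .twoA4 = 2) ∧
    (¬ CongPM p 8 → numClasses p .twoA4 = 1) ∧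
    (CongPM p 8 → numClasses p .twoS4 = 2) ∧
    (¬ CongPM p 8 → numClasses p .twoS4 = 0) ∧
    (CongPM p 5 → numClasses p .twoA5 = 2) ∧
    (¬ CongPM p 5 → numClasses p .twoA5 = 0) ∧
    Nonempty (BinaryIcosahedral ≃* SL(2, ZMod 5)) := by
  refine ⟨fun H hc => ?_, fun n hn h => numClasses_C hp hn h,
    fun n hn h => numClasses_twoD_eq_two hp (by omega) h,
    fun n hn h h' => numClasses_twoD_eq_one hp (by omega) h h',
    numClasses_twoA4_eq_two hp, numClasses_twoA4_eq_one hp, numClasses_twoS4_eq_two hp,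
    numClasses_twoS4_eq_zero hp, numClasses_twoA5_eq_two hp, numClasses_twoA5_eq_zero hp,
    nonempty_binaryIcosahedral_mulEquiv⟩
  obtain ⟨τ, hτ, hH⟩ := exists_listed hp hc
  exact ⟨τ, ⟨hτ, hH⟩, fun τ' h => listed_unique hp hc h.1 hτ h.2 hH⟩
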